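/- Theorem 2.3. For a complex-valued $p\in L_1(0,1)$ consider the differential expression $$l_3(y)=y'''+(py)'+py',\qquad x\in(0,1),$$ understood through the quasi-derivatives $y^{[0]}=y$, $y^{[1]}=y'$, $y^{[2]}=(y^{[1]})'+py$, $y^{[3]}=(y^{[2]})'+py^{[1]}$, that is, $l_3(y)=y^{[3]}$ on the domain of functions $y$ such that $y^{[0]},y^{[1]},y^{[2]}$ are absolutely continuous on $[0,1]$. A solution of $l_3(y)=\lambda y$ is a function $y$ of this domain that satisfies the equation a.e. on $(0,1)$. Put $U_s(y)=y^{[3-s]}(0)$ and $V_s(y)=y^{[3-s]}(1)$ for $s=1,2,3$. For $\lambda\in\mathbb C$ let $C_1(\cdot,\lambda),C_2(\cdot,\lambda),C_3(\cdot,\lambda)$ be the solutions of $l_3(y)=\lambda y$ with $U_s(C_k)=\delta_{s,k}$, $s,k=1,2,3$, and let $\Delta_{k,k}(\lambda)=\det[V_s(C_r)]_{s,r=k+1}^{3}$, $k=1,2,3$ (so $\Delta_{3,3}\equiv 1$). We say that $p$ satisfies the separation condition if for $m=1,2$ the functions $\Delta_{m,m}$ and $\Delta_{m+1,m+1}$ have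 no common zeros in $\mathbb C$. For $i\in\{1,2\}$ let $\mathfrak S_i$ be the spectrum of the boundary value problem $$l_3(y)=\lambda y,\qquad U_i(y)=0,\quad V_2(y)=V_3(y)=0,$$ that is, the multiset of its eigenvalues, each counted with its algebraic multiplicity (the dimension of its root subspace, spanned by the eigenfunctions and associated functions). Let $p,\tilde p\in L_1(0,1)$ be complex-valued and both satisfy the separation condition, and let $\mathfrak S_i$, $\tilde{\mathfrak S}_i$ be the corresponding spectra. If $\mathfrak S_1=\tilde{\mathfrak S}_1$ and $\mathfrak S_2=\tilde{\mathfrak S}_2$, then $p=\tilde p$ in $L_1(0,1)$, i.e. almost everywhere on $(0,1)$. Consequently, the two spectra $\mathfrak S_1,\mathfrak S_2$ determine $p$ uniquely. -/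

import Mathlib

noncomputable section

namespace ThirdOrder

open MeasureTheory Set

/-- The associated matrix `F(x)` of `l_3(y) = y''' + (p y)' + p y'`. -/
def assocMatrix (p : ℝ → ℂ) (x : ℝ) : Matrix (Fin 3) (Fin 3) ℂ :=
  !![0, 1, 0; -p x, 0, 1; 0, -p x, 0]

/-- `IsQuasi F Y g`: on `[0,1]` the functions `Y 0, Y 1, Y 2` are the quasi-derivatives
`y^{[0]}, y^{[1]}, y^{[2]}` (generated by the matrix function `F`) of the function `y = Y 0`,
they are absolutely continuous on `[0,1]` (so that `y` lies in the domain `D_F`), and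
`y^{[3]} = g` a.e. on `(0,1)`. The quasi-derivatives are
`y^{[k]} = (y^{[k-1]})' - ∑_{j=1}^{k} f_{k,j} y^{[j-1]}`, `k = 1, 2, 3`;
the rows and columns of `F` are numbered from `0` here, and a function on `[0,1]` is
extended to `ℝ` by constants only in order to be differentiated at points of `(0,1)`. -/
structure IsQuasi (F : ℝ → Matrix (Fin 3) (Fin 3) ℂ) (Y : Fin 3 → unitInterval → ℂ)
    (g : unitInterval → ℂ) : Prop where
  ac : ∀ k, AbsolutelyContinuousOnInterval (IccExtend zero_le_one (Y k)) 0 1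
  quasi_one : ∀ᵐ x : ℝ, ∀ hx : x ∈ Ioo (0 : ℝ) 1,
    HasDerivAt (IccExtend zero_le_one (Y 0))
      (Y 1 ⟨x, Ioo_subset_Icc_self hx⟩
        + F x 0 0 * Y 0 ⟨x, Ioo_subset_Icc_self hx⟩) x
  quasi_two : ∀ᵐ x : ℝ, ∀ hx : x ∈ Ioo (0 : ℝ) 1,
    HasDerivAt (IccExtend zero_le_one (Y 1))
      (Y 2 ⟨x, Ioo_subset_Icc_self hx⟩
        + (F x 1 0 * Y 0 ⟨x, Ioo_subset_Icc_self hx⟩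
          + F x 1 1 * Y 1 ⟨x, Ioo_subset_Icc_self hx⟩)) x
  quasi_three : ∀ᵐ x : ℝ, ∀ hx : x ∈ Ioo (0 : ℝ) 1,
    HasDerivAt (IccExtend zero_le_one (Y 2))
      (g ⟨x, Ioo_subset_Icc_self hx⟩
        + (F x 2 0 * Y 0 ⟨x, Ioo_subset_Icc_self hx⟩
          + F x 2 1 * Y 1 ⟨x, Ioo_subset_Icc_self hx⟩
          + F x 2 2 * Y 2 ⟨x, Ioo_subset_Icc_self hx⟩)) x

/-- `U_s(y) = y^{[3-s]}(0)`. The indices `s = 1, 2, 3` are numbered `0, 1, 2` here. -/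
def formU (s : Fin 3) (Y : Fin 3 → unitInterval → ℂ) : ℂ := Y s.rev 0

/-- `V_s(y) = y^{[3-s]}(1)`. The indices `s = 1, 2, 3` are numbered `0, 1, 2` here. -/
def formV (s : Fin 3) (Y : Fin 3 → unitInterval → ℂ) : ℂ := Y s.rev 1

/-- `Y` is the vector of quasi-derivatives of a solution `y` of `l_3(y) = lam * y`. -/
def IsSolution (p : ℝ → ℂ) (lam : ℂ) (Y : Fin 3 → unitInterval → ℂ) : Prop :=
  IsQuasi (assocMatrix p) Y (lam • Y 0)

/-- `C 0, C 1, C 2` are (the quasi-derivative vectors of) the solutions `C_1, C_2, C_3` of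
`l_3(y) = lam * y` with the initial conditions `U_s(C_k) = δ_{s,k}`. For integrable `p` there is
exactly one such triple for every `lam`. -/
def IsFundamental (p : ℝ → ℂ) (lam : ℂ) (C : Fin 3 → Fin 3 → unitInterval → ℂ) : Prop :=
  (∀ k, IsSolution p lam (C k)) ∧ ∀ s k, formU s (C k) = if s = k then 1 else 0

/-- `Δ_{k,k} = det [V_s(C_r)]_{s,r = k+1}^{3}` (the empty determinant, for the last `k`, is `1`). -/
def diagDelta (C : Fin 3 → Fin 3 → unitInterval → ℂ) (k : Fin 3) : ℂ :=
  Matrix.det (Matrix.of fun s r : {r : Fin 3 // k < r} => formV s.1 (C r.1))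

/-- The separation condition: `Δ_{m,m}(lam)` and `Δ_{m+1,m+1}(lam)`, `m = 1, 2`, have no common
zeros `lam`. -/
def Separated (p : ℝ → ℂ) : Prop :=
  ∀ (m : Fin 2) (lam : ℂ) (C : Fin 3 → Fin 3 → unitInterval → ℂ), IsFundamental p lam C →
    ¬ (diagDelta C m.castSucc = 0 ∧ diagDelta C m.succ = 0)

theorem IsQuasi.zero (F : ℝ → Matrix (Fin 3) (Fin 3) ℂ) : IsQuasi F 0 0 := by
  have h0 : IccExtend (zero_le_one (α := ℝ)) (0 : unitInterval → ℂ) = fun _ => 0 := rfl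
  refine ⟨fun k => ?_, ?_, ?_, ?_⟩
  · have : LipschitzOnWith 0 (fun _ : ℝ => (0 : ℂ)) (uIcc 0 1) :=
      (LipschitzWith.const (0 : ℂ)).lipschitzOnWith
    exact this.absolutelyContinuousOnInterval
  all_goals
    refine Filter.Eventually.of_forall fun x hx => ?_
    simpa [h0] using hasDerivAt_const x (0 : ℂ)

theorem IsQuasi.add {F : ℝ → Matrix (Fin 3) (Fin 3) ℂ} {Y Z : Fin 3 → unitInterval → ℂ}
    {g h : unitInterval → ℂ} (hY : IsQuasi F Y g) (hZ : IsQuasi F Z h) :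
    IsQuasi F (Y + Z) (g + h) := by
  refine ⟨fun k => (hY.ac k).add (hZ.ac k), ?_, ?_, ?_⟩
  · filter_upwards [hY.quasi_one, hZ.quasi_one] with x h1 h2 hx
    refine ((h1 hx).add (h2 hx)).congr_deriv ?_
    simp only [Pi.add_apply]; ring
  · filter_upwards [hY.quasi_two, hZ.quasi_two] with x h1 h2 hx
    refine ((h1 hx).add (h2 hx)).congr_deriv ?_
    simp only [Pi.add_apply]; ring
  · filter_upwards [hY.quasi_three, hZ.quasi_three] with x h1 h2 hx
    refine ((h1 hx).add (h2 hx)).congr_deriv ?_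
    simp only [Pi.add_apply]; ring

theorem IsQuasi.smul {F : ℝ → Matrix (Fin 3) (Fin 3) ℂ} {Y : Fin 3 → unitInterval → ℂ}
    {g : unitInterval → ℂ} (c : ℂ) (hY : IsQuasi F Y g) : IsQuasi F (c • Y) (c • g) := by
  refine ⟨fun k => (hY.ac k).const_smul c, ?_, ?_, ?_⟩
  · filter_upwards [hY.quasi_one] with x h1 hx
    refine ((h1 hx).const_smul c).congr_deriv ?_
    simp only [Pi.smul_apply, smul_eq_mul]; ring
  · filter_upwards [hY.quasi_two] with x h1 hx
    refine ((h1 hx).const_smul c).congr_deriv ?_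
    simp only [Pi.smul_apply, smul_eq_mul]; ring
  · filter_upwards [hY.quasi_three] with x h1 hx
    refine ((h1 hx).const_smul c).congr_deriv ?_
    simp only [Pi.smul_apply, smul_eq_mul]; ring

/-- The graph of `y ↦ l_3(y) - lam * y` on the functions `y` of the domain `D_F` that satisfy the
boundary conditions `U_i(y) = 0`, `V_2(y) = V_3(y) = 0`: the pairs `(y, g)` with
`l_3(y) - lam * y = g` a.e. on `(0,1)`. -/
def bvpGraph (p : ℝ → ℂ) (i : Fin 3) (lam : ℂ) :
    Submodule ℂ ((unitInterval → ℂ) × (unitInterval → ℂ)) where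
  carrier := {q | ∃ Y : Fin 3 → unitInterval → ℂ, Y 0 = q.1 ∧
    IsQuasi (assocMatrix p) Y (lam • q.1 + q.2) ∧
    formU i Y = 0 ∧ formV 1 Y = 0 ∧ formV 2 Y = 0}
  zero_mem' := ⟨0, rfl, by simpa using IsQuasi.zero (assocMatrix p), rfl, rfl, rfl⟩
  add_mem' := by
    rintro ⟨y, g⟩ ⟨z, h⟩ ⟨Y, rfl, hY, a1, a2, a3⟩ ⟨Z, rfl, hZ, b1, b2, b3⟩
    refine ⟨Y + Z, rfl, ?_, ?_, ?_, ?_⟩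
    · have := hY.add hZ
      convert this using 1
      simp only [Prod.fst_add, Prod.snd_add, smul_add]; abel
    all_goals simp_all [formU, formV]
  smul_mem' := by
    rintro c ⟨y, g⟩ ⟨Y, rfl, hY, a1, a2, a3⟩
    refine ⟨c • Y, rfl, ?_, ?_, ?_, ?_⟩
    · have := hY.smul c
      convert this using 1
      simp only [Prod.smul_fst, Prod.smul_snd, smul_add, smul_comm c lam]
    all_goals simp_all [formU, formV]

/-- The kernel of the `m`-th power of `l_3 - lam` under the boundary conditions
`U_i(y) = 0`, `V_2(y) = V_3(y) = 0`; its elements, for `m ≥ 1`, are the eigenfunctions and the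
associated functions of order below `m` (and zero). -/
def rootKer (p : ℝ → ℂ) (i : Fin 3) (lam : ℂ) : ℕ → Submodule ℂ (unitInterval → ℂ)
  | 0 => ⊥
  | m + 1 => (bvpGraph p i lam ⊓ (rootKer p i lam m).comap (LinearMap.snd ℂ _ _)).map
      (LinearMap.fst ℂ _ _)

/-- The root subspace (generalized eigenspace) at `lam` of the boundary value problem
`l_3(y) = lam * y`, `U_i(y) = 0`, `V_2(y) = V_3(y) = 0`. -/
def rootSpace (p : ℝ → ℂ) (i : Fin 3) (lam : ℂ) : Submodule ℂ (unitInterval → ℂ) :=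
  ⨆ m, rootKer p i lam m

/-- The spectrum, as a multiset: it assigns to each `lam` its algebraic multiplicity as an
eigenvalue of `l_3(y) = lam * y`, `U_i(y) = 0`, `V_2(y) = V_3(y) = 0`
(`0` if `lam` is no eigenvalue). -/
def spectrumMult (p : ℝ → ℂ) (i : Fin 3) (lam : ℂ) : Cardinal :=
  Module.rank ℂ (rootSpace p i lam)

end ThirdOrder

end

noncomputable section

namespace ThirdOrder

open MeasureTheory Set Filter Topology Real

/-! ### Entire functions of growth order at most one half -/

/-! The proof follows the method of spectral mappings. The equation is a first order system for the
vector of quasi-derivatives, with the fundamental matrix `fund`. Let b = `endSol` be the initial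
vector of the solution with end values y = y^{[1]} = 0, y^{[2]} = 1. The eigenvalues for i = 1, 2
are the zeros of the entire functions b 2 and b 1. The Taylor coefficients of that solution in the
spectral parameter form chains of associated functions, so algebraic multiplicities are orders of
zeros (`spectrumMult_eq`). These functions have order below one, and on lam = ±i s^3, s → ∞, their
ratios for the two coefficients tend to 1. Hence equal spectra force equal functions
(`endSol_eq_of_spectrumMult_eq`).

By Lagrange's identity (`SolvesSystem.lagrange`) b 1 and b 2 at -lam are, up to sign, entries of the
first row of `fund` at the point 1. So the three Weyl type solutions, given by y(1) = y^{[1]}(1) =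
0, by y^{[2]}(0) = y(1) = 0, and by y^{[1]}(0) = y^{[2]}(0) = 0, have the same initial vectors for p
and q up to scalar factors and one unknown: a shear by d = (b 0 - b' 0) / b 2, where b' belongs to
q. This d is also a quotient with denominator `fund` 1 0 0. The separation condition says that the
two denominators have no common zero, so d is entire (`exists_entire_of_mul_eq_mul`).

Consequently `transitionMatrix`, which carries the Weyl solutions for q to those for p, is entire of
order below one. Both families have the same leading asymptotics, so its first row tends to (1, 0,
0) on both halves of the imaginary axis (`tendsto_transitionMatrix`). Phragmén–Lindelöf and
Liouville make this row constant. Solutions for p and q then share their zeroth components, from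
which the coefficient is recovered (`SolvesSystem.ae_sub_mul_sq_eq_zero`).

The growth bound exp(C |lam|^(1/2)) is cruder than the true exponent 1/3, but only an exponent below
one is needed. -/

/-- The function `F` grows at most like `exp (C * |z| ^ (1 / 2))`. -/
def HalfGrowth (F : ℂ → ℂ) : Prop :=
  ∃ C : ℝ, 0 ≤ C ∧ ∀ z, ‖F z‖ ≤ exp (C * √(1 + ‖z‖))

/-- Polar coordinates about `c`; this turns mean value inequalities on circles into inequalities on
discs. -/
theorem setIntegral_ball_eq_circleAverage {u : ℂ → ℝ} (hu : Continuous u) (c : ℂ) {R : ℝ}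
    (hR : 0 ≤ R) :
    ∫ z in Metric.ball c R, u z = ∫ r in (0 : ℝ)..R, r * (2 * π * circleAverage u c r) := by
  have h1 : ∫ z in Metric.ball c R, u z
      = ∫ z, (Metric.ball (0 : ℂ) R).indicator (fun z => u (z + c)) z := by
    rw [← integral_indicator Metric.isOpen_ball.measurableSet,
      ← integral_add_right_eq_self (μ := volume) _ c]
    congr 1
    ext z
    simp [indicator]
  have hT : polarCoord.target = Ioi (0 : ℝ) ×ˢ Ioo (-π) π := rfl
  have h2 : (fun p : ℝ × ℝ => p.1 • (Metric.ball (0 : ℂ) R).indicator (fun z => u (z + c))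
        (Complex.polarCoord.symm p)) =ᵐ[volume.restrict (Ioi (0 : ℝ) ×ˢ Ioo (-π) π)]
      ((Iio R) ×ˢ univ).indicator (fun p : ℝ × ℝ => p.1 * u (circleMap c p.1 p.2)) := by
    filter_upwards [ae_restrict_mem (measurableSet_Ioi.prod measurableSet_Ioo)] with p hp
    have hp1 : 0 < p.1 := hp.1
    have h3 : Complex.polarCoord.symm p = circleMap 0 p.1 p.2 := by
      rw [Complex.polarCoord_symm_apply, circleMap, Complex.exp_mul_I]; simp
    have h4 : circleMap 0 p.1 p.2 + c = circleMap c p.1 p.2 := by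
      simp [circleMap, add_comm]
    rw [h3]
    by_cases h : p.1 < R
    · rw [indicator_of_mem, indicator_of_mem, h4, smul_eq_mul]
      · exact ⟨h, mem_univ _⟩
      · simpa [abs_of_pos hp1] using h
    · rw [indicator_of_notMem, indicator_of_notMem, smul_zero]
      · exact fun h' => h h'.1
      · simpa [abs_of_pos hp1] using h
  rw [h1, ← Complex.integral_comp_polarCoord_symm, hT, integral_congr_ae h2,
    setIntegral_indicator (measurableSet_Iio.prod MeasurableSet.univ)]
  have h5 : (Ioi (0 : ℝ) ×ˢ Ioo (-π) π) ∩ (Iio R ×ˢ univ) = Ioo 0 R ×ˢ Ioo (-π) π := by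
    rw [prod_inter_prod, inter_univ, Ioi_inter_Iio]
  have hc : Continuous fun p : ℝ × ℝ => p.1 * u (circleMap c p.1 p.2) := by
    have : Continuous fun p : ℝ × ℝ => circleMap c p.1 p.2 := circleMap.continuous
    fun_prop
  rw [h5, Measure.volume_eq_prod, setIntegral_prod, intervalIntegral.integral_of_le hR,
    ← integral_Ioc_eq_integral_Ioo]
  · refine setIntegral_congr_fun measurableSet_Ioc fun r _ => ?_
    simp only
    rw [integral_const_mul, ← integral_Ioc_eq_integral_Ioo,
      ← intervalIntegral.integral_of_le (by linarith [pi_pos]),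
      circleAverage_eq_integral_add (-π), intervalIntegral.integral_comp_add_right
        (fun θ => u (circleMap c r θ)) (-π), smul_eq_mul]
    rw [show (0 : ℝ) + -π = -π by ring, show 2 * π + -π = π by ring]
    field_simp
  · refine IntegrableOn.mono_set ?_ (prod_mono Ioo_subset_Icc_self Ioo_subset_Icc_self)
    exact hc.continuousOn.integrableOn_compact (isCompact_Icc.prod isCompact_Icc)

/-- By Jensen's formula the difference is a sum over the zeros in the disc of nonnegative terms. -/
theorem log_norm_le_circleAverage {f : ℂ → ℂ} (hf : Differentiable ℂ f) {c : ℂ} (hc : f c ≠ 0)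
    {r : ℝ} (hr : 0 < r) : log ‖f c‖ ≤ circleAverage (fun z => log ‖f z‖) c r := by
  have han : AnalyticOnNhd ℂ f (Metric.closedBall c |r|) := fun z _ => hf.analyticAt z
  rw [han.circleAverage_log_norm hr.ne' hc]
  refine le_add_of_nonneg_left (finsum_nonneg fun u => ?_)
  by_cases hu : u ∈ Metric.closedBall c |r|
  · refine mul_nonneg (mod_cast MeromorphicOn.AnalyticOnNhd.divisor_nonneg han u) ?_
    -- For `u = c` the logarithm is `log 0 = 0` by the conventions for `⁻¹` and `log`.
    rcases eq_or_ne u c with rfl | huc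
    · simp
    apply log_nonneg
    have h0 : 0 < ‖c - u‖ := norm_pos_iff.2 (sub_ne_zero.2 huc.symm)
    rw [mem_closedBall_iff_norm', abs_of_pos hr] at hu
    rw [← div_eq_mul_inv, le_div_iff₀ h0]
    linarith
  · simp [hu]

theorem posLog_norm_le_circleAverage {f : ℂ → ℂ} (hf : Differentiable ℂ f) (c : ℂ)
    {r : ℝ} (hr : 0 < r) : log⁺ ‖f c‖ ≤ circleAverage (fun z => log⁺ ‖f z‖) c r := by
  have hcont : Continuous fun z => log⁺ ‖f z‖ := continuous_posLog.comp hf.continuous.norm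
  have h0 : 0 ≤ circleAverage (fun z => log⁺ ‖f z‖) c r := by
    simpa [circleAverage_const] using
      circleAverage_mono (f₁ := fun _ => (0 : ℝ)) (c := c) (R := r)
        continuous_const.continuousOn.circleIntegrable'
        hcont.continuousOn.circleIntegrable' fun z _ => posLog_nonneg
  rcases eq_or_ne (f c) 0 with hc | hc
  · simpa [hc] using h0
  refine max_le h0 ((log_norm_le_circleAverage hf hc hr).trans ?_)
  refine circleAverage_mono ?_ hcont.continuousOn.circleIntegrable' fun z _ => le_max_right _ _
  exact MeromorphicOn.circleIntegrable_log_norm fun z _ => (hf.analyticAt z).meromorphicAt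

/-- Since f = N / D, log⁺|f| ≤ log⁺|N| + log⁺|1/D| and log⁺|1/D| = log⁺|D| - log|D|. Jensen bounds
the mean of log|D| below by its value at the centre, so no lower bound for D on the circle is
needed. -/
theorem circleAverage_posLog_le_of_mul_eq {f D N : ℂ → ℂ} (hf : Differentiable ℂ f)
    (hD : Differentiable ℂ D) (hN : Differentiable ℂ N) (h : ∀ z, f z * D z = N z) {c : ℂ}
    (hc : D c ≠ 0) {r : ℝ} (hr : 0 < r) :
    circleAverage (fun z => log⁺ ‖f z‖) c r ≤ circleAverage (fun z => log⁺ ‖N z‖) c r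
      + circleAverage (fun z => log⁺ ‖D z‖) c r - log ‖D c‖ := by
  have hcont : ∀ {g : ℂ → ℂ}, Differentiable ℂ g → CircleIntegrable (fun z => log⁺ ‖g z‖) c r :=
    fun hg => (continuous_posLog.comp hg.continuous.norm).continuousOn.circleIntegrable'
  have hDi : CircleIntegrable (fun z => log ‖D z‖) c r :=
    MeromorphicOn.circleIntegrable_log_norm fun z _ => (hD.analyticAt z).meromorphicAt
  have hDn : ∀ᶠ z in codiscreteWithin (Metric.sphere c |r|), D z ≠ 0 := by
    have := AnalyticOnNhd.preimage_zero_mem_codiscrete (f := D) (x := c)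
      (fun z _ => hD.analyticAt z) hc
    exact (codiscreteWithin_mono (subset_univ _)) this
  -- At a zero of `D` the right side of the pointwise bound is 0 by the convention `log 0 = 0`, so
  -- `f` must be discarded there; these points do not affect the average.
  have heq : (fun z => log⁺ ‖f z‖) =ᶠ[codiscreteWithin (Metric.sphere c |r|)]
      fun z => if D z = 0 then 0 else log⁺ ‖f z‖ := by
    filter_upwards [hDn] with z hz
    simp [hz]
  have hle : circleAverage (fun z => log⁺ ‖f z‖) c r ≤
      circleAverage (fun z => log⁺ ‖N z‖ + log⁺ ‖D z‖ - log ‖D z‖) c r := by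
    rw [circleAverage_congr_codiscreteWithin heq hr.ne']
    refine circleAverage_mono ((hcont hf).congr_codiscreteWithin heq)
      (((hcont hN).add (hcont hD)).sub hDi) fun z _ => ?_
    split_ifs with hz
    · simpa [hz] using posLog_nonneg
    · have h1 : f z = N z * (D z)⁻¹ := by rw [← h z]; field_simp
      rw [h1, norm_mul, norm_inv]
      refine posLog_mul.trans ?_
      have := posLog_sub_posLog_inv (x := ‖D z‖)
      linarith
  have h3 : circleAverage (fun z => log⁺ ‖N z‖ + log⁺ ‖D z‖ - log ‖D z‖) c r
      = circleAverage (fun z => log⁺ ‖N z‖) c r + circleAverage (fun z => log⁺ ‖D z‖) c r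
        - circleAverage (fun z => log ‖D z‖) c r := by
    have := circleAverage_sub ((hcont hN).add (hcont hD)) hDi
    have h' := circleAverage_add (hcont hN) (hcont hD)
    rw [h'] at this
    exact this
  have := log_norm_le_circleAverage hD hc hr
  linarith

/-- An entire quotient of two entire functions of growth order at most one half is again of
growth order at most one half. -/
theorem HalfGrowth.of_mul_eq {f D N : ℂ → ℂ} (hf : Differentiable ℂ f)
    (hD : Differentiable ℂ D) (hN : Differentiable ℂ N) (h : ∀ z, f z * D z = N z) {c : ℂ}
    (hc : D c ≠ 0) (gD : HalfGrowth D) (gN : HalfGrowth N) : HalfGrowth f := by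
  obtain ⟨A, hA0, hA⟩ := gD
  obtain ⟨B, hB0, hB⟩ := gN
  have hu : Continuous fun z => log⁺ ‖f z‖ := continuous_posLog.comp hf.continuous.norm
  have key : ∀ {g : ℂ → ℂ} {C : ℝ}, 0 ≤ C → Differentiable ℂ g →
      (∀ z, ‖g z‖ ≤ exp (C * √(1 + ‖z‖))) → ∀ r, 0 < r →
      circleAverage (fun z => log⁺ ‖g z‖) c r ≤ C * √(1 + ‖c‖ + r) := by
    intro g C hC hg hgC r hr
    refine circleAverage_mono_on_of_le_circle
      (continuous_posLog.comp hg.continuous.norm).continuousOn.circleIntegrable' fun z hz => ?_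
    rw [mem_sphere_iff_norm, abs_of_pos hr] at hz
    have hz' : ‖z‖ ≤ ‖c‖ + r := by
      calc ‖z‖ = ‖c + (z - c)‖ := by congr 1; ring
        _ ≤ _ := (norm_add_le _ _).trans (by rw [hz])
    refine (posLog_le_posLog (norm_nonneg _) (hgC z)).trans ?_
    have h0 : 0 ≤ C * √(1 + ‖z‖) := by positivity
    rw [posLog_apply, log_exp, max_eq_right h0]
    refine mul_le_mul_of_nonneg_left (sqrt_le_sqrt ?_) hC
    linarith
  set L : ℝ := |log ‖D c‖| with hL
  have hav : ∀ R, ∀ r, 0 < r → r ≤ R → circleAverage (fun z => log⁺ ‖f z‖) c r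
      ≤ (A + B) * √(1 + ‖c‖ + R) + L := by
    intro R r hr hrR
    have h1 := circleAverage_posLog_le_of_mul_eq hf hD hN h hc hr
    have h2 := key hA0 hD hA r hr
    have h3 := key hB0 hN hB r hr
    have h4 : √(1 + ‖c‖ + r) ≤ √(1 + ‖c‖ + R) := by gcongr
    have h5 : -log ‖D c‖ ≤ L := neg_le_abs _
    nlinarith
  -- The averages are about the fixed centre `c`. The disc of radius R about z lies in the disc of
  -- radius 2R about `c`; the factor 4 is the ratio of the areas.
  have hpt : ∀ z, log⁺ ‖f z‖ ≤ 4 * ((A + B) * √(1 + ‖c‖ + 2 * (1 + ‖c‖ + ‖z‖)) + L) := by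
    intro z
    set R := 1 + ‖c‖ + ‖z‖ with hR
    have hRpos : 0 < R := by positivity
    set M := (A + B) * √(1 + ‖c‖ + 2 * R) + L with hM
    have hM0 : 0 ≤ M := by positivity
    have hcu : ∀ w, Continuous fun r : ℝ => r * (2 * π * circleAverage (fun z => log⁺ ‖f z‖) w r) :=
      fun w => by have := hu.circleAverage (c := w); fun_prop
    have l1 : log⁺ ‖f z‖ * (π * R ^ 2) ≤ ∫ w in Metric.ball z R, log⁺ ‖f w‖ := by
      rw [setIntegral_ball_eq_circleAverage hu z hRpos.le]
      have : ∫ r in (0 : ℝ)..R, r * (2 * π * log⁺ ‖f z‖) = log⁺ ‖f z‖ * (π * R ^ 2) := by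
        rw [intervalIntegral.integral_mul_const, integral_id]; ring
      rw [← this]
      refine intervalIntegral.integral_mono_on hRpos.le
        ((by fun_prop : Continuous fun r : ℝ => r * (2 * π * log⁺ ‖f z‖)).intervalIntegrable _ _)
        ((hcu z).intervalIntegrable _ _) fun r hr => ?_
      rcases hr.1.eq_or_lt with h0 | h0
      · simp [← h0]
      · have := posLog_norm_le_circleAverage hf z h0
        have hp := pi_pos
        gcongr
    have l2 : ∫ w in Metric.ball z R, log⁺ ‖f w‖ ≤ ∫ w in Metric.ball c (2 * R), log⁺ ‖f w‖ := by
      refine setIntegral_mono_set ?_ (Eventually.of_forall fun w => posLog_nonneg) ?_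
      · exact (hu.continuousOn.integrableOn_compact (isCompact_closedBall c (2 * R))).mono_set
          Metric.ball_subset_closedBall
      · refine LE.le.eventuallyLE (Metric.ball_subset_ball' ?_)
        rw [dist_eq_norm]
        have := norm_sub_le z c
        linarith
    have l3 : ∫ w in Metric.ball c (2 * R), log⁺ ‖f w‖ ≤ M * (π * (2 * R) ^ 2) := by
      rw [setIntegral_ball_eq_circleAverage hu c (by positivity)]
      have : ∫ r in (0 : ℝ)..(2 * R), r * (2 * π * M) = M * (π * (2 * R) ^ 2) := by
        rw [intervalIntegral.integral_mul_const, integral_id]; ring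
      rw [← this]
      refine intervalIntegral.integral_mono_on (by positivity) ((hcu c).intervalIntegrable _ _)
        ((by fun_prop : Continuous fun r : ℝ => r * (2 * π * M)).intervalIntegrable _ _)
        fun r hr => ?_
      rcases hr.1.eq_or_lt with h0 | h0
      · simp [← h0]
      · have := hav (2 * R) r h0 hr.2
        have hp := pi_pos
        gcongr
    have hpos : 0 < π * R ^ 2 := by positivity
    have : log⁺ ‖f z‖ * (π * R ^ 2) ≤ (4 * M) * (π * R ^ 2) := by nlinarith
    exact le_of_mul_le_mul_right this hpos
  refine ⟨4 * ((A + B) * √(3 * (1 + ‖c‖)) + L), by positivity, fun z => ?_⟩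
  have h1 : ‖f z‖ ≤ exp (log⁺ ‖f z‖) := by
    rcases eq_or_ne (f z) 0 with h0 | h0
    · simp [h0]
    · calc ‖f z‖ = exp (log ‖f z‖) := (exp_log (norm_pos_iff.2 h0)).symm
        _ ≤ _ := exp_le_exp.2 (le_max_right _ _)
  refine h1.trans (exp_le_exp.2 ((hpt z).trans ?_))
  have h2 : √(1 + ‖c‖ + 2 * (1 + ‖c‖ + ‖z‖)) ≤ √(3 * (1 + ‖c‖)) * √(1 + ‖z‖) := by
    rw [← sqrt_mul (by positivity)]
    apply sqrt_le_sqrt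
    nlinarith [norm_nonneg c, norm_nonneg z, mul_nonneg (norm_nonneg c) (norm_nonneg z)]
  have h3 : 1 ≤ √(1 + ‖z‖) := by
    rw [one_le_sqrt]; linarith [norm_nonneg z]
  have hL0 : 0 ≤ L := abs_nonneg _
  have : (A + B) * √(1 + ‖c‖ + 2 * (1 + ‖c‖ + ‖z‖)) ≤ (A + B) * (√(3 * (1 + ‖c‖)) * √(1 + ‖z‖)) := by
    gcongr
  nlinarith

theorem HalfGrowth.mul {F G : ℂ → ℂ} (hF : HalfGrowth F) (hG : HalfGrowth G) :
    HalfGrowth fun z => F z * G z := by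
  obtain ⟨A, hA0, hA⟩ := hF
  obtain ⟨B, hB0, hB⟩ := hG
  refine ⟨A + B, by positivity, fun z => ?_⟩
  rw [norm_mul, add_mul, exp_add]
  gcongr
  exacts [hA z, hB z]

theorem HalfGrowth.add {F G : ℂ → ℂ} (hF : HalfGrowth F) (hG : HalfGrowth G) :
    HalfGrowth fun z => F z + G z := by
  obtain ⟨A, hA0, hA⟩ := hF
  obtain ⟨B, hB0, hB⟩ := hG
  refine ⟨A + B + 1, by positivity, fun z => ?_⟩
  have h3 : 1 ≤ √(1 + ‖z‖) := by
    rw [one_le_sqrt]; linarith [norm_nonneg z]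
  have hA' : ‖F z‖ ≤ exp ((A + B) * √(1 + ‖z‖)) :=
    (hA z).trans (exp_le_exp.2 (by nlinarith))
  have hB' : ‖G z‖ ≤ exp ((A + B) * √(1 + ‖z‖)) :=
    (hB z).trans (exp_le_exp.2 (by nlinarith))
  have h2 : (2 : ℝ) ≤ exp (√(1 + ‖z‖)) := by
    have := add_one_le_exp (√(1 + ‖z‖)); linarith
  calc ‖F z + G z‖ ≤ ‖F z‖ + ‖G z‖ := norm_add_le _ _
    _ ≤ exp ((A + B) * √(1 + ‖z‖)) * 2 := by linarith
    _ ≤ exp ((A + B) * √(1 + ‖z‖)) * exp (√(1 + ‖z‖)) := by gcongr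
    _ = _ := by rw [← exp_add]; ring_nf

theorem HalfGrowth.comp_neg {F : ℂ → ℂ} (hF : HalfGrowth F) : HalfGrowth fun z => F (-z) := by
  obtain ⟨A, hA0, hA⟩ := hF
  exact ⟨A, hA0, fun z => by simpa using hA (-z)⟩

theorem HalfGrowth.const (c : ℂ) : HalfGrowth fun _ => c := by
  refine ⟨‖c‖, norm_nonneg _, fun z => ?_⟩
  have h3 : 1 ≤ √(1 + ‖z‖) := by
    rw [one_le_sqrt]; linarith [norm_nonneg z]
  have := add_one_le_exp (‖c‖ * √(1 + ‖z‖))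
  nlinarith [norm_nonneg c]

/-- The factor exp(-ε z) has modulus one on the imaginary axis and makes F decay on the positive
real axis, because a square root is dominated by ε|z|. Phragmén–Lindelöf in the half plane applies
to the product, and then ε → 0. -/
theorem HalfGrowth.norm_le_of_re_nonneg {F : ℂ → ℂ} (hF : Differentiable ℂ F)
    (gF : HalfGrowth F) {B : ℝ} (hB : ∀ x : ℝ, ‖F (x * Complex.I)‖ ≤ B) {z : ℂ} (hz : 0 ≤ z.re) :
    ‖F z‖ ≤ B := by
  obtain ⟨C, hC0, hC⟩ := gF
  -- Completing the square in √(1 + ‖w‖).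
  have hsq : ∀ ε : ℝ, 0 < ε → ∀ w : ℂ, C * √(1 + ‖w‖) ≤ ε * ‖w‖ + (ε + C ^ 2 / ε) := by
    intro ε hε w
    have h1 : √(1 + ‖w‖) ^ 2 = 1 + ‖w‖ := sq_sqrt (by positivity)
    have h2 : C * √(1 + ‖w‖) ≤ ε * √(1 + ‖w‖) ^ 2 + C ^ 2 / ε := by
      have : 0 ≤ (ε * √(1 + ‖w‖) - C / 2) ^ 2 / ε := by positivity
      have h4 : (ε * √(1 + ‖w‖) - C / 2) ^ 2 / ε
        = ε * √(1 + ‖w‖) ^ 2 - C * √(1 + ‖w‖) + C ^ 2 / ε / 4 := by field_simp; ring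
      have h5 : 0 ≤ C ^ 2 / ε := by positivity
      linarith
    rw [h1] at h2; linarith
  have key : ∀ ε : ℝ, 0 < ε → ‖F z * Complex.exp (-ε * z)‖ ≤ B := by
    intro ε hε
    refine PhragmenLindelof.right_half_plane_of_tendsto_zero_on_real
      (f := fun z => F z * Complex.exp (-ε * z)) (C := B) ?_ ?_ ?_ ?_ hz
    · exact Differentiable.diffContOnCl (by fun_prop)
    · refine ⟨1, by norm_num, 1, ?_⟩
      refine Asymptotics.IsBigO.of_bound (exp (1 + C ^ 2)) ?_
      refine eventually_inf_principal.2 (Eventually.of_forall fun w hw => ?_)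
      have hw' : 0 < w.re := hw
      rw [norm_mul, Complex.norm_exp, norm_of_nonneg (exp_pos _).le, rpow_one, ← exp_add]
      have h1 : (-(ε : ℂ) * w).re ≤ 0 := by
        simp; positivity
      calc ‖F w‖ * exp (-(ε : ℂ) * w).re ≤ ‖F w‖ * 1 := by
            gcongr; exact exp_le_one_iff.2 h1
        _ ≤ exp (C * √(1 + ‖w‖)) := by rw [mul_one]; exact hC w
        _ ≤ _ := exp_le_exp.2 ((hsq 1 one_pos w).trans (by norm_num; linarith))
    · rw [tendsto_zero_iff_norm_tendsto_zero]
      have hlim : Tendsto (fun x : ℝ => exp (ε / 2 + C ^ 2 / (ε / 2)) * exp (-(ε / 2 * x))) atTop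
          (𝓝 0) := by
        rw [← mul_zero (exp (ε / 2 + C ^ 2 / (ε / 2)))]
        refine Tendsto.const_mul _ (tendsto_exp_neg_atTop_nhds_zero.comp ?_)
        exact tendsto_id.const_mul_atTop (by positivity)
      refine squeeze_zero' (Eventually.of_forall fun _ => norm_nonneg _) ?_ hlim
      filter_upwards [eventually_ge_atTop 0] with x hx
      rw [norm_mul, Complex.norm_exp, ← exp_add]
      refine (mul_le_mul_of_nonneg_right (hC x) (exp_pos _).le).trans ?_
      rw [← exp_add]
      refine exp_le_exp.2 ?_
      have := hsq (ε / 2) (by positivity) x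
      rw [Complex.norm_real, norm_of_nonneg hx] at this
      have h6 : (-(ε : ℂ) * x).re = -(ε * x) := by simp
      rw [h6, Complex.norm_real, norm_of_nonneg hx]
      linarith
    · intro x
      rw [norm_mul, Complex.norm_exp]
      simpa using hB x
  have hlim : Tendsto (fun ε : ℝ => ‖F z * Complex.exp (-ε * z)‖) (𝓝[>] 0)
      (𝓝 ‖F z * Complex.exp (-(0 : ℝ) * z)‖) := by
    refine Tendsto.mono_left (Continuous.tendsto ?_ 0) nhdsWithin_le_nhds
    fun_prop
  have := le_of_tendsto hlim (eventually_mem_nhdsWithin.mono fun ε hε => key ε hε)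
  simpa using this

/-- An entire function of growth order at most one half with the same finite limit at both ends of
the imaginary axis is constant. -/
theorem HalfGrowth.eq_const {F : ℂ → ℂ} (hF : Differentiable ℂ F) (gF : HalfGrowth F) {c : ℂ}
    (h1 : Tendsto (fun s : ℝ => F (Complex.I * (s : ℂ) ^ 3)) atTop (𝓝 c))
    (h2 : Tendsto (fun s : ℝ => F (-Complex.I * (s : ℂ) ^ 3)) atTop (𝓝 c)) (z : ℂ) : F z = c := by
  have hroot : Tendsto (fun x : ℝ => x ^ (1 / 3 : ℝ)) atTop atTop :=
    tendsto_rpow_atTop (by norm_num)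
  have hcube : ∀ x : ℝ, 0 ≤ x → ((x ^ (1 / 3 : ℝ) : ℝ) : ℂ) ^ 3 = x := by
    intro x hx
    rw [← Complex.ofReal_pow, ← rpow_natCast, ← rpow_mul hx]; norm_num
  have h1' : Tendsto (fun x : ℝ => F (x * Complex.I)) atTop (𝓝 c) := by
    refine (h1.comp hroot).congr' ?_
    filter_upwards [eventually_ge_atTop 0] with x hx
    simp only [Function.comp_apply]
    rw [hcube x hx, mul_comm]
  have h2' : Tendsto (fun x : ℝ => F (x * Complex.I)) atBot (𝓝 c) := by
    refine ((h2.comp hroot).comp tendsto_neg_atBot_atTop).congr' ?_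
    filter_upwards [eventually_le_atBot 0] with x hx
    simp only [Function.comp_apply]
    rw [hcube (-x) (by linarith)]
    congr 1; push_cast; ring
  have hcont : Continuous fun x : ℝ => F (x * Complex.I) := by
    have := hF.continuous; fun_prop
  obtain ⟨B, hB⟩ : ∃ B, ∀ x : ℝ, ‖F (x * Complex.I)‖ ≤ B := by
    obtain ⟨a, ha⟩ := eventually_atTop.1 (h1'.norm.eventually (eventually_le_nhds (lt_add_one ‖c‖)))
    obtain ⟨b, hb⟩ := eventually_atBot.1 (h2'.norm.eventually (eventually_le_nhds (lt_add_one ‖c‖)))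
    obtain ⟨M, hM⟩ := isCompact_Icc.exists_bound_of_continuousOn (hcont.continuousOn (s := Icc b a))
    refine ⟨max M (‖c‖ + 1), fun x => ?_⟩
    by_cases hxa : a ≤ x
    · exact (ha x hxa).trans (le_max_right _ _)
    by_cases hxb : x ≤ b
    · exact (hb x hxb).trans (le_max_right _ _)
    · exact (hM x ⟨by linarith, by linarith⟩).trans (le_max_left _ _)
  -- The left half plane is reduced to the right one by z ↦ -z; Liouville's theorem then applies.
  have hbd : ∀ w, ‖F w‖ ≤ B := by
    intro w
    rcases le_total 0 w.re with h | h
    · exact gF.norm_le_of_re_nonneg hF hB h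
    · have := gF.comp_neg.norm_le_of_re_nonneg (F := fun w => F (-w)) (by fun_prop) (B := B)
        (fun x => by simpa using hB (-x)) (z := -w) (by simpa using h)
      simpa using this
  have hconst : ∀ w, F w = F z := fun w =>
    hF.apply_eq_apply_of_bounded ((isBounded_iff_forall_norm_le.2
      ⟨B, by rintro _ ⟨w, rfl⟩; exact hbd w⟩)) w z
  exact (tendsto_nhds_unique (h1'.congr fun x => hconst _) tendsto_const_nhds).symm

/-- Two entire functions with the same zeros, counted with multiplicity, differ by an entire
factor without zeros. -/
theorem exists_entire_quotient {F G : ℂ → ℂ} (hF : Differentiable ℂ F) (hG : Differentiable ℂ G)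
    (hne : ∀ z, analyticOrderAt F z ≠ ⊤)
    (h : ∀ z, analyticOrderAt F z = analyticOrderAt G z) :
    ∃ f : ℂ → ℂ, Differentiable ℂ f ∧ ∀ z, f z * F z = G z := by
  have hloc : ∀ z₀, ∃ g : ℂ → ℂ, AnalyticAt ℂ g z₀ ∧ ∀ᶠ z in 𝓝 z₀, g z * F z = G z := by
    intro z₀
    obtain ⟨n, hn⟩ := ENat.ne_top_iff_exists.1 (hne z₀)
    obtain ⟨u, hu, hu0, hFu⟩ := ((hF.analyticAt z₀).analyticOrderAt_eq_natCast).1 hn.symm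
    obtain ⟨v, hv, hv0, hGv⟩ :=
      ((hG.analyticAt z₀).analyticOrderAt_eq_natCast).1 ((h z₀).symm.trans hn.symm)
    refine ⟨fun z => v z / u z, hv.div hu hu0, ?_⟩
    filter_upwards [hFu, hGv, hu.continuousAt.eventually_ne hu0] with z h1 h2 h3
    rw [h1, h2]; simp only [smul_eq_mul]; field_simp
  choose g hg hgF using hloc
  have hFne : ∀ z₀, ∀ᶠ z in 𝓝[≠] z₀, F z ≠ 0 := by
    intro z₀
    rcases (hF.analyticAt z₀).eventually_eq_zero_or_eventually_ne_zero with h0 | h0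
    · exact absurd (analyticOrderAt_eq_top.2 h0) (hne z₀)
    · exact h0
  -- The local quotients agree off the zeros of `F`, which are isolated, so the function `z ↦ g z z`
  -- coincides near each `z₀` with the analytic function `g z₀`.
  have heq : ∀ z₀, (fun z => g z z) =ᶠ[𝓝 z₀] g z₀ := by
    intro z₀
    have h1 : ∀ᶠ z in 𝓝[≠] z₀, g z z = g z₀ z := by
      filter_upwards [hFne z₀, (hgF z₀).filter_mono nhdsWithin_le_nhds] with z h1 h2
      exact mul_right_cancel₀ h1 ((hgF z).self_of_nhds.trans h2.symm)
    rw [eventually_nhdsWithin_iff] at h1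
    filter_upwards [h1] with z hz
    by_cases hzz : z = z₀
    · rw [hzz]
    · exact hz hzz
  refine ⟨fun z => g z z, fun z₀ => ?_, fun z => (hgF z).self_of_nhds⟩
  exact ((hg z₀).congr (heq z₀).symm).differentiableAt

/-- If the ratio of two entire functions of growth order at most one half with the same zeros tends
to one along the imaginary axis, then the functions coincide. -/
theorem HalfGrowth.eq_of_analyticOrderAt_eq {F G : ℂ → ℂ} (hF : Differentiable ℂ F)
    (hG : Differentiable ℂ G) (gF : HalfGrowth F) (gG : HalfGrowth G)
    (hne : ∀ z, analyticOrderAt F z ≠ ⊤)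
    (h : ∀ z, analyticOrderAt F z = analyticOrderAt G z)
    (h1 : Tendsto (fun s : ℝ => G (Complex.I * (s : ℂ) ^ 3) / F (Complex.I * (s : ℂ) ^ 3)) atTop
      (𝓝 1))
    (h2 : Tendsto (fun s : ℝ => G (-Complex.I * (s : ℂ) ^ 3) / F (-Complex.I * (s : ℂ) ^ 3)) atTop
      (𝓝 1)) : F = G := by
  obtain ⟨f, hf, hfF⟩ := exists_entire_quotient hF hG hne h
  have hlim : ∀ {μ : ℂ}, Tendsto (fun s : ℝ => G (μ * (s : ℂ) ^ 3) / F (μ * (s : ℂ) ^ 3)) atTop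
      (𝓝 1) → Tendsto (fun s : ℝ => f (μ * (s : ℂ) ^ 3)) atTop (𝓝 1) := by
    intro μ hμ
    refine hμ.congr' ?_
    filter_upwards [hμ.eventually_ne one_ne_zero] with s hs
    have : F (μ * (s : ℂ) ^ 3) ≠ 0 := fun h0 => hs (by simp [h0])
    rw [← hfF]; field_simp
  obtain ⟨c, hc⟩ : ∃ c, F c ≠ 0 := by
    by_contra! h0
    exact hne 0 (analyticOrderAt_eq_top.2 (Eventually.of_forall h0))
  have gf : HalfGrowth f := HalfGrowth.of_mul_eq hf hF hG hfF hc gF gG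
  ext z
  rw [← hfF z, gf.eq_const hf (hlim h1) (hlim h2) z, one_mul]

end ThirdOrder
end

noncomputable section

namespace ThirdOrder

open MeasureTheory Set Filter Topology

/-! ### Absolutely continuous functions with values in a Banach space -/

section AbsolutelyContinuous

variable {E F : Type*} [NormedAddCommGroup E] [NormedAddCommGroup F]

/-- Absolute continuity passes to a function whose increments are dominated; this covers
vector-valued primitives, Lipschitz compositions and components. -/
theorem absolutelyContinuousOnInterval_of_dist_le {f : ℝ → E} {g : ℝ → F} {a b K : ℝ}
    (hg : AbsolutelyContinuousOnInterval g a b)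
    (h : ∀ x ∈ uIcc a b, ∀ y ∈ uIcc a b, dist (f x) (f y) ≤ K * dist (g x) (g y)) :
    AbsolutelyContinuousOnInterval f a b := by
  unfold AbsolutelyContinuousOnInterval at hg ⊢
  refine squeeze_zero' (Eventually.of_forall fun _ => Finset.sum_nonneg fun _ _ => dist_nonneg) ?_
    (by simpa using hg.const_mul K)
  rw [eventually_inf_principal]
  refine Eventually.of_forall fun J hJ => ?_
  rw [Finset.mul_sum]
  exact Finset.sum_le_sum fun i hi => h _ (hJ.1 i hi).1 _ (hJ.1 i hi).2

theorem absolutelyContinuousOnInterval_congr {f g : ℝ → E} {a b : ℝ}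
    (hg : AbsolutelyContinuousOnInterval g a b) (h : EqOn f g (uIcc a b)) :
    AbsolutelyContinuousOnInterval f a b :=
  absolutelyContinuousOnInterval_of_dist_le (K := 1) hg fun x hx y hy => by
    rw [h hx, h hy, one_mul]

variable [NormedSpace ℝ E]

theorem absolutelyContinuousOnInterval_integral {f : ℝ → E} {a b c : ℝ}
    (hf : IntervalIntegrable f volume a b) (hc : c ∈ uIcc a b) :
    AbsolutelyContinuousOnInterval (fun x => ∫ t in c..x, f t) a b := by
  refine absolutelyContinuousOnInterval_of_dist_le (K := 1)
    (hf.norm.absolutelyContinuousOnInterval_intervalIntegral hc) fun x hx y hy => ?_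
  have hsub : ∀ {u v : ℝ}, u ∈ uIcc a b → v ∈ uIcc a b → IntervalIntegrable f volume u v :=
    fun hu hv => hf.mono_set (uIcc_subset_uIcc hu hv)
  rw [one_mul, dist_eq_norm, dist_eq_norm,
    intervalIntegral.integral_interval_sub_left (hsub hc hx) (hsub hc hy),
    intervalIntegral.integral_interval_sub_left (hsub hc hx).norm (hsub hc hy).norm]
  exact intervalIntegral.norm_integral_le_abs_integral_norm

theorem hasDerivAt_congr_Icc {F G : ℝ → E} {F' : E} {x : ℝ} (h : EqOn F G (Icc 0 1))
    (hx : x ∈ Ioo (0 : ℝ) 1) (hG : HasDerivAt G F' x) : HasDerivAt F F' x :=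
  hG.congr_of_eventuallyEq (eventually_of_mem (Icc_mem_nhds hx.1 hx.2) h)

/-- The fundamental theorem of calculus for absolutely continuous functions on `[0,1]`. -/
theorem ac_and_hasDerivAt_iff [CompleteSpace E] {F f : ℝ → E} (hf : IntervalIntegrable f volume 0 1) {c : ℝ}
    (hc : c ∈ Icc (0 : ℝ) 1) :
    (AbsolutelyContinuousOnInterval F 0 1 ∧ ∀ᵐ x : ℝ, x ∈ Ioo (0 : ℝ) 1 → HasDerivAt F (f x) x) ↔
      ∀ x ∈ Icc (0 : ℝ) 1, F x = F c + ∫ t in c..x, f t := by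
  have hI : uIcc (0 : ℝ) 1 = Icc 0 1 := uIcc_of_le zero_le_one
  have hint := absolutelyContinuousOnInterval_integral hf (hI ▸ hc)
  have hder : ∀ᵐ x : ℝ, x ∈ Ioo (0 : ℝ) 1 → HasDerivAt (fun x => ∫ t in c..x, f t) (f x) x := by
    filter_upwards [hf.ae_hasDerivAt_integral] with x hx hx1
    exact hx (hI ▸ Ioo_subset_Icc_self hx1) c (hI ▸ hc)
  constructor
  · rintro ⟨hac, hd⟩
    have hends : ∀ᵐ x : ℝ, x ≠ 0 ∧ x ≠ 1 := by
      have h0 : ∀ y : ℝ, ∀ᵐ x : ℝ, x ≠ y := fun y => by simp [ae_iff]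
      exact (h0 0).and (h0 1)
    obtain ⟨C, hC⟩ := (hac.sub hint).const_of_ae_hasDerivAt_zero (by
      filter_upwards [hd, hder, hends] with x h1 h2 h3 hx
      rw [hI] at hx
      have hx' : x ∈ Ioo (0 : ℝ) 1 :=
        ⟨lt_of_le_of_ne hx.1 (Ne.symm h3.1), lt_of_le_of_ne hx.2 h3.2⟩
      simpa using (h1 hx').sub (h2 hx'))
    intro x hx
    have e1 := hC x (hI ▸ hx)
    have e2 := hC c (hI ▸ hc)
    simp only [Pi.sub_apply, intervalIntegral.integral_same, sub_zero] at e1 e2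
    rw [e2, ← e1]; abel
  · intro h
    constructor
    · have hconst : AbsolutelyContinuousOnInterval (fun _ : ℝ => F c) 0 1 :=
        ((LipschitzWith.const (F c)).lipschitzOnWith
          (s := uIcc (0 : ℝ) 1)).absolutelyContinuousOnInterval
      exact absolutelyContinuousOnInterval_congr (hconst.add hint) fun x hx => h x (hI ▸ hx)
    · filter_upwards [hder] with x hx hx1
      refine ((hx hx1).const_add (F c)).congr_of_eventuallyEq ?_
      filter_upwards [Icc_mem_nhds hx1.1 hx1.2] with y hy using h y hy

/-- The primitive of α has bounded range, on which exp is Lipschitz. So its exponential is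
absolutely continuous and the chain rule can be integrated for merely integrable α. -/
theorem integral_mul_exp_integral {α : ℝ → ℝ} (hα : IntervalIntegrable α volume 0 1) (κ : ℝ)
    {c x : ℝ} (hc : c ∈ Icc (0 : ℝ) 1) (hx : x ∈ Icc (0 : ℝ) 1) :
    κ * ∫ t in c..x, α t * Real.exp (κ * ∫ u in c..t, α u)
      = Real.exp (κ * ∫ u in c..x, α u) - 1 := by
  have hI : uIcc (0 : ℝ) 1 = Icc 0 1 := uIcc_of_le zero_le_one
  have hac := (absolutelyContinuousOnInterval_integral hα (hI ▸ hc)).const_mul κ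
  set a : ℝ → ℝ := fun x => κ * ∫ t in c..x, α t with ha
  have hcont : ContinuousOn a (uIcc 0 1) := hac.continuousOn
  obtain ⟨M, hM⟩ := isCompact_uIcc.exists_bound_of_continuousOn hcont
  obtain ⟨K, hK⟩ := (Real.contDiff_exp.contDiffOn (n := 1) (s := Icc (-M) M)).exists_lipschitzOnWith
    (by decide) (convex_Icc _ _) isCompact_Icc
  have hmem : ∀ y ∈ uIcc (0 : ℝ) 1, a y ∈ Icc (-M) M := fun y hy => abs_le.1 (hM y hy)
  have hexp : AbsolutelyContinuousOnInterval (fun x => Real.exp (a x)) 0 1 :=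
    absolutelyContinuousOnInterval_of_dist_le (K := K) hac fun y hy z hz =>
      hK.dist_le_mul _ (hmem y hy) _ (hmem z hz)
  have hint : IntervalIntegrable (fun t => α t * Real.exp (a t) * κ) volume 0 1 :=
    (hα.mul_continuousOn hexp.continuousOn).mul_const κ
  have := (ac_and_hasDerivAt_iff (F := fun x => Real.exp (a x)) hint hc).1 ⟨hexp, by
    filter_upwards [hα.ae_hasDerivAt_integral] with y hy hy1
    have h1 := ((hy (hI ▸ Ioo_subset_Icc_self hy1) c (hI ▸ hc)).const_mul κ).exp
    refine h1.congr_deriv ?_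
    simp only [ha]; ring⟩ x hx
  rw [intervalIntegral.integral_mul_const] at this
  have hac0 : a c = 0 := by simp [ha]
  rw [hac0, Real.exp_zero] at this
  linarith

end AbsolutelyContinuous

/-! ### Volterra operators -/

section Volterra

variable {V : Type*} [NormedAddCommGroup V]

/-- A continuous function on `[0,1]`, extended to the line by constants. -/
abbrev ext (f : C(unitInterval, V)) : ℝ → V := IccExtend zero_le_one f

theorem continuous_ext (f : C(unitInterval, V)) : Continuous (ext f) :=
  f.continuous.Icc_extend'

theorem ext_apply (f : C(unitInterval, V)) (x : unitInterval) : ext f x = f x :=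
  IccExtend_val _ _ _

theorem ext_of_mem (f : C(unitInterval, V)) {x : ℝ} (hx : x ∈ Icc (0 : ℝ) 1) :
    ext f x = f ⟨x, hx⟩ := IccExtend_of_mem _ _ hx

theorem norm_ext_le (f : C(unitInterval, V)) (x : ℝ) : ‖ext f x‖ ≤ ‖f‖ := f.norm_coe_le_norm _

variable [NormedSpace ℂ V]

theorem intervalIntegrable_clm_apply {A : ℝ → V →L[ℂ] V} {a b : ℝ}
    (hA : IntervalIntegrable A volume a b) {f : ℝ → V} (hf : Continuous f) :
    IntervalIntegrable (fun t => A t (f t)) volume a b := by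
  obtain ⟨C, hC⟩ := isCompact_uIcc.exists_bound_of_continuousOn (hf.continuousOn (s := uIcc a b))
  rw [intervalIntegrable_iff] at hA ⊢
  refine Integrable.mono' (hA.norm.mul_const C) ?_ ?_
  · exact (ContinuousLinearMap.apply ℂ V).aestronglyMeasurable_comp₂
      hf.aestronglyMeasurable hA.aestronglyMeasurable
  · filter_upwards [ae_restrict_mem measurableSet_uIoc] with t ht
    exact ((A t).le_opNorm _).trans (by gcongr; exact hC t (uIoc_subset_uIcc ht))

theorem unitInterval_uIcc_subset (x y : unitInterval) : uIcc (x : ℝ) y ⊆ uIcc (0 : ℝ) 1 := by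
  rw [uIcc_of_le zero_le_one]
  exact (Set.ordConnected_Icc).uIcc_subset x.2 y.2

theorem coe_mem_uIcc (c : unitInterval) : (c : ℝ) ∈ uIcc (0 : ℝ) 1 := by
  rw [uIcc_of_le zero_le_one]; exact c.2

/-- The Volterra integral operator `f ↦ ∫ t in c..x, A t (f t)`. -/
def volterra (A : ℝ → V →L[ℂ] V) (hA : IntervalIntegrable A volume 0 1) (c : unitInterval) :
    C(unitInterval, V) →L[ℂ] C(unitInterval, V) :=
  LinearMap.mkContinuous
    { toFun := fun f => ⟨fun x => ∫ t in (c : ℝ)..x, A t (ext f t), by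
        have h := (absolutelyContinuousOnInterval_integral
          (intervalIntegrable_clm_apply hA (continuous_ext f))
          (coe_mem_uIcc c)).continuousOn
        rw [uIcc_of_le zero_le_one] at h
        exact h.comp_continuous continuous_subtype_val fun x => x.2⟩
      map_add' := fun f g => by
        ext x
        have hi : ∀ f : C(unitInterval, V), IntervalIntegrable (fun t => A t (ext f t)) volume c x :=
          fun f => (intervalIntegrable_clm_apply hA (continuous_ext f)).mono_set
            (unitInterval_uIcc_subset c x)
        simp only [ContinuousMap.coe_mk, ContinuousMap.add_apply]
        rw [← intervalIntegral.integral_add (hi f) (hi g)]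
        exact intervalIntegral.integral_congr fun t _ => (A t).map_add _ _
      map_smul' := fun r f => by
        ext x
        simp only [ContinuousMap.coe_mk, ContinuousMap.smul_apply, RingHom.id_apply]
        rw [← intervalIntegral.integral_smul]
        exact intervalIntegral.integral_congr fun t _ => (A t).map_smul _ _ }
    (∫ t in (0 : ℝ)..1, ‖A t‖) (fun f => by
      have h0 : 0 ≤ ∫ t in (0 : ℝ)..1, ‖A t‖ :=
        intervalIntegral.integral_nonneg zero_le_one fun t _ => norm_nonneg _
      refine (ContinuousMap.norm_le _ (by positivity)).2 fun x => ?_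
      simp only [LinearMap.coe_mk, AddHom.coe_mk, ContinuousMap.coe_mk]
      refine (intervalIntegral.norm_integral_le_abs_of_norm_le (g := fun t => ‖A t‖ * ‖f‖)
        (Eventually.of_forall fun t => ?_) ?_).trans ?_
      · exact ((A t).le_opNorm _).trans (by gcongr; exact norm_ext_le f t)
      · exact (hA.norm.mono_set (unitInterval_uIcc_subset c x)).mul_const _
      · rw [intervalIntegral.integral_mul_const, abs_mul, abs_of_nonneg (norm_nonneg f)]
        gcongr
        rw [← abs_of_nonneg h0]
        refine intervalIntegral.abs_integral_mono_interval ?_ ?_ hA.norm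
        · refine uIoc_subset_uIoc_of_uIcc_subset_uIcc ?_
          exact unitInterval_uIcc_subset c x
        · exact Eventually.of_forall fun t => norm_nonneg _)

theorem volterra_apply (A : ℝ → V →L[ℂ] V) (hA : IntervalIntegrable A volume 0 1)
    (c : unitInterval) (f : C(unitInterval, V)) (x : unitInterval) :
    volterra A hA c f x = ∫ t in (c : ℝ)..x, A t (ext f t) := rfl

/-- With B the coefficient of the spectral parameter, this affine dependence makes the resolvents
analytic in the parameter. -/
theorem volterra_add_smul (A B : ℝ → V →L[ℂ] V) (hA : IntervalIntegrable A volume 0 1)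
    (hB : IntervalIntegrable B volume 0 1) (r : ℂ) (c : unitInterval)
    (hAB : IntervalIntegrable (fun t => A t + r • B t) volume 0 1) :
    volterra (fun t => A t + r • B t) hAB c = volterra A hA c + r • volterra B hB c := by
  ext f x
  simp only [add_apply, smul_apply,
    ContinuousMap.add_apply, ContinuousMap.smul_apply, volterra_apply]
  have hi : ∀ {A : ℝ → V →L[ℂ] V}, IntervalIntegrable A volume 0 1 →
      IntervalIntegrable (fun t => A t (ext f t)) volume c x := fun hA =>
    (intervalIntegrable_clm_apply hA (continuous_ext f)).mono_set (unitInterval_uIcc_subset c x)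
  rw [← intervalIntegral.integral_smul]
  exact intervalIntegral.integral_add (hi hA) ((hi hB).smul r)

/-- Multiplication by a continuous real function. -/
def mulOp (w : C(unitInterval, ℝ)) : C(unitInterval, V) →L[ℂ] C(unitInterval, V) :=
  LinearMap.mkContinuous
    { toFun := fun f => ⟨fun x => (w x : ℂ) • f x, by fun_prop⟩
      map_add' := fun f g => by ext x; simp
      map_smul' := fun r f => by ext x; simp [smul_comm r] }
    ‖w‖ (fun f => by
      refine (ContinuousMap.norm_le _ (by positivity)).2 fun x => ?_
      simp only [LinearMap.coe_mk, AddHom.coe_mk, ContinuousMap.coe_mk, norm_smul,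
        Complex.norm_real]
      gcongr
      exacts [w.norm_coe_le_norm x, f.norm_coe_le_norm x])

/-- `w` is a weight in which the Volterra operator of `A` based at `c` is a contraction. -/
structure IsWeight (A : ℝ → V →L[ℂ] V) (c : unitInterval) (w v : C(unitInterval, ℝ)) : Prop where
  pos : ∀ x, 0 < w x
  inv : ∀ x, v x * w x = 1
  le : ∀ x : unitInterval, |∫ t in (c : ℝ)..x, ‖A t‖ * ext w t| ≤ w x / 2

/-- Conjugation multiplies the integrand by w(t)/w(x), and `IsWeight.le` bounds the resulting
integral. The Volterra operator, however large, is thus similar to a contraction. -/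
theorem IsWeight.norm_conj_le {A : ℝ → V →L[ℂ] V} {c : unitInterval} {w v : C(unitInterval, ℝ)}
    (h : IsWeight A c w v) (hA : IntervalIntegrable A volume 0 1) :
    ‖mulOp v * volterra A hA c * mulOp w‖ ≤ 1 / 2 := by
  refine ContinuousLinearMap.opNorm_le_bound _ (by norm_num) fun f => ?_
  refine (ContinuousMap.norm_le _ (by positivity)).2 fun x => ?_
  have hv : 0 < v x := by
    have h1 := h.inv x
    have h2 := h.pos x
    by_contra h3
    nlinarith
  change ‖(v x : ℂ) • ∫ t in (c : ℝ)..x, A t (ext (mulOp w f) t)‖ ≤ _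
  rw [norm_smul, Complex.norm_real, Real.norm_of_nonneg hv.le]
  have h1 : ‖∫ t in (c : ℝ)..x, A t (ext (mulOp w f) t)‖ ≤ w x / 2 * ‖f‖ := by
    refine (intervalIntegral.norm_integral_le_abs_of_norm_le
      (g := fun t => ‖A t‖ * ext w t * ‖f‖) (Eventually.of_forall fun t => ?_) ?_).trans ?_
    · refine ((A t).le_opNorm _).trans ?_
      rw [mul_assoc]
      gcongr
      change ‖(w _ : ℂ) • f _‖ ≤ w _ * ‖f‖
      rw [norm_smul, Complex.norm_real, Real.norm_of_nonneg (h.pos _).le]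
      exact mul_le_mul_of_nonneg_left (f.norm_coe_le_norm _) (h.pos _).le
    · exact ((hA.norm.mono_set (unitInterval_uIcc_subset c x)).mul_continuousOn
        w.continuous.Icc_extend'.continuousOn).mul_const _
    · rw [intervalIntegral.integral_mul_const, abs_mul, abs_of_nonneg (norm_nonneg f)]
      exact mul_le_mul_of_nonneg_right (h.le x) (norm_nonneg _)
  calc v x * ‖∫ t in (c : ℝ)..x, A t (ext (mulOp w f) t)‖ ≤ v x * (w x / 2 * ‖f‖) := by gcongr
    _ = (v x * w x) / 2 * ‖f‖ := by ring
    _ = _ := by rw [h.inv]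

theorem IsWeight.isUnit [CompleteSpace V] {A : ℝ → V →L[ℂ] V} {c : unitInterval}
    {w v : C(unitInterval, ℝ)} (h : IsWeight A c w v) (hA : IntervalIntegrable A volume 0 1) :
    IsUnit (1 - volterra A hA c) := by
  have hwv : mulOp (V := V) w * mulOp v = 1 := by
    ext f x
    change (w x : ℂ) • (v x : ℂ) • f x = f x
    rw [smul_smul, ← Complex.ofReal_mul, mul_comm, h.inv]; simp
  have hvw : mulOp (V := V) v * mulOp w = 1 := by
    ext f x
    change (v x : ℂ) • (w x : ℂ) • f x = f x
    rw [smul_smul, ← Complex.ofReal_mul, h.inv]; simp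
  have h1 : IsUnit (1 - mulOp v * volterra A hA c * mulOp w) := by
    have hlt : ‖mulOp v * volterra A hA c * mulOp w‖ < 1 :=
      (h.norm_conj_le hA).trans_lt (by norm_num)
    exact isUnit_one_sub_of_norm_lt_one (R := C(unitInterval, V) →L[ℂ] C(unitInterval, V)) hlt
  have hw : IsUnit (mulOp (V := V) w) := ⟨⟨_, _, hwv, hvw⟩, rfl⟩
  have hv : IsUnit (mulOp (V := V) v) := ⟨⟨_, _, hvw, hwv⟩, rfl⟩
  have h2 : 1 - volterra A hA c
      = mulOp w * (1 - mulOp v * volterra A hA c * mulOp w) * mulOp v := by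
    simp only [mul_sub, sub_mul, mul_one, ← mul_assoc, hwv, one_mul]
    rw [mul_assoc, hwv, mul_one]
  rw [h2]
  exact (hw.mul h1).mul hv

/-- The contraction absorbs half of the weighted norm of f; the factor ‖w‖‖v‖ is the price of going
to the weighted norm and back. -/
theorem IsWeight.norm_le {A : ℝ → V →L[ℂ] V} {c : unitInterval}
    {w v : C(unitInterval, ℝ)} (h : IsWeight A c w v) (hA : IntervalIntegrable A volume 0 1)
    {f g : C(unitInterval, V)} (hf : f = g + volterra A hA c f) :
    ‖f‖ ≤ 2 * ‖w‖ * ‖v‖ * ‖g‖ := by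
  have hmul : ∀ (w : C(unitInterval, ℝ)) (f : C(unitInterval, V)), ‖mulOp w f‖ ≤ ‖w‖ * ‖f‖ :=
    fun w f => ContinuousLinearMap.le_of_opNorm_le _
      (LinearMap.mkContinuous_norm_le _ (norm_nonneg w) _) f
  have hwv : ∀ f : C(unitInterval, V), mulOp w (mulOp v f) = f := by
    intro f
    ext x
    change (w x : ℂ) • (v x : ℂ) • f x = f x
    rw [smul_smul, ← Complex.ofReal_mul, mul_comm, h.inv]; simp
  have h0 : (mulOp v * volterra A hA c * mulOp w : C(unitInterval, V) →L[ℂ] C(unitInterval, V))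
      (mulOp v f) = mulOp v (volterra A hA c (mulOp w (mulOp v f))) := rfl
  have h1 : mulOp v f = mulOp v g + mulOp v (volterra A hA c (mulOp w (mulOp v f))) := by
    rw [hwv, ← map_add, ← hf]
  have h2 : ‖mulOp v f‖ ≤ ‖mulOp v g‖ + 1 / 2 * ‖mulOp v f‖ := by
    have h5 := ContinuousLinearMap.le_of_opNorm_le _ (h.norm_conj_le hA) (mulOp v f)
    rw [h0] at h5
    calc ‖mulOp v f‖ = ‖mulOp v g + mulOp v (volterra A hA c (mulOp w (mulOp v f)))‖ := by rw [← h1]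
      _ ≤ _ := (norm_add_le _ _).trans (add_le_add le_rfl h5)
  have h3 := hmul w (mulOp v f)
  rw [hwv] at h3
  have h4 := hmul v g
  calc ‖f‖ ≤ ‖w‖ * (2 * (‖v‖ * ‖g‖)) := h3.trans (by gcongr; linarith)
    _ = _ := by ring

/-- The exponential of a multiple of a primitive of an integrable function. -/
def expPrimitive (α : ℝ → ℝ) (hα : IntervalIntegrable α volume 0 1) (c : unitInterval) (κ : ℝ) :
    C(unitInterval, ℝ) :=
  ⟨fun x => Real.exp (κ * ∫ t in (c : ℝ)..x, α t), by
    have h := (absolutelyContinuousOnInterval_integral hα (coe_mem_uIcc c)).continuousOn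
    rw [uIcc_of_le zero_le_one] at h
    have := h.comp_continuous continuous_subtype_val fun x : unitInterval => x.2
    fun_prop⟩

theorem expPrimitive_apply {α : ℝ → ℝ} (hα : IntervalIntegrable α volume 0 1) (c : unitInterval)
    (κ : ℝ) (x : unitInterval) :
    expPrimitive α hα c κ x = Real.exp (κ * ∫ t in (c : ℝ)..x, α t) := rfl

theorem integral_mul_ext_expPrimitive {α : ℝ → ℝ} (hα : IntervalIntegrable α volume 0 1)
    (c : unitInterval) (κ : ℝ) (x : unitInterval) :
    κ * ∫ t in (c : ℝ)..x, α t * ext (expPrimitive α hα c κ) t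
      = expPrimitive α hα c κ x - 1 := by
  rw [expPrimitive_apply, ← integral_mul_exp_integral hα κ c.2 x.2]
  congr 1
  refine intervalIntegral.integral_congr fun t ht => ?_
  have ht' := unitInterval_uIcc_subset c x ht
  rw [uIcc_of_le zero_le_one] at ht'
  rw [ext_of_mem _ ht', expPrimitive_apply]

/-- The exponent 2 is chosen so that w' = 2‖A‖w, whence the integral of ‖A‖w equals (w - 1)/2. For
the base point 1 the sign is reversed, so that the weight grows towards the left. -/
theorem isWeight_zero {A : ℝ → V →L[ℂ] V} (hA : IntervalIntegrable A volume 0 1) :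
    IsWeight A 0 (expPrimitive _ hA.norm 0 2) (expPrimitive _ hA.norm 0 (-2)) := by
  refine ⟨fun x => Real.exp_pos _, fun x => ?_, fun x => ?_⟩
  · rw [expPrimitive_apply, expPrimitive_apply, ← Real.exp_add]; simp
  · have h := integral_mul_ext_expPrimitive hA.norm 0 2 x
    rw [abs_of_nonneg]
    · linarith
    · refine intervalIntegral.integral_nonneg x.2.1 fun t _ => ?_
      exact mul_nonneg (norm_nonneg _) (Real.exp_pos _).le

theorem isWeight_one {A : ℝ → V →L[ℂ] V} (hA : IntervalIntegrable A volume 0 1) :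
    IsWeight A 1 (expPrimitive _ hA.norm 1 (-2)) (expPrimitive _ hA.norm 1 2) := by
  refine ⟨fun x => Real.exp_pos _, fun x => ?_, fun x => ?_⟩
  · rw [expPrimitive_apply, expPrimitive_apply, ← Real.exp_add]; simp
  · have h := integral_mul_ext_expPrimitive hA.norm 1 (-2) x
    rw [intervalIntegral.integral_symm, abs_neg, abs_of_nonneg]
    · rw [intervalIntegral.integral_symm] at h
      linarith
    · refine intervalIntegral.integral_nonneg x.2.2 fun t _ => ?_
      exact mul_nonneg (norm_nonneg _) (Real.exp_pos _).le

/-- A Gronwall estimate, meant for a coefficient whose norm depends on the spectral parameter. -/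
theorem norm_le_exp_of_eq_add_volterra {A : ℝ → V →L[ℂ] V} (hA : IntervalIntegrable A volume 0 1)
    {f g : C(unitInterval, V)} (hf : f = g + volterra A hA 0 f) :
    ‖f‖ ≤ 2 * Real.exp (2 * ∫ t in (0 : ℝ)..1, ‖A t‖) * ‖g‖ := by
  have hn : ∀ x : unitInterval, 0 ≤ ∫ t in (0 : ℝ)..x, ‖A t‖ := fun x =>
    intervalIntegral.integral_nonneg x.2.1 fun t _ => norm_nonneg _
  have h := (isWeight_zero hA).norm_le hA hf
  have h1 : ‖expPrimitive _ hA.norm 0 2‖ ≤ Real.exp (2 * ∫ t in (0 : ℝ)..1, ‖A t‖) := by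
    refine (ContinuousMap.norm_le _ (Real.exp_pos _).le).2 fun x => ?_
    rw [expPrimitive_apply, Real.norm_of_nonneg (Real.exp_pos _).le, Real.exp_le_exp]
    gcongr
    refine intervalIntegral.integral_mono_interval le_rfl x.2.1 x.2.2 ?_ hA.norm
    exact Eventually.of_forall fun t => norm_nonneg _
  have h2 : ‖expPrimitive _ hA.norm 0 (-2)‖ ≤ 1 := by
    refine (ContinuousMap.norm_le _ zero_le_one).2 fun x => ?_
    rw [expPrimitive_apply, Real.norm_of_nonneg (Real.exp_pos _).le, Real.exp_le_one_iff]
    have := hn x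
    change -2 * ∫ t in (0 : ℝ)..x, ‖A t‖ ≤ 0
    linarith
  calc ‖f‖ ≤ 2 * ‖expPrimitive _ hA.norm 0 2‖ * ‖expPrimitive _ hA.norm 0 (-2)‖ * ‖g‖ := h
    _ ≤ 2 * Real.exp (2 * ∫ t in (0 : ℝ)..1, ‖A t‖) * 1 * ‖g‖ := by gcongr
    _ = _ := by ring

end Volterra

end ThirdOrder
end

noncomputable section

namespace ThirdOrder

open MeasureTheory Set Filter Topology

/-! ### The first order system of the third order equation -/

instance (priority := high) normedSpaceFinThree : NormedSpace ℂ (Fin 3 → ℂ) := Pi.normedSpace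

/-- The continuous linear map on `ℂ³` given by a matrix. -/
def matCLM (M : Matrix (Fin 3) (Fin 3) ℂ) : (Fin 3 → ℂ) →L[ℂ] (Fin 3 → ℂ) :=
  LinearMap.toContinuousLinearMap (Matrix.mulVecLin M)

theorem matCLM_apply (M : Matrix (Fin 3) (Fin 3) ℂ) (v : Fin 3 → ℂ) :
    matCLM M v = M.mulVec v := rfl

/-- The coefficient of the spectral parameter in the first order system. -/
def paramCLM : (Fin 3 → ℂ) →L[ℂ] (Fin 3 → ℂ) := matCLM !![0, 0, 0; 0, 0, 0; 1, 0, 0]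

/-- The coefficient of the first order system at `lam = 0`. -/
def baseCoef (p : ℝ → ℂ) (t : ℝ) : (Fin 3 → ℂ) →L[ℂ] (Fin 3 → ℂ) :=
  matCLM !![0, 1, 0; 0, 0, 1; 0, 0, 0] + p t • matCLM !![0, 0, 0; -1, 0, 0; 0, -1, 0]

/-- The coefficient of the first order system. -/
def coef (p : ℝ → ℂ) (lam : ℂ) (t : ℝ) : (Fin 3 → ℂ) →L[ℂ] (Fin 3 → ℂ) :=
  baseCoef p t + lam • paramCLM

theorem paramCLM_apply (v : Fin 3 → ℂ) : paramCLM v = ![0, 0, v 0] := by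
  ext i
  fin_cases i <;> simp [paramCLM, matCLM_apply, Matrix.mulVec, dotProduct, Fin.sum_univ_three]

theorem coef_apply (p : ℝ → ℂ) (lam : ℂ) (t : ℝ) (v : Fin 3 → ℂ) :
    coef p lam t v = ![v 1, v 2 - p t * v 0, lam * v 0 - p t * v 1] := by
  ext i
  fin_cases i <;>
    simp [coef, baseCoef, paramCLM, matCLM_apply, dotProduct,
      Fin.sum_univ_three] <;> ring

theorem intervalIntegrable_of_integrableOn_Ioo {p : ℝ → ℂ}
    (hp : IntegrableOn p (Ioo 0 1) volume) : IntervalIntegrable p volume 0 1 :=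
  (intervalIntegrable_iff_integrableOn_Ioo_of_le zero_le_one).2 hp

variable {p : ℝ → ℂ} (hp : IntervalIntegrable p volume 0 1)

include hp in
theorem intervalIntegrable_baseCoef : IntervalIntegrable (baseCoef p) volume 0 1 := by
  refine IntervalIntegrable.add intervalIntegrable_const ?_
  rw [intervalIntegrable_iff] at hp ⊢
  exact hp.smul_const _

include hp in
theorem intervalIntegrable_coef (lam : ℂ) : IntervalIntegrable (coef p lam) volume 0 1 :=
  (intervalIntegrable_baseCoef hp).add intervalIntegrable_const

/-- The Volterra operator of the system. -/
def sysOp (lam : ℂ) (c : unitInterval) :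
    C(unitInterval, Fin 3 → ℂ) →L[ℂ] C(unitInterval, Fin 3 → ℂ) :=
  volterra (coef p lam) (intervalIntegrable_coef hp lam) c

/-- The Volterra operator of the coefficient of the spectral parameter. -/
def paramOp (c : unitInterval) :
    C(unitInterval, Fin 3 → ℂ) →L[ℂ] C(unitInterval, Fin 3 → ℂ) :=
  volterra (fun _ => paramCLM) intervalIntegrable_const c

theorem sysOp_eq (lam : ℂ) (c : unitInterval) : sysOp hp lam c =
    volterra (baseCoef p) (intervalIntegrable_baseCoef hp) c + lam • paramOp c :=
  volterra_add_smul _ _ _ _ _ _ _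

theorem sysOp_add_smul (lam z : ℂ) (c : unitInterval) :
    sysOp hp (lam + z) c = sysOp hp lam c + z • paramOp c := by
  rw [sysOp_eq, sysOp_eq]
  ext f x i
  simp only [add_apply, smul_apply, ContinuousMap.add_apply, ContinuousMap.smul_apply,
    Pi.add_apply, Pi.smul_apply, smul_eq_mul]
  ring

theorem isUnit_one_sub_sysOp (lam : ℂ) {c : unitInterval} (hc : c = 0 ∨ c = 1) :
    IsUnit (1 - sysOp hp lam c) := by
  rcases hc with rfl | rfl
  · exact (isWeight_zero (intervalIntegrable_coef hp lam)).isUnit _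
  · exact (isWeight_one (intervalIntegrable_coef hp lam)).isUnit _

/-- The resolvent of the Volterra operator of the system. -/
def resOp (lam : ℂ) (c : unitInterval) :
    C(unitInterval, Fin 3 → ℂ) →L[ℂ] C(unitInterval, Fin 3 → ℂ) :=
  Ring.inverse (1 - sysOp hp lam c)

theorem resOp_eq (lam : ℂ) {c : unitInterval} (hc : c = 0 ∨ c = 1)
    (g : C(unitInterval, Fin 3 → ℂ)) :
    resOp hp lam c g = g + sysOp hp lam c (resOp hp lam c g) := by
  have h := Ring.mul_inverse_cancel _ (isUnit_one_sub_sysOp hp lam hc)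
  have h' : (1 - sysOp hp lam c) (resOp hp lam c g) = g := DFunLike.congr_fun h g
  calc resOp hp lam c g = (1 - sysOp hp lam c) (resOp hp lam c g)
        + sysOp hp lam c (resOp hp lam c g) := by simp
    _ = _ := by rw [h']

theorem eq_resOp (lam : ℂ) {c : unitInterval} (hc : c = 0 ∨ c = 1)
    {f g : C(unitInterval, Fin 3 → ℂ)} (hf : f = g + sysOp hp lam c f) :
    f = resOp hp lam c g := by
  have h := Ring.inverse_mul_cancel _ (isUnit_one_sub_sysOp hp lam hc)
  have h' : resOp hp lam c ((1 - sysOp hp lam c) f) = f := DFunLike.congr_fun h f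
  have h2 : (1 - sysOp hp lam c) f = g := by
    change f - sysOp hp lam c f = g
    exact sub_eq_iff_eq_add.2 hf
  rw [← h', h2]

theorem differentiable_ringInverse_affine {E : Type*} [NormedAddCommGroup E] [NormedSpace ℂ E]
    [CompleteSpace E] (K N : E →L[ℂ] E) (h : ∀ z : ℂ, IsUnit (1 - (K + z • N))) (v : E) :
    Differentiable ℂ fun z : ℂ => Ring.inverse (1 - (K + z • N)) v := by
  intro z
  have h2 : DifferentiableAt ℂ (fun z : ℂ => 1 - (K + z • N)) z := by
    fun_prop
  have := DifferentiableAt.inverse (𝕜 := ℂ) (R := E →L[ℂ] E) (h := fun z => 1 - (K + z • N)) h2 (h z)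
  exact this.clm_apply (differentiableAt_const _)

theorem differentiable_resOp {c : unitInterval} (hc : c = 0 ∨ c = 1)
    (g : C(unitInterval, Fin 3 → ℂ)) : Differentiable ℂ fun lam => resOp hp lam c g := by
  have h : ∀ lam, resOp hp lam c = Ring.inverse
      (1 - (volterra (baseCoef p) (intervalIntegrable_baseCoef hp) c + lam • paramOp c)) :=
    fun lam => by rw [resOp, sysOp_eq]
  simp only [h]
  exact differentiable_ringInverse_affine _ _
    (fun z => by rw [← sysOp_eq]; exact isUnit_one_sub_sysOp hp z hc) g

/-- The constant function. -/
abbrev constFun (v : Fin 3 → ℂ) : C(unitInterval, Fin 3 → ℂ) := ContinuousMap.const _ v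

/-- The solution of the system with the value `v` at `c`. -/
def sol (lam : ℂ) (c : unitInterval) (v : Fin 3 → ℂ) : C(unitInterval, Fin 3 → ℂ) :=
  resOp hp lam c (constFun v)

theorem sysOp_self (lam : ℂ) (c : unitInterval) (f : C(unitInterval, Fin 3 → ℂ)) :
    sysOp hp lam c f c = 0 := by
  simp [sysOp, volterra_apply]

theorem paramOp_self (c : unitInterval) (f : C(unitInterval, Fin 3 → ℂ)) :
    paramOp c f c = 0 := by
  simp [paramOp, volterra_apply]

theorem sol_self (lam : ℂ) {c : unitInterval} (hc : c = 0 ∨ c = 1) (v : Fin 3 → ℂ) :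
    sol hp lam c v c = v := by
  rw [sol, resOp_eq hp lam hc, ContinuousMap.add_apply, sysOp_self]
  simp

theorem differentiable_sol_apply {c : unitInterval} (hc : c = 0 ∨ c = 1) (v : Fin 3 → ℂ)
    (x : unitInterval) (i : Fin 3) : Differentiable ℂ fun lam => sol hp lam c v x i := by
  have h1 : Differentiable ℂ fun lam => resOp hp lam c (constFun v) :=
    differentiable_resOp hp hc _
  have h2 := (ContinuousMap.evalCLM ℂ x : C(unitInterval, Fin 3 → ℂ) →L[ℂ] _).differentiable.comp h1
  exact differentiable_pi.1 h2 i

/-! ### Quasi-derivatives and the system -/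

theorem absolutelyContinuousOnInterval_pi {F : ℝ → Fin 3 → ℂ} {a b : ℝ} :
    AbsolutelyContinuousOnInterval F a b ↔
      ∀ k, AbsolutelyContinuousOnInterval (fun x => F x k) a b := by
  constructor
  · intro h k
    refine absolutelyContinuousOnInterval_of_dist_le (K := 1) h fun x _ y _ => ?_
    rw [one_mul]
    exact dist_le_pi_dist (F x) (F y) k
  · intro h
    have h3 := ((h 0).add (h 1)).add (h 2)
    unfold AbsolutelyContinuousOnInterval at h ⊢
    refine squeeze_zero' (Eventually.of_forall fun _ => Finset.sum_nonneg fun _ _ => dist_nonneg) ?_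
      (by simpa using ((h 0).add (h 1)).add (h 2))
    refine Eventually.of_forall fun J => ?_
    rw [← Finset.sum_add_distrib, ← Finset.sum_add_distrib]
    refine Finset.sum_le_sum fun i _ => ?_
    refine (dist_pi_le_iff (by positivity)).2 fun k => ?_
    have h0 : ∀ k, 0 ≤ dist (F (J.2 i).1 k) (F (J.2 i).2 k) := fun _ => dist_nonneg
    have := h0 0; have := h0 1; have := h0 2
    fin_cases k <;> simp <;> linarith

/-- The bridge from quasi-derivatives to an integral equation with an arbitrary base point. `G = 0`
gives solutions of the equation; for associated functions `G` is a combination of earlier members of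
the chain. -/
theorem isQuasi_iff (lam : ℂ) (c : unitInterval) (Y : Fin 3 → unitInterval → ℂ)
    (G : C(unitInterval, Fin 3 → ℂ)) :
    IsQuasi (assocMatrix p) Y (lam • Y 0 + fun x => G x 0) ↔
      ∃ f : C(unitInterval, Fin 3 → ℂ), (∀ k x, Y k x = f x k) ∧
        f = constFun (f c) + sysOp hp lam c f + paramOp c G := by
  have hI : uIcc (0 : ℝ) 1 = Icc 0 1 := uIcc_of_le zero_le_one
  have key : ∀ f : C(unitInterval, Fin 3 → ℂ),
      f = constFun (f c) + sysOp hp lam c f + paramOp c G ↔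
      (AbsolutelyContinuousOnInterval (ext f) 0 1 ∧ ∀ᵐ x : ℝ, x ∈ Ioo (0 : ℝ) 1 →
        HasDerivAt (ext f) (coef p lam x (ext f x) + paramCLM (ext G x)) x) := by
    intro f
    have hi1 := intervalIntegrable_clm_apply (intervalIntegrable_coef hp lam) (continuous_ext f)
    have hi2 : IntervalIntegrable (fun t => paramCLM (ext G t)) volume 0 1 :=
      intervalIntegrable_clm_apply (A := fun _ => paramCLM) intervalIntegrable_const
        (continuous_ext G)
    rw [ac_and_hasDerivAt_iff (hi1.add hi2) c.2]
    have e : ∀ x : unitInterval,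
        ∫ t in (c : ℝ)..x, (coef p lam t (ext f t) + paramCLM (ext G t))
        = sysOp hp lam c f x + paramOp c G x := fun x =>
      intervalIntegral.integral_add (hi1.mono_set (unitInterval_uIcc_subset c x))
        (hi2.mono_set (unitInterval_uIcc_subset c x))
    constructor
    · intro h x hx
      rw [e ⟨x, hx⟩, ext_of_mem f hx, ext_apply]
      conv_lhs => rw [h]
      simp [add_assoc]
    · intro h
      ext1 x
      have := h x x.2
      rw [ext_apply, ext_apply, e x] at this
      rw [this]
      simp [add_assoc]
  constructor
  · intro h
    have hcont : ∀ k, Continuous (Y k) := by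
      intro k
      have := (h.ac k).continuousOn
      rw [hI] at this
      have h2 := this.comp_continuous continuous_subtype_val fun x : unitInterval => x.2
      refine h2.congr fun x => IccExtend_val _ _ _
    refine ⟨⟨fun x k => Y k x, by fun_prop⟩, fun k x => rfl, ?_⟩
    rw [key]
    refine ⟨absolutelyContinuousOnInterval_pi.2 fun k => h.ac k, ?_⟩
    filter_upwards [h.quasi_one, h.quasi_two, h.quasi_three] with x h1 h2 h3 hx
    rw [hasDerivAt_pi, coef_apply, paramCLM_apply, ext_of_mem _ (Ioo_subset_Icc_self hx),
      ext_of_mem _ (Ioo_subset_Icc_self hx)]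
    intro k
    fin_cases k
    · refine (h1 hx).congr_deriv ?_
      simp [assocMatrix]
    · refine (h2 hx).congr_deriv ?_
      simp [assocMatrix]; ring
    · refine (h3 hx).congr_deriv ?_
      simp [assocMatrix]; ring
  · rintro ⟨f, hY, hf⟩
    rw [key] at hf
    obtain ⟨hac, hd⟩ := hf
    have hYf : ∀ k, (IccExtend zero_le_one (Y k) : ℝ → ℂ) = fun x => ext f x k := by
      intro k; ext x; exact hY k _
    have hd' : ∀ᵐ x : ℝ, x ∈ Ioo (0 : ℝ) 1 → ∀ k, HasDerivAt (fun x => ext f x k)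
        ((coef p lam x (ext f x) + paramCLM (ext G x)) k) x := by
      filter_upwards [hd] with x hx hx1 using hasDerivAt_pi.1 (hx hx1)
    refine ⟨fun k => ?_, ?_, ?_, ?_⟩
    · rw [hYf]; exact absolutelyContinuousOnInterval_pi.1 hac k
    · filter_upwards [hd'] with x hx hx1
      rw [hYf]
      refine (hx hx1 0).congr_deriv ?_
      rw [coef_apply, paramCLM_apply, ext_of_mem _ (Ioo_subset_Icc_self hx1)]
      simp [assocMatrix, hY]
    · filter_upwards [hd'] with x hx hx1
      rw [hYf]
      refine (hx hx1 1).congr_deriv ?_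
      rw [coef_apply, paramCLM_apply, ext_of_mem _ (Ioo_subset_Icc_self hx1)]
      simp [assocMatrix, hY]; ring
    · filter_upwards [hd'] with x hx hx1
      rw [hYf]
      refine (hx hx1 2).congr_deriv ?_
      rw [coef_apply, paramCLM_apply, ext_of_mem _ (Ioo_subset_Icc_self hx1),
        ext_of_mem _ (Ioo_subset_Icc_self hx1)]
      simp [assocMatrix, hY]; ring

/-- `f` solves the system with the parameter `lam`. -/
def SolvesSystem (p : ℝ → ℂ) (lam : ℂ) (f : ℝ → Fin 3 → ℂ) : Prop :=
  AbsolutelyContinuousOnInterval f 0 1 ∧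
    ∀ᵐ x : ℝ, x ∈ Ioo (0 : ℝ) 1 → HasDerivAt f (coef p lam x (f x)) x

theorem solvesSystem_ext_iff (lam : ℂ) (c : unitInterval) (f : C(unitInterval, Fin 3 → ℂ)) :
    SolvesSystem p lam (ext f) ↔ f = constFun (f c) + sysOp hp lam c f := by
  have hi1 := intervalIntegrable_clm_apply (intervalIntegrable_coef hp lam) (continuous_ext f)
  rw [SolvesSystem, ac_and_hasDerivAt_iff hi1 c.2]
  constructor
  · intro h
    ext1 x
    have := h x x.2
    rw [ext_apply, ext_apply] at this
    rw [this]; rfl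
  · intro h x hx
    rw [ext_of_mem f hx, ext_apply]
    conv_lhs => rw [h]
    rfl

theorem solvesSystem_sol (lam : ℂ) {c : unitInterval} (hc : c = 0 ∨ c = 1) (v : Fin 3 → ℂ) :
    SolvesSystem p lam (ext (sol hp lam c v)) := by
  rw [solvesSystem_ext_iff hp lam c, sol_self hp lam hc]
  exact resOp_eq hp lam hc _

include hp in
theorem SolvesSystem.eq_sol {lam : ℂ} {c : unitInterval} (hc : c = 0 ∨ c = 1)
    {f : C(unitInterval, Fin 3 → ℂ)} (hf : SolvesSystem p lam (ext f)) :
    f = sol hp lam c (f c) :=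
  eq_resOp hp lam hc ((solvesSystem_ext_iff hp lam c f).1 hf)

/-- The fundamental matrix of the system, equal to the identity at `0`. -/
def fund (lam : ℂ) (x : unitInterval) : Matrix (Fin 3) (Fin 3) ℂ :=
  Matrix.of fun i j => sol hp lam 0 (Pi.single j 1) x i

theorem fund_zero (lam : ℂ) : fund hp lam 0 = 1 := by
  ext i j
  simp [fund, sol_self, Matrix.one_apply, Pi.single_apply]

theorem sol_zero_apply (lam : ℂ) (v : Fin 3 → ℂ) (x : unitInterval) :
    sol hp lam 0 v x = (fund hp lam x).mulVec v := by
  have hv : constFun v = ∑ j, v j • constFun (Pi.single j 1) := by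
    ext x i
    simp [Finset.sum_apply, Pi.single_apply]
  have h : sol hp lam 0 v = ∑ j, v j • sol hp lam 0 (Pi.single j 1) := by
    rw [sol, hv, map_sum]
    simp only [map_smul]
    rfl
  ext i
  rw [h, ContinuousMap.sum_apply, Finset.sum_apply, Matrix.mulVec, dotProduct]
  refine Finset.sum_congr rfl fun j _ => ?_
  simp [fund, mul_comm]

include hp in
theorem SolvesSystem.eq_fund_mulVec {lam : ℂ} {f : C(unitInterval, Fin 3 → ℂ)}
    (hf : SolvesSystem p lam (ext f)) (x : unitInterval) :
    f x = (fund hp lam x).mulVec (f 0) := by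
  rw [← sol_zero_apply, ← hf.eq_sol hp (Or.inl rfl)]

theorem differentiable_fund (x : unitInterval) (i j : Fin 3) :
    Differentiable ℂ fun lam => fund hp lam x i j :=
  differentiable_sol_apply hp (Or.inl rfl) _ x i

/-- The value at `0` of the solution with the value `(0, 0, 1)` at `1`. -/
def endSol (lam : ℂ) : Fin 3 → ℂ := sol hp lam 1 ![0, 0, 1] 0

theorem differentiable_endSol (i : Fin 3) : Differentiable ℂ fun lam => endSol hp lam i :=
  differentiable_sol_apply hp (Or.inr rfl) _ 0 i

theorem fund_one_mulVec_endSol (lam : ℂ) :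
    (fund hp lam 1).mulVec (endSol hp lam) = ![0, 0, 1] := by
  rw [endSol, ← (solvesSystem_sol hp lam (Or.inr rfl) ![0, 0, 1]).eq_fund_mulVec hp 1,
    sol_self hp lam (Or.inr rfl)]

/-- Lagrange's identity. -/
theorem SolvesSystem.lagrange {lam : ℂ} {f g : C(unitInterval, Fin 3 → ℂ)}
    (hf : SolvesSystem p (-lam) (ext f)) (hg : SolvesSystem p lam (ext g)) (x : unitInterval) :
    f x 2 * g x 0 - f x 1 * g x 1 + f x 0 * g x 2
      = f 0 2 * g 0 0 - f 0 1 * g 0 1 + f 0 0 * g 0 2 := by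
  have hI : uIcc (0 : ℝ) 1 = Icc 0 1 := uIcc_of_le zero_le_one
  have h1 := absolutelyContinuousOnInterval_pi.1 hf.1
  have h2 := absolutelyContinuousOnInterval_pi.1 hg.1
  set W : ℝ → ℂ := fun x => ext f x 2 * ext g x 0 - ext f x 1 * ext g x 1 + ext f x 0 * ext g x 2
    with hW
  have hac : AbsolutelyContinuousOnInterval W 0 1 :=
    (((h1 2).smul (h2 0)).sub ((h1 1).smul (h2 1))).add ((h1 0).smul (h2 2))
  have hz : IntervalIntegrable (fun _ : ℝ => (0 : ℂ)) volume 0 1 := intervalIntegrable_const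
  -- The derivative of the bracket vanishes: the terms with p cancel in pairs, and those with the
  -- spectral parameter cancel because the two parameters are opposite.
  have := (ac_and_hasDerivAt_iff hz (left_mem_Icc.2 zero_le_one)).1 ⟨hac, by
    filter_upwards [hf.2, hg.2] with t ht1 ht2 ht
    have d1 := hasDerivAt_pi.1 (ht1 ht)
    have d2 := hasDerivAt_pi.1 (ht2 ht)
    have := (((d1 2).mul (d2 0)).sub ((d1 1).mul (d2 1))).add ((d1 0).mul (d2 2))
    refine this.congr_deriv ?_
    simp only [coef_apply]
    simp
    ring⟩ x x.2
  rw [intervalIntegral.integral_zero, add_zero] at this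
  simpa only [hW, ext_apply, show (0 : ℝ) = ((0 : unitInterval) : ℝ) from rfl] using this

end ThirdOrder
end

noncomputable section

namespace ThirdOrder

open MeasureTheory Set Filter Topology

variable {p : ℝ → ℂ} (hp : IntervalIntegrable p volume 0 1)

/-! ### Symmetry of the fundamental matrix -/

/-- In Lagrange's identity with the solution normalized at 1, only its second quasi-derivative
survives at 1, and it picks out row 0 of `fund`. Both characteristic functions thereby become
boundary entries of the fundamental matrix at the opposite parameter. -/
theorem fund_neg_row_zero (lam : ℂ) (j : Fin 3) : fund hp (-lam) 1 0 j
    = (Pi.single j 1 : Fin 3 → ℂ) 2 * endSol hp lam 0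
      - (Pi.single j 1 : Fin 3 → ℂ) 1 * endSol hp lam 1
      + (Pi.single j 1 : Fin 3 → ℂ) 0 * endSol hp lam 2 := by
  have h := (solvesSystem_sol hp (-lam) (Or.inl rfl) (Pi.single j 1)).lagrange
    (solvesSystem_sol hp lam (Or.inr rfl) ![0, 0, 1]) 1
  rw [sol_self hp lam (Or.inr rfl), sol_self hp (-lam) (Or.inl rfl)] at h
  simpa [fund, endSol] using h

theorem endSol_zero (lam : ℂ) : endSol hp lam 0 = fund hp (-lam) 1 0 2 := by
  simp [fund_neg_row_zero]

theorem endSol_one (lam : ℂ) : endSol hp lam 1 = -fund hp (-lam) 1 0 1 := by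
  simp [fund_neg_row_zero]

theorem endSol_two (lam : ℂ) : endSol hp lam 2 = fund hp (-lam) 1 0 0 := by
  simp [fund_neg_row_zero]

/-- The inverse of the fundamental matrix, expressed through the fundamental matrix at `-lam`. -/
def fundInv (lam : ℂ) (x : unitInterval) : Matrix (Fin 3) (Fin 3) ℂ :=
  !![fund hp (-lam) x 2 2, -fund hp (-lam) x 1 2, fund hp (-lam) x 0 2;
    -fund hp (-lam) x 2 1, fund hp (-lam) x 1 1, -fund hp (-lam) x 0 1;
    fund hp (-lam) x 2 0, -fund hp (-lam) x 1 0, fund hp (-lam) x 0 0]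

/-- The entries are, up to sign, Lagrange brackets of columns at `-lam` and `lam`, which keep their
values from x = 0. -/
theorem fundInv_mul_fund (lam : ℂ) (x : unitInterval) : fundInv hp lam x * fund hp lam x = 1 := by
  have key : ∀ i j : Fin 3, fund hp (-lam) x 2 i * fund hp lam x 0 j
      - fund hp (-lam) x 1 i * fund hp lam x 1 j + fund hp (-lam) x 0 i * fund hp lam x 2 j
      = (Pi.single i 1 : Fin 3 → ℂ) 2 * (Pi.single j 1 : Fin 3 → ℂ) 0
        - (Pi.single i 1 : Fin 3 → ℂ) 1 * (Pi.single j 1 : Fin 3 → ℂ) 1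
        + (Pi.single i 1 : Fin 3 → ℂ) 0 * (Pi.single j 1 : Fin 3 → ℂ) 2 := by
    intro i j
    have h := (solvesSystem_sol hp (-lam) (Or.inl rfl) (Pi.single i 1)).lagrange
      (solvesSystem_sol hp lam (Or.inl rfl) (Pi.single j 1)) x
    rw [sol_self hp lam (Or.inl rfl), sol_self hp (-lam) (Or.inl rfl)] at h
    exact h
  have k0 := fun j => key 2 j
  have k1 := fun j => key 1 j
  have k2 := fun j => key 0 j
  ext i j
  fin_cases i
  · have := k0 j
    fin_cases j <;> simp [fundInv, Matrix.mul_apply, Fin.sum_univ_three] at this ⊢ <;>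
      linear_combination this
  · have := k1 j
    fin_cases j <;> simp [fundInv, Matrix.mul_apply, Fin.sum_univ_three] at this ⊢ <;>
      linear_combination -this
  · have := k2 j
    fin_cases j <;> simp [fundInv, Matrix.mul_apply, Fin.sum_univ_three] at this ⊢ <;>
      linear_combination this

theorem fund_mul_fundInv (lam : ℂ) (x : unitInterval) : fund hp lam x * fundInv hp lam x = 1 :=
  mul_eq_one_comm.1 (fundInv_mul_fund hp lam x)

/-! ### Growth of the fundamental matrix -/

/-- Pointwise application of a continuous linear map. -/
def mapOp {V : Type*} [NormedAddCommGroup V] [NormedSpace ℂ V] (L : V →L[ℂ] V)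
    (f : C(unitInterval, V)) : C(unitInterval, V) :=
  ⟨fun x => L (f x), by fun_prop⟩

theorem mapOp_volterra {V : Type*} [NormedAddCommGroup V] [NormedSpace ℂ V] [CompleteSpace V]
    (L : V →L[ℂ] V) {A A' : ℝ → V →L[ℂ] V} (hA : IntervalIntegrable A volume 0 1)
    (hA' : IntervalIntegrable A' volume 0 1) (h : ∀ t v, L (A t v) = A' t (L v))
    (c : unitInterval) (f : C(unitInterval, V)) :
    mapOp L (volterra A hA c f) = volterra A' hA' c (mapOp L f) := by
  ext x
  change L (∫ t in (c : ℝ)..x, A t (ext f t)) = ∫ t in (c : ℝ)..x, A' t (L (ext f t))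
  rw [← L.intervalIntegral_comp_comm ((intervalIntegrable_clm_apply hA (continuous_ext f)).mono_set
    (unitInterval_uIcc_subset c x))]
  exact intervalIntegral.integral_congr fun t _ => h t _

/-- Rescaling the components by 1, s, s² with s² = 1 + ‖lam‖ turns the coefficient into one of norm
at most 2s + |p|; the Gronwall estimate then gives exp(O(s)). -/
theorem halfGrowth_fund (x : unitInterval) (i j : Fin 3) :
    HalfGrowth fun lam => fund hp lam x i j := by
  set P : ℝ := ∫ t in (0 : ℝ)..1, ‖p t‖ with hP
  have hP0 : 0 ≤ P := intervalIntegral.integral_nonneg zero_le_one fun t _ => norm_nonneg _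
  -- The 7 collects s² ≤ exp(2s) from undoing the rescaling, 2 ≤ exp(s) for the Gronwall constant,
  -- and exp(4s) from twice the integral of 2s.
  refine ⟨7 + 2 * P, by positivity, fun lam => ?_⟩
  set s : ℝ := √(1 + ‖lam‖) with hs
  have hs1 : 1 ≤ s := by rw [hs, Real.one_le_sqrt]; linarith [norm_nonneg lam]
  have hs2 : s ^ 2 = 1 + ‖lam‖ := Real.sq_sqrt (by positivity)
  have hs0 : (s : ℂ) ≠ 0 := by
    rw [Complex.ofReal_ne_zero]; positivity
  have hns : ‖(s : ℂ)‖ = s := by rw [Complex.norm_real, Real.norm_of_nonneg (by positivity)]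
  set S := matCLM (Matrix.diagonal ![1, (s : ℂ), (s : ℂ) ^ 2]) with hS
  set R := matCLM (Matrix.diagonal ![1, (s : ℂ)⁻¹, ((s : ℂ) ^ 2)⁻¹]) with hR
  have hSa : ∀ v, S v = ![v 0, s * v 1, s ^ 2 * v 2] := by
    intro v; ext i; rw [hS, matCLM_apply, Matrix.mulVec_diagonal]; fin_cases i <;> simp
  have hRa : ∀ v, R v = ![v 0, (s : ℂ)⁻¹ * v 1, ((s : ℂ) ^ 2)⁻¹ * v 2] := by
    intro v; ext i; rw [hR, matCLM_apply, Matrix.mulVec_diagonal]; fin_cases i <;> simp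
  set A' : ℝ → (Fin 3 → ℂ) →L[ℂ] (Fin 3 → ℂ) := fun t => R.comp ((coef p lam t).comp S) with hA'
  have hA'i : IntervalIntegrable A' volume 0 1 := by
    have h1 := intervalIntegrable_coef hp lam
    rw [intervalIntegrable_iff] at h1 ⊢
    exact (ContinuousLinearMap.integrable_comp
      ((ContinuousLinearMap.compL ℂ (Fin 3 → ℂ) (Fin 3 → ℂ) (Fin 3 → ℂ) R).comp
      ((ContinuousLinearMap.compL ℂ (Fin 3 → ℂ) (Fin 3 → ℂ) (Fin 3 → ℂ)).flip S)) h1 :)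
  have hconj : ∀ t v, R (coef p lam t v) = A' t (R v) := by
    intro t v
    have : S (R v) = v := by
      rw [hSa, hRa]; ext i; fin_cases i <;> simp <;> field_simp
    simp only [hA', ContinuousLinearMap.comp_apply, this]
  have hnorm : ∀ t, ‖A' t‖ ≤ 2 * s + ‖p t‖ := by
    intro t
    refine ContinuousLinearMap.opNorm_le_bound _ (by positivity) fun v => ?_
    have hv : ∀ i, ‖v i‖ ≤ ‖v‖ := norm_le_pi_norm v
    refine (pi_norm_le_iff_of_nonneg (by positivity)).2 fun i => ?_
    have e : A' t v = ![s * v 1, s * v 2 - (s : ℂ)⁻¹ * (p t * v 0),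
        ((s : ℂ) ^ 2)⁻¹ * lam * v 0 - (s : ℂ)⁻¹ * (p t * v 1)] := by
      simp only [hA', ContinuousLinearMap.comp_apply]
      rw [hRa, coef_apply, hSa]
      ext i; fin_cases i <;> simp <;> field_simp
    have hsinv : ‖(s : ℂ)⁻¹‖ ≤ 1 := by rw [norm_inv, hns]; exact inv_le_one_of_one_le₀ hs1
    have hpv : ∀ i, ‖(s : ℂ)⁻¹ * (p t * v i)‖ ≤ ‖p t‖ * ‖v‖ := by
      intro i
      rw [norm_mul, norm_mul]
      calc ‖(s : ℂ)⁻¹‖ * (‖p t‖ * ‖v i‖) ≤ 1 * (‖p t‖ * ‖v‖) := by gcongr; exact hv i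
        _ = _ := one_mul _
    have hsv : ∀ i, ‖(s : ℂ) * v i‖ ≤ s * ‖v‖ := by
      intro i; rw [norm_mul, hns]; gcongr; exact hv i
    have hlv : ‖((s : ℂ) ^ 2)⁻¹ * lam * v 0‖ ≤ s * ‖v‖ := by
      rw [norm_mul, norm_mul, norm_inv, norm_pow, hns, hs2]
      have : (1 + ‖lam‖)⁻¹ * ‖lam‖ ≤ 1 := by
        rw [inv_mul_le_iff₀ (by positivity)]; linarith
      exact mul_le_mul (this.trans hs1) (hv 0) (norm_nonneg _) (by positivity)
    have hsv0 : 0 ≤ s * ‖v‖ := by positivity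
    have hpv0 : 0 ≤ ‖p t‖ * ‖v‖ := by positivity
    rw [e, add_mul]
    fin_cases i
    · have := hsv 1
      simp at this ⊢; linarith
    · have := norm_sub_le ((s : ℂ) * v 2) ((s : ℂ)⁻¹ * (p t * v 0))
      have h1 := hsv 2; have h2 := hpv 0
      change ‖(s : ℂ) * v 2 - (s : ℂ)⁻¹ * (p t * v 0)‖ ≤ _
      linarith
    · have := norm_sub_le (((s : ℂ) ^ 2)⁻¹ * lam * v 0) ((s : ℂ)⁻¹ * (p t * v 1))
      have h2 := hpv 1
      change ‖((s : ℂ) ^ 2)⁻¹ * lam * v 0 - (s : ℂ)⁻¹ * (p t * v 1)‖ ≤ _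
      linarith
  have hint : ∫ t in (0 : ℝ)..1, ‖A' t‖ ≤ 2 * s + P := by
    calc ∫ t in (0 : ℝ)..1, ‖A' t‖ ≤ ∫ t in (0 : ℝ)..1, (2 * s + ‖p t‖) :=
          intervalIntegral.integral_mono_on zero_le_one hA'i.norm
            (intervalIntegrable_const.add hp.norm) fun t _ => hnorm t
      _ = 2 * s + P := by
          rw [intervalIntegral.integral_add intervalIntegrable_const hp.norm]; simp [hP]
  set f := sol hp lam 0 (Pi.single j 1) with hf
  have hfeq : f = constFun (Pi.single j 1) + sysOp hp lam 0 f := resOp_eq hp lam (Or.inl rfl) _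
  have hg : mapOp R f = mapOp R (constFun (Pi.single j 1)) + volterra A' hA'i 0 (mapOp R f) := by
    rw [← mapOp_volterra R (intervalIntegrable_coef hp lam) hA'i hconj]
    conv_lhs => rw [hfeq]
    ext1 x
    exact map_add R _ _
  have hgb := norm_le_exp_of_eq_add_volterra hA'i hg
  have hini : ‖mapOp R (constFun (Pi.single j 1))‖ ≤ 1 := by
    refine (ContinuousMap.norm_le _ zero_le_one).2 fun x => ?_
    change ‖R (Pi.single j 1)‖ ≤ 1
    refine (pi_norm_le_iff_of_nonneg zero_le_one).2 fun i => ?_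
    have h1 : ‖(s : ℂ)⁻¹‖ ≤ 1 := by rw [norm_inv, hns]; exact inv_le_one_of_one_le₀ hs1
    have h2 : ‖((s : ℂ) ^ 2)⁻¹‖ ≤ 1 := by
      rw [norm_inv, norm_pow, hns]; exact inv_le_one_of_one_le₀ (one_le_pow₀ hs1)
    rw [hRa]
    fin_cases i <;> fin_cases j <;> simp at h1 h2 ⊢ <;> assumption
  have hfx : ‖f x i‖ ≤ s ^ 2 * ‖mapOp R f‖ := by
    have h1 : ‖R (f x)‖ ≤ ‖mapOp R f‖ := (mapOp R f).norm_coe_le_norm x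
    have h2 := (norm_le_pi_norm (R (f x)) i).trans h1
    rw [hRa] at h2
    have hm : 0 ≤ ‖mapOp R f‖ := norm_nonneg _
    fin_cases i
    · simp at h2 ⊢; nlinarith [one_le_pow₀ hs1 (n := 2)]
    · simp [abs_of_nonneg (show 0 ≤ s by positivity)] at h2 ⊢
      rw [inv_mul_le_iff₀ (by positivity)] at h2
      have : s * ‖mapOp R f‖ ≤ s ^ 2 * ‖mapOp R f‖ := by
        gcongr; nlinarith
      exact h2.trans this
    · simp [abs_of_nonneg (show 0 ≤ s by positivity)] at h2 ⊢
      rwa [inv_mul_le_iff₀ (by positivity)] at h2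
  have he : s ≤ Real.exp s := by linarith [Real.add_one_le_exp s]
  have he2 : 2 ≤ Real.exp s := by linarith [Real.add_one_le_exp s]
  change ‖f x i‖ ≤ _
  have hle : Real.exp (2 * ∫ t in (0 : ℝ)..1, ‖A' t‖) ≤ Real.exp (4 * s + 2 * P * s) := by
    apply Real.exp_le_exp.2
    nlinarith
  calc ‖f x i‖ ≤ s ^ 2 * ‖mapOp R f‖ := hfx
    _ ≤ Real.exp s ^ 2 * (Real.exp s * Real.exp (4 * s + 2 * P * s) * 1) := by
        gcongr
        refine hgb.trans ?_
        gcongr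
    _ = Real.exp ((7 + 2 * P) * s) := by
        rw [mul_one, ← Real.exp_nat_mul, ← Real.exp_add, ← Real.exp_add]
        congr 1; push_cast; ring

theorem halfGrowth_endSol (i : Fin 3) : HalfGrowth fun lam => endSol hp lam i := by
  fin_cases i
  · change HalfGrowth fun lam => endSol hp lam 0
    simp only [endSol_zero]
    exact (halfGrowth_fund hp 1 0 2).comp_neg
  · change HalfGrowth fun lam => endSol hp lam 1
    simp only [endSol_one]
    have := (HalfGrowth.const (-1)).mul (halfGrowth_fund hp 1 0 1).comp_neg
    simpa using this
  · change HalfGrowth fun lam => endSol hp lam 2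
    simp only [endSol_two]
    exact (halfGrowth_fund hp 1 0 0).comp_neg

/-! ### The separation condition -/

theorem diagDelta_zero (C : Fin 3 → Fin 3 → unitInterval → ℂ) : diagDelta C 0
    = formV 1 (C 1) * formV 2 (C 2) - formV 1 (C 2) * formV 2 (C 1) := by
  let e : Fin 2 ≃ {r : Fin 3 // (0 : Fin 3) < r} :=
    ⟨fun i => ⟨i.succ, Fin.succ_pos i⟩, fun r => r.1.pred (ne_of_gt r.2), fun i => by simp,
      fun r => by simp⟩
  rw [diagDelta, ← Matrix.det_submatrix_equiv_self e, Matrix.det_fin_two]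
  rfl

theorem diagDelta_one (C : Fin 3 → Fin 3 → unitInterval → ℂ) : diagDelta C 1 = formV 2 (C 2) := by
  let u : Unique {r : Fin 3 // (1 : Fin 3) < r} := ⟨⟨⟨2, by decide⟩⟩, fun ⟨r, hr⟩ => by
    ext
    have h1 := Fin.lt_def.1 hr
    have h2 := r.2
    change (r : ℕ) = 2
    simp only [Fin.val_one] at h1
    omega⟩
  rw [diagDelta, Matrix.det_unique]
  rfl

/-- Here `fund` 1 0 0 is Δ_{2,2}, and by Cramer's rule `endSol` 2 is Δ_{1,1} up to the Wronskian. So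
this is the separation condition for m = 1, the index `0` in the code. -/
theorem Separated.endSol_two_ne_zero (h : Separated p) (lam : ℂ) (h0 : fund hp lam 1 0 0 = 0) :
    endSol hp lam 2 ≠ 0 := by
  intro h2
  set C : Fin 3 → Fin 3 → unitInterval → ℂ := fun k i x => fund hp lam x i k.rev with hC
  have hfund : IsFundamental p lam C := by
    refine ⟨fun k => ?_, fun s k => ?_⟩
    · have := (isQuasi_iff hp lam 0 (C k) 0).2 ⟨sol hp lam 0 (Pi.single k.rev 1),
        fun i x => rfl, by
          rw [sol_self hp lam (Or.inl rfl), (paramOp 0).map_zero, add_zero]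
          exact resOp_eq hp lam (Or.inl rfl) _⟩
      have hz : (fun x : unitInterval => (0 : C(unitInterval, Fin 3 → ℂ)) x 0) = 0 := rfl
      rw [hz, add_zero] at this
      exact this
    · simp only [formU, hC, fund_zero, Matrix.one_apply, Fin.rev_inj]
  have hb := fund_one_mulVec_endSol hp lam
  have e0 := congr_fun hb 0
  have e1 := congr_fun hb 1
  have e2 := congr_fun hb 2
  simp only [Matrix.mulVec, dotProduct, Fin.sum_univ_three] at e0 e1 e2
  simp [h0, h2] at e0 e1 e2
  -- With both quantities zero, the first row of the end point relation leaves one product equal to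
  -- 0; the case where its `endSol` factor vanishes is settled by the other two rows.
  have hdet : fund hp lam 1 1 0 * fund hp lam 1 0 1 = 0 := by
    rcases e0 with h3 | h3
    · simp [h3]
    · simp [h3] at e1 e2
      rcases e1 with h4 | h4
      · simp [h4]
      · simp [h4] at e2
  refine h 0 lam C hfund ⟨?_, ?_⟩
  · refine (diagDelta_zero C).trans ?_
    change fund hp lam 1 1 1 * fund hp lam 1 0 0 - fund hp lam 1 1 0 * fund hp lam 1 0 1 = 0
    rw [h0, hdet]; ring
  · exact (diagDelta_one C).trans h0

end ThirdOrder
end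

noncomputable section

namespace ThirdOrder

open MeasureTheory Set Filter Topology

variable {p : ℝ → ℂ} (hp : IntervalIntegrable p volume 0 1)

/-! ### Algebraic multiplicities -/

/-- The right hand sides of the chain of equations of the associated functions and the chain of
associated functions normalized at `1`. -/
def chainSol (lam : ℂ) : ℕ → C(unitInterval, Fin 3 → ℂ)
  | 0 => resOp hp lam 1 (constFun ![0, 0, 1])
  | n + 1 => resOp hp lam 1 (paramOp 1 (chainSol lam n))

/-- The right hand side of the integral equation of `chainSol`. -/
def chainRhs (lam : ℂ) : ℕ → C(unitInterval, Fin 3 → ℂ)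
  | 0 => constFun ![0, 0, 1]
  | n + 1 => paramOp 1 (chainSol hp lam n)

theorem chainSol_eq (lam : ℂ) (n : ℕ) :
    chainSol hp lam n = resOp hp lam 1 (chainRhs hp lam n) := by
  cases n <;> rfl

theorem resOp_apply_one (lam : ℂ) (g : C(unitInterval, Fin 3 → ℂ)) :
    resOp hp lam 1 g 1 = g 1 := by
  rw [resOp_eq hp lam (Or.inr rfl), ContinuousMap.add_apply, sysOp_self, add_zero]

theorem chainSol_zero_one (lam : ℂ) : chainSol hp lam 0 1 = ![0, 0, 1] :=
  resOp_apply_one hp lam _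

/-- The resolvent identity. -/
theorem resOp_add (lam z : ℂ) (h : C(unitInterval, Fin 3 → ℂ)) :
    resOp hp (lam + z) 1 h
      = resOp hp lam 1 h + z • resOp hp (lam + z) 1 (paramOp 1 (resOp hp lam 1 h)) := by
  symm
  refine eq_resOp hp (lam + z) (Or.inr rfl) ?_
  have h1 := resOp_eq hp lam (Or.inr rfl) h
  set r := resOp hp lam 1 h
  have h2 := resOp_eq hp (lam + z) (Or.inr rfl) (paramOp 1 r)
  set q := resOp hp (lam + z) 1 (paramOp 1 r)
  have h3 : sysOp hp (lam + z) 1 r = sysOp hp lam 1 r + z • paramOp 1 r := by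
    rw [sysOp_add_smul]; rfl
  have h4 : sysOp hp (lam + z) 1 (r + z • q)
      = sysOp hp (lam + z) 1 r + z • sysOp hp (lam + z) 1 q := by
    rw [(sysOp hp (lam + z) 1).map_add, (sysOp hp (lam + z) 1).map_smul]
  rw [h4, h3]
  conv_lhs => rw [h1, h2]
  ext x i
  simp only [ContinuousMap.add_apply, ContinuousMap.smul_apply, Pi.add_apply, Pi.smul_apply,
    smul_eq_mul]
  ring

/-- Iterating the resolvent identity is Taylor's formula at `lam`: each vanishing chain value at 0
releases one factor z - lam, and the remainder is again a resolvent, hence entire. -/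
theorem exists_analytic_expansion (lam : ℂ) (k : Fin 3) (m : ℕ)
    (h0 : ∀ j < m, chainSol hp lam j 0 k = 0) :
    ∃ g : ℂ → ℂ, Differentiable ℂ g ∧ g lam = chainSol hp lam m 0 k ∧
      ∀ z, endSol hp z k = (z - lam) ^ m * g z := by
  refine ⟨fun z => resOp hp z 1 (chainRhs hp lam m) 0 k, ?_, ?_, ?_⟩
  · have h2 := (ContinuousMap.evalCLM ℂ (0 : unitInterval) :
      C(unitInterval, Fin 3 → ℂ) →L[ℂ] _).differentiable.comp
      (differentiable_resOp hp (Or.inr rfl) (chainRhs hp lam m))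
    exact differentiable_pi.1 h2 k
  · simp only [chainSol_eq]
  · intro z
    induction m with
    | zero => simp [endSol, sol, chainRhs]
    | succ m ih =>
      rw [ih fun j hj => h0 j (hj.trans (Nat.lt_succ_self m))]
      have h1 := resOp_add hp lam (z - lam) (chainRhs hp lam m)
      rw [add_sub_cancel, ← chainSol_eq] at h1
      have h2 := congr_fun (DFunLike.congr_fun h1 0) k
      simp only [ContinuousMap.add_apply, ContinuousMap.smul_apply, Pi.add_apply, Pi.smul_apply,
        smul_eq_mul, h0 m (Nat.lt_succ_self m), zero_add] at h2
      change _ * resOp hp z 1 (chainRhs hp lam m) 0 k = _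
      rw [h2, pow_succ, mul_assoc]
      rfl

/-- If n + 1 chain values vanished, the expansion would give order above n; the first nonvanishing
one is the leading Taylor coefficient. -/
theorem chainSol_of_analyticOrderAt (lam : ℂ) (k : Fin 3) (n : ℕ)
    (hn : analyticOrderAt (fun z => endSol hp z k) lam = n) :
    (∀ j < n, chainSol hp lam j 0 k = 0) ∧ chainSol hp lam n 0 k ≠ 0 := by
  have han : AnalyticAt ℂ (fun z => endSol hp z k) lam := (differentiable_endSol hp k).analyticAt lam
  have hex : ∃ m, chainSol hp lam m 0 k ≠ 0 := by
    by_contra! hall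
    obtain ⟨g, hg, -, hz⟩ := exists_analytic_expansion hp lam k (n + 1) fun j _ => hall j
    have : ((n + 1 : ℕ) : ℕ∞) ≤ analyticOrderAt (fun z => endSol hp z k) lam :=
      (natCast_le_analyticOrderAt han).2 ⟨g, hg.analyticAt lam, Eventually.of_forall hz⟩
    rw [hn, Nat.cast_le] at this
    omega
  classical
  have hmin : ∀ j < Nat.find hex, chainSol hp lam j 0 k = 0 := fun j hj => by
    simpa using Nat.find_min hex hj
  obtain ⟨g, hg, hg0, hz⟩ := exists_analytic_expansion hp lam k (Nat.find hex) hmin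
  have hord : analyticOrderAt (fun z => endSol hp z k) lam = (Nat.find hex : ℕ) :=
    han.analyticOrderAt_eq_natCast.2 ⟨g, hg.analyticAt lam, hg0 ▸ Nat.find_spec hex,
      Eventually.of_forall hz⟩
  rw [hn, Nat.cast_inj] at hord
  rw [hord]
  exact ⟨hmin, Nat.find_spec hex⟩

theorem eq_zero_of_ae_Ioo {h : unitInterval → ℂ} (hc : Continuous h)
    (h0 : ∀ᵐ x : ℝ, ∀ hx : x ∈ Ioo (0 : ℝ) 1, h ⟨x, Ioo_subset_Icc_self hx⟩ = 0) : h = 0 := by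
  have h1 : IccExtend zero_le_one h =ᵐ[volume.restrict (Icc (0 : ℝ) 1)] fun _ => 0 := by
    rw [← restrict_Ioo_eq_restrict_Icc]
    refine (ae_restrict_iff' measurableSet_Ioo).2 ?_
    filter_upwards [h0] with x hx hx1
    rw [IccExtend_of_mem _ _ (Ioo_subset_Icc_self hx1)]
    exact hx hx1
  have h2 := Measure.eqOn_Icc_of_ae_eq volume zero_ne_one h1
    hc.Icc_extend'.continuousOn continuousOn_const
  ext x
  have := h2 x.2
  rwa [IccExtend_val] at this

/-- A function of the domain vanishes only together with its quasi-derivatives. -/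
theorem IsQuasi.eq_zero {Y : Fin 3 → unitInterval → ℂ} {g : unitInterval → ℂ}
    (h : IsQuasi (assocMatrix p) Y g) (hc : ∀ k, Continuous (Y k)) (hg : Continuous g)
    (h0 : Y 0 = 0) : Y 1 = 0 ∧ Y 2 = 0 ∧ g = 0 := by
  have hz : (IccExtend (zero_le_one (α := ℝ)) (0 : unitInterval → ℂ)) = fun _ => 0 := rfl
  have h1 : Y 1 = 0 := by
    refine eq_zero_of_ae_Ioo (hc 1) ?_
    filter_upwards [h.quasi_one] with x hx hx1
    have := hx hx1
    rw [h0, hz] at this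
    simpa [assocMatrix] using (this.unique (hasDerivAt_const x (0 : ℂ)))
  have h2 : Y 2 = 0 := by
    refine eq_zero_of_ae_Ioo (hc 2) ?_
    filter_upwards [h.quasi_two] with x hx hx1
    have := hx hx1
    rw [h0, h1, hz] at this
    simpa [assocMatrix] using (this.unique (hasDerivAt_const x (0 : ℂ)))
  refine ⟨h1, h2, eq_zero_of_ae_Ioo hg ?_⟩
  filter_upwards [h.quasi_three] with x hx hx1
  have := hx hx1
  rw [h0, h1, h2, hz] at this
  simpa [assocMatrix] using (this.unique (hasDerivAt_const x (0 : ℂ)))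

theorem zero_smul_continuousMap (f : C(unitInterval, Fin 3 → ℂ)) : (0 : ℂ) • f = 0 := by
  ext x i
  simp

/-- A linear combination of the chain. -/
def chainComb (lam : ℂ) (k : ℕ) (c : ℕ → ℂ) : C(unitInterval, Fin 3 → ℂ) :=
  ∑ j ∈ Finset.range k, c j • chainSol hp lam j

theorem chainComb_succ' (lam : ℂ) (k : ℕ) (c : ℕ → ℂ) : chainComb hp lam (k + 1) c
    = resOp hp lam 1 (paramOp 1 (chainComb hp lam k fun j => c (j + 1)))
      + c 0 • chainSol hp lam 0 := by
  rw [chainComb, Finset.sum_range_succ', chainComb, map_sum, map_sum]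
  congr 1
  refine Finset.sum_congr rfl fun j _ => ?_
  rw [(paramOp 1).map_smul, (resOp hp lam 1).map_smul]
  rfl

/-- On combinations of the chain, `l_3 - lam` acts as the shift of coefficients, and the boundary
values at 1 see only `c 0`. -/
theorem chainComb_succ_eq (lam : ℂ) (k : ℕ) (c : ℕ → ℂ) :
    chainComb hp lam (k + 1) c 1 = c 0 • ![0, 0, 1] ∧
    chainComb hp lam (k + 1) c = constFun (chainComb hp lam (k + 1) c 1)
      + sysOp hp lam 1 (chainComb hp lam (k + 1) c)
      + paramOp 1 (chainComb hp lam k fun j => c (j + 1)) := by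
  set G := chainComb hp lam k fun j => c (j + 1)
  have h1 : chainComb hp lam (k + 1) c 1 = c 0 • ![0, 0, 1] := by
    rw [chainComb_succ', ContinuousMap.add_apply, resOp_apply_one, paramOp_self, zero_add,
      ContinuousMap.smul_apply, chainSol_zero_one]
  refine ⟨h1, ?_⟩
  have h2 : chainComb hp lam (k + 1) c
      = resOp hp lam 1 (paramOp 1 G + constFun (c 0 • ![0, 0, 1])) := by
    rw [chainComb_succ', (resOp hp lam 1).map_add, chainSol]
    congr 1
    rw [← (resOp hp lam 1).map_smul]
    rfl
  rw [h1]
  conv_lhs => rw [h2, resOp_eq hp lam (Or.inr rfl), ← h2]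
  abel

/-- If y = 0, all quasi-derivatives and the right hand side vanish. The second quasi-derivative at 1
gives `c 0 = 0`, and the right hand side is the shifted combination, to which induction applies. -/
theorem chainComb_injective (lam : ℂ) (k : ℕ) (c : ℕ → ℂ)
    (h : ∀ x, chainComb hp lam k c x 0 = 0) : ∀ j < k, c j = 0 := by
  induction k generalizing c with
  | zero => intro j hj; omega
  | succ k ih =>
    obtain ⟨h1, h2⟩ := chainComb_succ_eq hp lam k c
    set f := chainComb hp lam (k + 1) c
    set G := chainComb hp lam k fun j => c (j + 1) with hG
    have hq := (isQuasi_iff hp lam 1 (fun i x => f x i) G).2 ⟨f, fun _ _ => rfl, h2⟩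
    have h0 : (fun x => f x 0) = 0 := funext h
    have hcf : ∀ i, Continuous fun x => f x i := fun i => by fun_prop
    have hcG : Continuous fun x => G x 0 := by fun_prop
    obtain ⟨-, hf2, hg⟩ := hq.eq_zero hcf (by
      simp only [h0, smul_zero, zero_add]; exact hcG) h0
    have hG0 : ∀ x, G x 0 = 0 := fun x => by
      simpa [h x] using congr_fun hg x
    intro j hj
    rcases j with _ | j
    · have := congr_fun hf2 1
      simpa [h1] using this
    · exact ih (fun j => c (j + 1)) hG0 j (by omega)

/-- The conditions at 1 leave y^{[2]}(1) as the only freedom. It becomes the new coefficient `a 0`,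
placed in front of `c`; the condition at 0 remains as a scalar equation. -/
theorem mem_bvpGraph_iff (i : Fin 3) (lam : ℂ) (y : unitInterval → ℂ)
    (k : ℕ) (c : ℕ → ℂ) :
    (y, fun x => chainComb hp lam k c x 0) ∈ bvpGraph p i lam ↔
      ∃ a : ℕ → ℂ, (∀ j, a (j + 1) = c j) ∧ (y = fun x => chainComb hp lam (k + 1) a x 0) ∧
        chainComb hp lam (k + 1) a 0 i.rev = 0 := by
  set G := chainComb hp lam k c with hG
  constructor
  · rintro ⟨Y, hY0, hq, hU, hV1, hV2⟩
    simp only at hY0 hq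
    rw [← hY0, isQuasi_iff hp lam 1] at hq
    obtain ⟨f, hYf, hf⟩ := hq
    have hf1 : f 1 = (f 1 2) • ![0, 0, 1] := by
      have e0 : f 1 0 = 0 := by rw [← hYf]; exact hV2
      have e1 : f 1 1 = 0 := by rw [← hYf]; exact hV1
      ext i; fin_cases i <;> simp [e0, e1]
    let a : ℕ → ℂ := fun j => Nat.casesOn j (f 1 2) c
    have ha : f = chainComb hp lam (k + 1) a := by
      have h2 := (chainComb_succ_eq hp lam k a).2
      rw [(chainComb_succ_eq hp lam k a).1] at h2
      have hfr : f = (constFun (f 1) + paramOp 1 G) + sysOp hp lam 1 f := by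
        conv_lhs => rw [hf]
        abel
      have h2r : chainComb hp lam (k + 1) a = (constFun (f 1) + paramOp 1 G)
          + sysOp hp lam 1 (chainComb hp lam (k + 1) a) := by
        conv_lhs => rw [h2]
        rw [hf1]
        change _ = constFun (a 0 • ![0, 0, 1]) + paramOp 1 G + _
        abel
      rw [eq_resOp hp lam (Or.inr rfl) hfr, eq_resOp hp lam (Or.inr rfl) h2r]
    refine ⟨a, fun j => rfl, ?_, ?_⟩
    · rw [← hY0, ← ha]; ext x; exact hYf 0 x
    · rw [← ha, ← hYf]; exact hU
  · rintro ⟨a, hac, hy, h0⟩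
    have hca : (fun j => a (j + 1)) = c := funext hac
    obtain ⟨h1, h2⟩ := chainComb_succ_eq hp lam k a
    rw [hca] at h2
    set f := chainComb hp lam (k + 1) a
    refine ⟨fun i x => f x i, hy.symm, ?_, h0, ?_, ?_⟩
    · have := (isQuasi_iff hp lam 1 (fun i x => f x i) G).2 ⟨f, fun _ _ => rfl, h2⟩
      simp only
      rw [hy]
      exact this
    · change f 1 1 = 0
      rw [h1]; simp
    · change f 1 0 = 0
      rw [h1]; simp

theorem chainComb_succ (lam : ℂ) (k : ℕ) (c : ℕ → ℂ) : chainComb hp lam (k + 1) c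
    = chainComb hp lam k c + c k • chainSol hp lam k :=
  Finset.sum_range_succ _ _

theorem chainComb_apply_zero (lam : ℂ) (i : Fin 3) (k : ℕ) (c : ℕ → ℂ)
    (h : ∀ j < k, chainSol hp lam j 0 i = 0) : chainComb hp lam k c 0 i = 0 := by
  rw [chainComb, ContinuousMap.sum_apply, Finset.sum_apply]
  refine Finset.sum_eq_zero fun j hj => ?_
  simp [h j (Finset.mem_range.1 hj)]

/-- Each power of the operator adds one chain member while the values at 0 vanish. Once the n-th
value enters, it is nonzero and the boundary condition at 0 kills its coefficient, so the kernels
stabilize at dimension n. -/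
theorem mem_rootKer_iff (i : Fin 3) (lam : ℂ) (n : ℕ)
    (h0 : ∀ j < n, chainSol hp lam j 0 i.rev = 0) (hn : chainSol hp lam n 0 i.rev ≠ 0) (m : ℕ)
    (y : unitInterval → ℂ) : y ∈ rootKer p i lam m ↔
      ∃ c : ℕ → ℂ, y = fun x => chainComb hp lam (min m n) c x 0 := by
  induction m generalizing y with
  | zero =>
    simp only [rootKer, Submodule.mem_bot, Nat.zero_min]
    have : ∀ c : ℕ → ℂ, (fun x => chainComb hp lam 0 c x 0) = 0 := fun c => by
      ext x; simp [chainComb]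
    simp [this]
  | succ m ih =>
    have hmem : y ∈ rootKer p i lam (m + 1) ↔
        ∃ c : ℕ → ℂ, (y, fun x => chainComb hp lam (min m n) c x 0) ∈ bvpGraph p i lam := by
      rw [rootKer, Submodule.mem_map]
      constructor
      · rintro ⟨⟨y', g⟩, ⟨hg1, hg2⟩, rfl⟩
        obtain ⟨c, hc⟩ := (ih g).1 hg2
        exact ⟨c, hc ▸ hg1⟩
      · rintro ⟨c, hc⟩
        exact ⟨(y, _), ⟨hc, (ih _).2 ⟨c, rfl⟩⟩, rfl⟩
    rw [hmem]
    simp only [mem_bvpGraph_iff]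
    rcases lt_or_ge m n with hmn | hmn
    · rw [min_eq_left hmn.le, min_eq_left (Nat.succ_le_of_lt hmn)]
      constructor
      · rintro ⟨c, a, -, hy, -⟩
        exact ⟨a, hy⟩
      · rintro ⟨a, hy⟩
        exact ⟨fun j => a (j + 1), a, fun _ => rfl, hy,
          chainComb_apply_zero hp lam _ _ _ fun j hj => h0 j (by omega)⟩
    · rw [min_eq_right hmn, min_eq_right (hmn.trans (Nat.le_succ m))]
      constructor
      · rintro ⟨c, a, -, hy, hU⟩
        rw [chainComb_succ] at hy hU
        have h1 := chainComb_apply_zero hp lam i.rev n a h0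
        rw [ContinuousMap.add_apply, Pi.add_apply, h1, zero_add] at hU
        have ha : a n = 0 := by
          simpa [hn] using hU
        rw [ha, zero_smul_continuousMap, add_zero] at hy
        exact ⟨a, hy⟩
      · rintro ⟨a, hy⟩
        -- Coefficients beyond the first n are irrelevant to `y` but not to the combination of n + 1
        -- members, so they are cut off.
        set a' : ℕ → ℂ := fun j => if j < n then a j else 0 with ha'
        have hsame : chainComb hp lam (n + 1) a' = chainComb hp lam n a := by
          rw [chainComb_succ]
          have : a' n = 0 := by simp [ha']
          rw [this, zero_smul_continuousMap, add_zero]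
          refine Finset.sum_congr rfl fun j hj => ?_
          simp only [ha', if_pos (Finset.mem_range.1 hj)]
        refine ⟨fun j => a' (j + 1), a', fun _ => rfl, ?_, ?_⟩
        · rw [hsame]; exact hy
        · rw [hsame]; exact chainComb_apply_zero hp lam _ _ _ h0

/-- The algebraic multiplicity is the order of the zero of the characteristic function. -/
theorem spectrumMult_eq (i : Fin 3) (lam : ℂ) (n : ℕ)
    (hn : analyticOrderAt (fun z => endSol hp z i.rev) lam = n) : spectrumMult p i lam = n := by
  obtain ⟨h0, h1⟩ := chainSol_of_analyticOrderAt hp lam i.rev n hn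
  let L : (Fin n → ℂ) →ₗ[ℂ] (unitInterval → ℂ) :=
    { toFun := fun c x => ∑ j, c j * chainSol hp lam j x 0
      map_add' := fun c d => by ext x; simp [add_mul, Finset.sum_add_distrib]
      map_smul' := fun r c => by ext x; simp [Finset.mul_sum, mul_assoc] }
  have hL : ∀ c : ℕ → ℂ, L (fun j => c j) = fun x => chainComb hp lam n c x 0 := by
    intro c
    ext x
    change ∑ j : Fin n, c j * chainSol hp lam j x 0 = _
    rw [Fin.sum_univ_eq_sum_range (fun j => c j * chainSol hp lam j x 0), chainComb,
      ContinuousMap.sum_apply, Finset.sum_apply]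
    rfl
  have hext : ∀ c : Fin n → ℂ, ∃ d : ℕ → ℂ, c = fun j : Fin n => d j := fun c =>
    ⟨fun j => if h : j < n then c ⟨j, h⟩ else 0, by ext j; simp⟩
  have hinj : Function.Injective L := by
    rw [← LinearMap.ker_eq_bot, LinearMap.ker_eq_bot']
    intro c hc
    obtain ⟨d, rfl⟩ := hext c
    rw [hL] at hc
    have := chainComb_injective hp lam n d fun x => congr_fun hc x
    ext j
    exact this j j.2
  have hrange : rootSpace p i lam = LinearMap.range L := by
    apply le_antisymm
    · refine iSup_le fun m y hy => ?_
      obtain ⟨c, rfl⟩ := (mem_rootKer_iff hp i lam n h0 h1 m y).1 hy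
      have hsame : chainComb hp lam (min m n) c
          = chainComb hp lam n (fun j => if j < min m n then c j else 0) := by
        rw [chainComb, chainComb]
        refine (Finset.sum_subset_zero_on_sdiff (s₁ := Finset.range (min m n))
          (Finset.range_mono (min_le_right m n)) ?_ ?_)
        · intro j hj
          have := (Finset.mem_sdiff.1 hj).2
          rw [Finset.mem_range] at this
          rw [if_neg this, zero_smul_continuousMap]
        · intro j hj
          rw [if_pos (Finset.mem_range.1 hj)]
      rw [hsame, ← hL]
      exact ⟨_, rfl⟩
    · rintro _ ⟨c, rfl⟩
      obtain ⟨d, rfl⟩ := hext c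
      refine Submodule.mem_iSup_of_mem n ((mem_rootKer_iff hp i lam n h0 h1 n _).2 ⟨d, ?_⟩)
      rw [min_self, hL]
  rw [spectrumMult, hrange, ← (LinearEquiv.ofInjective L hinj).rank_eq, rank_fin_fun]

theorem analyticOrderAt_eq_of_spectrumMult_eq {q : ℝ → ℂ} (hq : IntervalIntegrable q volume 0 1)
    (i : Fin 3) (lam : ℂ) (hp' : analyticOrderAt (fun z => endSol hp z i.rev) lam ≠ ⊤)
    (hq' : analyticOrderAt (fun z => endSol hq z i.rev) lam ≠ ⊤)
    (h : spectrumMult p i lam = spectrumMult q i lam) :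
    analyticOrderAt (fun z => endSol hp z i.rev) lam
      = analyticOrderAt (fun z => endSol hq z i.rev) lam := by
  obtain ⟨n, hn⟩ := ENat.ne_top_iff_exists.1 hp'
  obtain ⟨m, hm⟩ := ENat.ne_top_iff_exists.1 hq'
  rw [spectrumMult_eq hp i lam n hn.symm, spectrumMult_eq hq i lam m hm.symm, Nat.cast_inj] at h
  rw [← hn, ← hm, h]

end ThirdOrder
end

noncomputable section

namespace ThirdOrder

open MeasureTheory Set Filter Topology

/-! ### Exponential solutions for large values of the spectral parameter -/

theorem exists_eq_add_apply {E : Type*} [NormedAddCommGroup E] [NormedSpace ℂ E]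
    [CompleteSpace E] (G : E →L[ℂ] E) (hG : ‖G‖ ≤ 1 / 2) (e : E) :
    ∃ f : E, f = e + G f ∧ ‖f - e‖ ≤ 2 * ‖G‖ * ‖e‖ := by
  have hu : IsUnit (1 - G) := isUnit_one_sub_of_norm_lt_one (hG.trans_lt (by norm_num))
  have h1 : (1 - G) (Ring.inverse (1 - G) e) = e :=
    DFunLike.congr_fun (Ring.mul_inverse_cancel _ hu) e
  set f := Ring.inverse (1 - G) e
  have h2 : f = e + G f := by
    have h3 : f - G f = e := h1
    rw [← h3]; abel
  have h4 : ‖G f‖ ≤ ‖G‖ * ‖f‖ := G.le_opNorm f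
  have h5 : ‖f‖ ≤ 2 * ‖e‖ := by
    have h6 : ‖f‖ ≤ ‖e‖ + ‖G f‖ := by
      conv_lhs => rw [h2]
      exact norm_add_le _ _
    nlinarith [norm_nonneg f]
  refine ⟨f, h2, ?_⟩
  have h7 : f - e = G f := sub_eq_iff_eq_add'.2 h2
  rw [h7]
  nlinarith [norm_nonneg G]

theorem continuous_integral_unitInterval {g : ℝ → ℂ} (hg : IntervalIntegrable g volume 0 1)
    (c : unitInterval) : Continuous fun x : unitInterval => ∫ t in (c : ℝ)..x, g t := by
  have h := (absolutelyContinuousOnInterval_integral hg (coe_mem_uIcc c)).continuousOn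
  rw [uIcc_of_le zero_le_one] at h
  exact h.comp_continuous continuous_subtype_val fun x : unitInterval => x.2

variable {r : ℝ → ℂ} (hr : IntervalIntegrable r volume 0 1)

include hr in
theorem intervalIntegrable_exp_mul (θ : ℂ) (M : Matrix (Fin 3) (Fin 3) ℂ)
    (f : C(unitInterval, Fin 3 → ℂ)) (k : Fin 3) : IntervalIntegrable
      (fun t : ℝ => Complex.exp (-θ * t) * (r t * M.mulVec (ext f t) k)) volume 0 1 := by
  have h1 : Continuous fun t : ℝ => M.mulVec (ext f t) k := by
    have := (matCLM M).continuous.comp (continuous_ext f)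
    exact (continuous_apply k).comp this
  exact (hr.mul_continuousOn h1.continuousOn).continuousOn_mul (by fun_prop)

/-- The integral operator with the kernel `exp (θ k * (x - t))` acting in the `k`-th component
between the points `c k` and `x`. -/
def dichotomyOp (θ : Fin 3 → ℂ) (c : Fin 3 → unitInterval) (M : Matrix (Fin 3) (Fin 3) ℂ)
    (h : ∀ k, (c k = 0 ∧ (θ k).re ≤ 0) ∨ (c k = 1 ∧ 0 ≤ (θ k).re)) :
    C(unitInterval, Fin 3 → ℂ) →L[ℂ] C(unitInterval, Fin 3 → ℂ) :=
  LinearMap.mkContinuous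
    { toFun := fun f => ⟨fun x k => Complex.exp (θ k * (x : ℝ)) * ∫ t in (c k : ℝ)..x,
          Complex.exp (-θ k * t) * (r t * M.mulVec (ext f t) k), by
        refine continuous_pi fun k => Continuous.mul (by fun_prop) ?_
        exact continuous_integral_unitInterval (intervalIntegrable_exp_mul hr (θ k) M f k) (c k)⟩
      map_add' := fun f g => by
        ext x k
        simp only [ContinuousMap.coe_mk, ContinuousMap.add_apply, Pi.add_apply]
        rw [← mul_add, ← intervalIntegral.integral_add
          ((intervalIntegrable_exp_mul hr (θ k) M f k).mono_set (unitInterval_uIcc_subset _ _))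
          ((intervalIntegrable_exp_mul hr (θ k) M g k).mono_set (unitInterval_uIcc_subset _ _))]
        congr 1
        refine intervalIntegral.integral_congr fun t _ => ?_
        have : ext (f + g) t = ext f t + ext g t := rfl
        simp only [this, Matrix.mulVec_add, Pi.add_apply]
        ring
      map_smul' := fun a f => by
        ext x k
        have h1 : ∀ t : ℝ, Complex.exp (-θ k * t) * (r t * M.mulVec (ext (a • f) t) k)
            = a * (Complex.exp (-θ k * t) * (r t * M.mulVec (ext f t) k)) := fun t => by
          have h1 : M.mulVec (ext (a • f) t) k = a * M.mulVec (ext f t) k :=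
            congr_fun (Matrix.mulVec_smul M a (ext f t)) k
          rw [h1]
          ring
        change Complex.exp (θ k * (x : ℝ)) * ∫ t in (c k : ℝ)..x,
            Complex.exp (-θ k * t) * (r t * M.mulVec (ext (a • f) t) k)
          = a * (Complex.exp (θ k * (x : ℝ)) * ∫ t in (c k : ℝ)..x,
            Complex.exp (-θ k * t) * (r t * M.mulVec (ext f t) k))
        simp only [h1, intervalIntegral.integral_const_mul]
        ring }
    (‖matCLM M‖ * ∫ t in (0 : ℝ)..1, ‖r t‖) (fun f => by
      have h0 : 0 ≤ ∫ t in (0 : ℝ)..1, ‖r t‖ :=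
        intervalIntegral.integral_nonneg zero_le_one fun t _ => norm_nonneg _
      refine (ContinuousMap.norm_le _ (by positivity)).2 fun x => ?_
      refine (pi_norm_le_iff_of_nonneg (by positivity)).2 fun k => ?_
      simp only [LinearMap.coe_mk, AddHom.coe_mk, ContinuousMap.coe_mk]
      rw [← intervalIntegral.integral_const_mul]
      refine (intervalIntegral.norm_integral_le_abs_of_norm_le
        (g := fun t => ‖r t‖ * (‖matCLM M‖ * ‖f‖)) ?_ ?_).trans ?_
      · filter_upwards [ae_restrict_mem measurableSet_uIoc] with t ht
        have hM : ‖M.mulVec (ext f t) k‖ ≤ ‖matCLM M‖ * ‖f‖ :=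
          (norm_le_pi_norm _ k).trans (((matCLM M).le_opNorm _).trans
            (by gcongr; exact norm_ext_le f t))
        -- The base point is tied to the sign of Re θ k exactly so that the kernel is bounded by 1,
        -- uniformly in θ.
        have hexp : ‖Complex.exp (θ k * (x : ℝ)) * Complex.exp (-θ k * t)‖ ≤ 1 := by
          rw [← Complex.exp_add, Complex.norm_exp, Real.exp_le_one_iff]
          have : (θ k * ((x : ℝ) : ℂ) + -θ k * t).re = (θ k).re * (x - t) := by
            simp; ring
          rw [this]
          rcases h k with ⟨hc, hθ⟩ | ⟨hc, hθ⟩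
          · rw [hc] at ht
            have hx0 : ((0 : unitInterval) : ℝ) ≤ x := x.2.1
            rw [uIoc_of_le hx0] at ht
            exact mul_nonpos_of_nonpos_of_nonneg hθ (by linarith [ht.2])
          · rw [hc] at ht
            have hx1 : (x : ℝ) ≤ ((1 : unitInterval) : ℝ) := x.2.2
            rw [uIoc_of_ge hx1] at ht
            exact mul_nonpos_of_nonneg_of_nonpos hθ (by linarith [ht.1])
        rw [← mul_assoc, norm_mul, norm_mul (r t)]
        calc _ ≤ 1 * (‖r t‖ * (‖matCLM M‖ * ‖f‖)) := by gcongr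
          _ = _ := one_mul _
      · exact (hr.norm.mono_set (unitInterval_uIcc_subset _ _)).mul_const _
      · rw [intervalIntegral.integral_mul_const, abs_mul,
          abs_of_nonneg (show 0 ≤ ‖matCLM M‖ * ‖f‖ by positivity)]
        have : |∫ t in (c k : ℝ)..x, ‖r t‖| ≤ ∫ t in (0 : ℝ)..1, ‖r t‖ := by
          rw [← abs_of_nonneg h0]
          refine intervalIntegral.abs_integral_mono_interval ?_ ?_ hr.norm
          · exact uIoc_subset_uIoc_of_uIcc_subset_uIcc (unitInterval_uIcc_subset _ _)
          · exact Eventually.of_forall fun t => norm_nonneg _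
        calc _ ≤ (∫ t in (0 : ℝ)..1, ‖r t‖) * (‖matCLM M‖ * ‖f‖) := by gcongr
          _ = _ := by ring)

theorem norm_dichotomyOp_le (θ : Fin 3 → ℂ) (c : Fin 3 → unitInterval)
    (M : Matrix (Fin 3) (Fin 3) ℂ)
    (h : ∀ k, (c k = 0 ∧ (θ k).re ≤ 0) ∨ (c k = 1 ∧ 0 ≤ (θ k).re)) :
    ‖dichotomyOp hr θ c M h‖ ≤ ‖matCLM M‖ * ∫ t in (0 : ℝ)..1, ‖r t‖ :=
  LinearMap.mkContinuous_norm_le _ (mul_nonneg (norm_nonneg _)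
    (intervalIntegral.integral_nonneg zero_le_one fun _ _ => norm_nonneg _)) _

/-- `ω` are the cube roots of `μ`, ordered by their distinct real parts. -/
structure IsCubeRoots (μ : ℂ) (ω : Fin 3 → ℂ) : Prop where
  cube : ∀ k, ω k ^ 3 = μ
  re_strictMono : StrictMono fun k => (ω k).re
  ne_zero : μ ≠ 0

/-- The imaginary axis is used because the cube roots there have three distinct real parts; on the
real axis two of these coincide. -/
theorem isCubeRoots_I : IsCubeRoots Complex.I
    ![⟨-(√3 / 2), 1 / 2⟩, ⟨0, -1⟩, ⟨√3 / 2, 1 / 2⟩] := by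
  have h3 : √3 ^ 2 = 3 := Real.sq_sqrt (by norm_num)
  have h0 : 0 < √3 := by positivity
  refine ⟨fun k => ?_, ?_, Complex.I_ne_zero⟩
  · fin_cases k
    · apply Complex.ext <;> simp [pow_succ] <;> nlinarith
    · apply Complex.ext <;> simp [pow_succ]
    · apply Complex.ext <;> simp [pow_succ] <;> nlinarith
  · rw [Fin.strictMono_iff_lt_succ]
    intro i
    fin_cases i <;> simp

theorem isCubeRoots_neg_I : IsCubeRoots (-Complex.I)
    ![⟨-(√3 / 2), -(1 / 2)⟩, ⟨0, 1⟩, ⟨√3 / 2, -(1 / 2)⟩] := by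
  have h3 : √3 ^ 2 = 3 := Real.sq_sqrt (by norm_num)
  have h0 : 0 < √3 := by positivity
  refine ⟨fun k => ?_, ?_, neg_ne_zero.2 Complex.I_ne_zero⟩
  · fin_cases k
    · apply Complex.ext <;> simp [pow_succ] <;> nlinarith
    · apply Complex.ext <;> simp [pow_succ]
    · apply Complex.ext <;> simp [pow_succ] <;> nlinarith
  · rw [Fin.strictMono_iff_lt_succ]
    intro i
    fin_cases i <;> simp

/-- The matrix with the entries `ω k ^ i`. -/
def powMatrix (ω : Fin 3 → ℂ) : Matrix (Fin 3) (Fin 3) ℂ := Matrix.of fun i k => ω k ^ (i : ℕ)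

theorem IsCubeRoots.injective {μ : ℂ} {ω : Fin 3 → ℂ} (h : IsCubeRoots μ ω) :
    Function.Injective ω := fun _ _ hij =>
  h.re_strictMono.injective (congr_arg Complex.re hij)

theorem IsCubeRoots.det_ne_zero {μ : ℂ} {ω : Fin 3 → ℂ} (h : IsCubeRoots μ ω) :
    (powMatrix ω).det ≠ 0 := by
  have : powMatrix ω = (Matrix.vandermonde ω).transpose := rfl
  rw [this, Matrix.det_transpose, Matrix.det_vandermonde_ne_zero_iff]
  exact h.injective

/-- The coefficient of `p` in the first order system. -/
def potMatrix : Matrix (Fin 3) (Fin 3) ℂ := !![0, 0, 0; -1, 0, 0; 0, -1, 0]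

/-- The substitution y^{[i]} = s^i Σ ω_k^i z_k diagonalizes the leading part of the system and
leaves the potential with the small factor 1/s. -/
theorem solvesSystem_of_diagonal {p : ℝ → ℂ} {μ : ℂ} {ω : Fin 3 → ℂ} (h : IsCubeRoots μ ω)
    {M : Matrix (Fin 3) (Fin 3) ℂ} (hM : powMatrix ω * M = potMatrix * powMatrix ω) {s : ℝ}
    (hs : 0 < s) {z : ℝ → Fin 3 → ℂ} (hac : ∀ k, AbsolutelyContinuousOnInterval (fun x => z x k) 0 1)
    (hz : ∀ᵐ x : ℝ, x ∈ Ioo (0 : ℝ) 1 → ∀ k, HasDerivAt (fun x => z x k)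
      (s * ω k * z x k + p x / s * M.mulVec (z x) k) x) :
    SolvesSystem p (μ * s ^ 3) fun x i => (s : ℂ) ^ (i : ℕ) * (powMatrix ω).mulVec (z x) i := by
  have hs0 : (s : ℂ) ≠ 0 := Complex.ofReal_ne_zero.2 hs.ne'
  have hform : ∀ (v : Fin 3 → ℂ) (i : Fin 3), (powMatrix ω).mulVec v i
      = ω 0 ^ (i : ℕ) * v 0 + ω 1 ^ (i : ℕ) * v 1 + ω 2 ^ (i : ℕ) * v 2 := by
    intro v i
    simp [powMatrix, Matrix.mulVec, dotProduct, Fin.sum_univ_three]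
  constructor
  · rw [absolutelyContinuousOnInterval_pi]
    intro i
    have := ((((hac 0).const_smul (ω 0 ^ (i : ℕ))).add ((hac 1).const_smul (ω 1 ^ (i : ℕ)))).add
      ((hac 2).const_smul (ω 2 ^ (i : ℕ)))).const_smul ((s : ℂ) ^ (i : ℕ))
    refine absolutelyContinuousOnInterval_congr this fun x _ => ?_
    simp only [hform, Pi.add_apply, smul_eq_mul]
  · filter_upwards [hz] with x hx hx1
    have hd := hx hx1
    rw [hasDerivAt_pi]
    intro i
    have hd1 := ((((hd 0).const_mul (ω 0 ^ (i : ℕ))).add ((hd 1).const_mul (ω 1 ^ (i : ℕ)))).add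
      ((hd 2).const_mul (ω 2 ^ (i : ℕ)))).const_mul ((s : ℂ) ^ (i : ℕ))
    have hMv : ∀ i, (powMatrix ω).mulVec (M.mulVec (z x)) i
        = potMatrix.mulVec ((powMatrix ω).mulVec (z x)) i := by
      intro i; rw [Matrix.mulVec_mulVec, Matrix.mulVec_mulVec, hM]
    have e := hMv i
    rw [hform] at e
    simp only [hform]
    refine hd1.congr_deriv ?_
    rw [coef_apply]
    have e3 : ∀ k, ω k ^ 3 = μ := h.cube
    have hsum : (s : ℂ) ^ (i : ℕ) * (ω 0 ^ (i : ℕ) * (s * ω 0 * z x 0 + p x / s * M.mulVec (z x) 0)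
        + ω 1 ^ (i : ℕ) * (s * ω 1 * z x 1 + p x / s * M.mulVec (z x) 1)
        + ω 2 ^ (i : ℕ) * (s * ω 2 * z x 2 + p x / s * M.mulVec (z x) 2))
        = (s : ℂ) ^ ((i : ℕ) + 1) * (ω 0 ^ ((i : ℕ) + 1) * z x 0 + ω 1 ^ ((i : ℕ) + 1) * z x 1
          + ω 2 ^ ((i : ℕ) + 1) * z x 2) + (s : ℂ) ^ (i : ℕ) * (p x / s)
          * potMatrix.mulVec ((powMatrix ω).mulVec (z x)) i := by
      rw [← e]; ring
    rw [hsum]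
    have hpot : ∀ v : Fin 3 → ℂ, potMatrix.mulVec v = ![0, -v 0, -v 1] := by
      intro v; ext i
      fin_cases i <;> simp [potMatrix, Matrix.mulVec, dotProduct, Fin.sum_univ_three]
    rw [hpot, hform, hform]
    fin_cases i
    · simp
    · simp; field_simp; ring
    · simp [e3]; field_simp; ring

end ThirdOrder
end

/-! ### Construction of the exponential solutions. -/

noncomputable section

namespace ThirdOrder

open MeasureTheory Set Filter Topology

theorem SolvesSystem.congr {p : ℝ → ℂ} {lam : ℂ} {f g : ℝ → Fin 3 → ℂ}
    (hg : SolvesSystem p lam g) (h : EqOn f g (Icc 0 1)) : SolvesSystem p lam f := by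
  refine ⟨absolutelyContinuousOnInterval_congr hg.1 (by rwa [uIcc_of_le zero_le_one]), ?_⟩
  filter_upwards [hg.2] with x hx hx1
  rw [h (Ioo_subset_Icc_self hx1)]
  exact hasDerivAt_congr_Icc h hx1 (hx hx1)

variable {p : ℝ → ℂ} (hp : IntervalIntegrable p volume 0 1)

/-- Here ζ is the vector z of the diagonalized system with exp(s ω_m x) factored out, and its
equation is variation of constants, each component integrated from its own end point. -/
theorem solvesSystem_of_eq_dichotomyOp {μ : ℂ} {ω : Fin 3 → ℂ} (h : IsCubeRoots μ ω)
    {M : Matrix (Fin 3) (Fin 3) ℂ} (hM : powMatrix ω * M = potMatrix * powMatrix ω) {s : ℝ}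
    (hs : 0 < s) (hr : IntervalIntegrable (fun t => p t / s) volume 0 1) (m : Fin 3)
    {c : Fin 3 → unitInterval}
    (hc : ∀ k, (c k = 0 ∧ (s * (ω k - ω m)).re ≤ 0) ∨ (c k = 1 ∧ 0 ≤ (s * (ω k - ω m)).re))
    {ζ : C(unitInterval, Fin 3 → ℂ)} (hζ : ζ = ContinuousMap.const _ (Pi.single m 1)
      + dichotomyOp hr (fun k => s * (ω k - ω m)) c M hc ζ) :
    SolvesSystem p (μ * s ^ 3) fun x i => (s : ℂ) ^ (i : ℕ) *
      (powMatrix ω).mulVec (fun k => Complex.exp (s * ω m * x) * ext ζ x k) i := by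
  let J : Fin 3 → ℝ → ℂ := fun k x => ∫ t in (c k : ℝ)..x,
    Complex.exp (-(s * (ω k - ω m)) * t) * (p t / s * M.mulVec (ext ζ t) k)
  have hi := fun k => intervalIntegrable_exp_mul hr (s * (ω k - ω m)) M ζ k
  have hJ : ∀ k, AbsolutelyContinuousOnInterval (J k) 0 1 ∧
      ∀ᵐ x : ℝ, x ∈ Ioo (0 : ℝ) 1 → HasDerivAt (J k)
        (Complex.exp (-(s * (ω k - ω m)) * x) * (p x / s * M.mulVec (ext ζ x) k)) x := by
    intro k
    refine (ac_and_hasDerivAt_iff (hi k) (c k).2).2 fun x _ => ?_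
    simp only [J, intervalIntegral.integral_same, zero_add]
  let z : ℝ → Fin 3 → ℂ := fun x k => Complex.exp (s * ω m * x) * (Pi.single m 1 : Fin 3 → ℂ) k
    + Complex.exp (s * ω k * x) * J k x
  have hexp : ∀ k, ContDiff ℝ 1 fun x : ℝ => Complex.exp (s * ω k * x) := fun k =>
    (contDiff_const.mul Complex.ofRealCLM.contDiff).cexp
  have hz : EqOn (fun (x : ℝ) k => Complex.exp (s * ω m * x) * ext ζ x k) z (Icc 0 1) := by
    intro x hx
    ext k
    have h1 : ext ζ x k = (Pi.single m 1 : Fin 3 → ℂ) k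
        + Complex.exp (s * (ω k - ω m) * x) * J k x := by
      rw [ext_of_mem ζ hx]
      conv_lhs => rw [hζ]
      rfl
    simp only [h1, z]
    rw [mul_add, ← mul_assoc, ← Complex.exp_add]
    ring_nf
  have hac : ∀ k, AbsolutelyContinuousOnInterval (fun x => z x k) 0 1 := by
    intro k
    have h1 := ((hexp m).contDiffOn (s := uIcc 0 1)).absolutelyContinuousOnInterval
    have h2 := ((hexp k).contDiffOn (s := uIcc 0 1)).absolutelyContinuousOnInterval
    refine absolutelyContinuousOnInterval_congr ((h1.const_smul
      ((Pi.single m 1 : Fin 3 → ℂ) k)).add (h2.smul (hJ k).1)) fun x _ => ?_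
    simp only [z, Pi.add_apply, smul_eq_mul, Pi.mul_apply]
    ring
  refine (solvesSystem_of_diagonal h hM hs hac ?_).congr fun x hx => ?_
  · have hall := ae_all_iff.2 fun k => (hJ k).2
    filter_upwards [hall] with x hx hx1 k
    have he : ∀ k, HasDerivAt (fun x : ℝ => Complex.exp (s * ω k * x))
        (s * ω k * Complex.exp (s * ω k * x)) x := fun k => by
      have := ((Complex.ofRealCLM.hasDerivAt (x := x)).const_mul (s * ω k)).cexp
      refine this.congr_deriv ?_
      simp; ring
    refine (((he m).mul_const _).add ((he k).mul (hx k hx1))).congr_deriv ?_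
    have hzx := congr_fun (hz (Ioo_subset_Icc_self hx1))
    have hMz : M.mulVec (z x) k = Complex.exp (s * ω m * x) * M.mulVec (ext ζ x) k := by
      rw [← hz (Ioo_subset_Icc_self hx1)]
      exact congr_fun (Matrix.mulVec_smul M (Complex.exp (s * ω m * x)) (ext ζ x)) k
    have hexp2 : Complex.exp (s * ω k * x) * Complex.exp (-(s * (ω k - ω m)) * x)
        = Complex.exp (s * ω m * x) := by
      rw [← Complex.exp_add]; ring_nf
    rw [hMz, ← mul_assoc, hexp2]
    have hsingle : ω m * (Pi.single m 1 : Fin 3 → ℂ) k = ω k * (Pi.single m 1 : Fin 3 → ℂ) k := by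
      by_cases hk : k = m
      · rw [hk]
      · simp [hk]
    simp only [z]
    linear_combination s * Complex.exp (s * ω m * x) * hsingle
  · simp only
    rw [show (fun k => Complex.exp (s * ω m * x) * ext ζ x k) = z x from hz hx]

/-- Components with Re ω_k ≤ Re ω_m are integrated from 0 and the others from 1. The operator then
has norm at most K/s, with K independent of s, and for s ≥ 2K a Neumann series gives ζ close to the
m-th unit vector. -/
theorem exists_exponential_solution {μ : ℂ} {ω : Fin 3 → ℂ} (h : IsCubeRoots μ ω) :
    ∃ K : ℝ, ∀ s : ℝ, 0 < s → 2 * K ≤ s → ∀ m : Fin 3, ∃ ζ : C(unitInterval, Fin 3 → ℂ),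
      (∀ x k, ‖ζ x k - (Pi.single m 1 : Fin 3 → ℂ) k‖ ≤ 2 * K / s) ∧
      ∀ x, (fund hp (μ * s ^ 3) x).mulVec
          (fun i : Fin 3 => (s : ℂ) ^ (i : ℕ) * (powMatrix ω).mulVec (ζ 0) i)
        = fun i : Fin 3 => (s : ℂ) ^ (i : ℕ) *
          (Complex.exp (s * ω m * (x : ℝ)) * (powMatrix ω).mulVec (ζ x) i) := by
  let M := (powMatrix ω)⁻¹ * (potMatrix * powMatrix ω)
  have hM : powMatrix ω * M = potMatrix * powMatrix ω :=
    Matrix.mul_nonsing_inv_cancel_left _ _ (isUnit_iff_ne_zero.2 h.det_ne_zero)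
  refine ⟨‖matCLM M‖ * ∫ t in (0 : ℝ)..1, ‖p t‖, fun s hs hK m => ?_⟩
  set K := ‖matCLM M‖ * ∫ t in (0 : ℝ)..1, ‖p t‖
  have hr : IntervalIntegrable (fun t => p t / s) volume 0 1 := hp.div_const _
  let c : Fin 3 → unitInterval := fun k => if k ≤ m then 0 else 1
  have hc : ∀ k, (c k = 0 ∧ (s * (ω k - ω m)).re ≤ 0) ∨ (c k = 1 ∧ 0 ≤ (s * (ω k - ω m)).re) := by
    intro k
    have hre : (s * (ω k - ω m)).re = s * ((ω k).re - (ω m).re) := by simp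
    rw [hre]
    by_cases hk : k ≤ m
    · left
      exact ⟨if_pos hk, mul_nonpos_of_nonneg_of_nonpos hs.le
        (sub_nonpos.2 (h.re_strictMono.monotone hk))⟩
    · right
      exact ⟨if_neg hk, mul_nonneg hs.le
        (sub_nonneg.2 (h.re_strictMono.monotone (not_le.1 hk).le))⟩
  have hG : ‖dichotomyOp hr (fun k => s * (ω k - ω m)) c M hc‖ ≤ K / s := by
    refine (norm_dichotomyOp_le hr _ c M hc).trans (le_of_eq ?_)
    simp only [norm_div, Complex.norm_real, Real.norm_of_nonneg hs.le,
      intervalIntegral.integral_div, K]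
    ring
  obtain ⟨ζ, hζ, hn⟩ := exists_eq_add_apply _ (hG.trans (by rw [div_le_div_iff₀ hs two_pos]; linarith))
    (ContinuousMap.const unitInterval (Pi.single m 1 : Fin 3 → ℂ))
  refine ⟨ζ, fun x k => ?_, fun x => ?_⟩
  · have h1 : ‖ContinuousMap.const unitInterval (Pi.single m 1 : Fin 3 → ℂ)‖ ≤ 1 := by
      refine (ContinuousMap.norm_le _ zero_le_one).2 fun x => ?_
      refine (pi_norm_le_iff_of_nonneg zero_le_one).2 fun k => ?_
      by_cases hk : k = m <;> simp [hk]
    calc ‖ζ x k - (Pi.single m 1 : Fin 3 → ℂ) k‖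
        ≤ ‖ζ x - Pi.single m 1‖ := norm_le_pi_norm (ζ x - Pi.single m 1) k
      _ ≤ ‖ζ - ContinuousMap.const unitInterval (Pi.single m 1 : Fin 3 → ℂ)‖ :=
        (ζ - ContinuousMap.const unitInterval (Pi.single m 1 : Fin 3 → ℂ)).norm_coe_le_norm x
      _ ≤ _ := hn
      _ ≤ 2 * (K / s) * 1 :=
        mul_le_mul (by linarith) h1 (norm_nonneg _) (by linarith [(ContinuousLinearMap.opNorm_nonneg _).trans hG])
      _ = _ := by ring
  · have hsol := solvesSystem_of_eq_dichotomyOp h hM hs hr m hc hζ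
    let f : C(unitInterval, Fin 3 → ℂ) := ⟨fun x i => (s : ℂ) ^ (i : ℕ) *
      (Complex.exp (s * ω m * (x : ℝ)) * (powMatrix ω).mulVec (ζ x) i), by
        refine continuous_pi fun i => continuous_const.mul (Continuous.mul (by fun_prop) ?_)
        exact (continuous_apply i).comp ((matCLM (powMatrix ω)).continuous.comp ζ.continuous)⟩
    have hf : SolvesSystem p (μ * s ^ 3) (ext f) := by
      refine hsol.congr fun x hx => ?_
      rw [ext_of_mem f hx]
      simp only [ext_of_mem ζ hx]
      ext i
      exact congr_arg (fun w => (s : ℂ) ^ (i : ℕ) * w)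
        (congr_fun (Matrix.mulVec_smul (powMatrix ω) (Complex.exp (s * ω m * x)) (ζ ⟨x, hx⟩)) i).symm
    have h0 : f 0 = fun i : Fin 3 => (s : ℂ) ^ (i : ℕ) * (powMatrix ω).mulVec (ζ 0) i := by
      ext i
      change (s : ℂ) ^ (i : ℕ) * (Complex.exp (s * ω m * ((0 : unitInterval) : ℝ)) * _) = _
      simp
    rw [← h0]
    exact (hf.eq_fund_mulVec hp x).symm

end ThirdOrder
end

/-! ### Weyl type solutions and their asymptotics. -/

noncomputable section

namespace ThirdOrder

open MeasureTheory Set Filter Topology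

/-- The matrix `diag(1, s, s ^ 2)`. -/
def scaleMatrix (s : ℝ) : Matrix (Fin 3) (Fin 3) ℂ :=
  Matrix.diagonal fun i : Fin 3 => (s : ℂ) ^ (i : ℕ)

/-- The diagonal matrix with the entries `exp (s * ω k * x)`. -/
def expMatrix (ω : Fin 3 → ℂ) (s : ℝ) (x : unitInterval) : Matrix (Fin 3) (Fin 3) ℂ :=
  Matrix.diagonal fun k : Fin 3 => Complex.exp (s * ω k * (x : ℝ))

section Exponential

variable {p : ℝ → ℂ} (hp : IntervalIntegrable p volume 0 1)

theorem exists_tendsto_powMatrix {μ : ℂ} {ω : Fin 3 → ℂ} (h : IsCubeRoots μ ω) :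
    ∃ H : ℝ → unitInterval → Matrix (Fin 3) (Fin 3) ℂ,
      (∀ᶠ s : ℝ in atTop, ∀ x, fund hp (μ * s ^ 3) x * (scaleMatrix s * H s 0)
        = scaleMatrix s * (H s x * expMatrix ω s x)) ∧
      ∀ x, Tendsto (fun s => H s x) atTop (𝓝 (powMatrix ω)) := by
  obtain ⟨K, hK⟩ := exists_exponential_solution hp h
  choose! ζ hζ1 hζ2 using hK
  refine ⟨fun s x => powMatrix ω * Matrix.of fun i m => ζ s m x i, ?_, fun x => ?_⟩
  · filter_upwards [eventually_gt_atTop 0, eventually_ge_atTop (2 * K)] with s hs hsK x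
    ext i m
    have h1 := congr_fun (hζ2 s hs hsK m x) i
    rw [Matrix.mul_apply]
    simp only [scaleMatrix, expMatrix, Matrix.diagonal_mul, Matrix.mul_diagonal]
    simp only [Matrix.mulVec, dotProduct] at h1
    simp only [Matrix.mul_apply, Matrix.of_apply]
    rw [h1]
    ring
  · have h1 : Tendsto (fun s => (Matrix.of fun i m => ζ s m x i : Matrix (Fin 3) (Fin 3) ℂ)) atTop
        (𝓝 1) := by
      refine tendsto_pi_nhds.2 fun i => tendsto_pi_nhds.2 fun m => ?_
      rw [tendsto_iff_norm_sub_tendsto_zero]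
      refine squeeze_zero' (Eventually.of_forall fun _ => norm_nonneg _) ?_
        (tendsto_const_nhds.div_atTop tendsto_id : Tendsto (fun s : ℝ => 2 * K / s) atTop (𝓝 0))
      filter_upwards [eventually_gt_atTop 0, eventually_ge_atTop (2 * K)] with s hs hsK
      have := hζ1 s hs hsK m x i
      simpa [Pi.single_apply, Matrix.one_apply] using this
    simpa using (tendsto_const_nhds (x := powMatrix ω)).mul h1

/-- The coefficients of the Weyl type solutions in terms of the exponential ones with the
asymptotics given by `h0` at the left and by `h1` at the right end point. -/
def weylMatrix (ω : Fin 3 → ℂ) (h0 h1 : Matrix (Fin 3) (Fin 3) ℂ) (s x : ℝ) :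
    Matrix (Fin 3) (Fin 3) ℂ :=
  !![h1 0 1 * h1 1 2 - h1 0 2 * h1 1 1,
      (h0 2 1 * h1 0 2 - h0 2 2 * Complex.exp (s * (ω 1 - ω 2)) * h1 0 1)
        * Complex.exp (s * x * (ω 0 - ω 1)),
      (h0 1 1 * h0 2 2 - h0 1 2 * h0 2 1) * Complex.exp (s * x * (ω 0 - ω 2));
    (h1 0 2 * h1 1 0 - h1 0 0 * h1 1 2) * Complex.exp (s * (1 - x) * (ω 0 - ω 1)),
      h0 2 2 * Complex.exp (s * (ω 1 - ω 2)) * (h1 0 0 * Complex.exp (s * (ω 0 - ω 1)))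
        - h0 2 0 * h1 0 2,
      (h0 1 2 * h0 2 0 - h0 1 0 * h0 2 2) * Complex.exp (s * x * (ω 1 - ω 2));
    (h1 0 0 * h1 1 1 - h1 0 1 * h1 1 0) * Complex.exp (s * (1 - x) * (ω 0 - ω 2)),
      (h0 2 0 * h1 0 1 - h0 2 1 * (h1 0 0 * Complex.exp (s * (ω 0 - ω 1))))
        * Complex.exp (s * (1 - x) * (ω 1 - ω 2)),
      h0 1 0 * h0 2 1 - h0 1 1 * h0 2 0]

/-- The columns of `weylMatrix` are cross products of the rows of boundary values that have to
vanish, divided by the dominant exponential: rows 0, 1 at the point 1; row 2 at 0 with row 0 at 1;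
rows 1, 2 at 0. The k-th column belongs to the behaviour exp(s ω_k x), and moving this factor across
shifts the remaining exponents from 0 to x. -/
theorem expMatrix_mul_weylMatrix (ω : Fin 3 → ℂ) (h0 h1 : Matrix (Fin 3) (Fin 3) ℂ) (s : ℝ)
    (x : unitInterval) : expMatrix ω s x * weylMatrix ω h0 h1 s 0
      = weylMatrix ω h0 h1 s x * expMatrix ω s x := by
  have e : ∀ a b c d : ℂ, a + b = c + d →
      Complex.exp a * Complex.exp b = Complex.exp c * Complex.exp d := fun a b c d h => by
    rw [← Complex.exp_add, ← Complex.exp_add, h]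
  have e' : ∀ a c d : ℂ, a = c + d →
      Complex.exp a = Complex.exp c * Complex.exp d := fun a c d h => by
    rw [← Complex.exp_add, h]
  ext i j
  simp only [expMatrix, Matrix.diagonal_mul, Matrix.mul_diagonal]
  fin_cases i <;> fin_cases j <;> simp [weylMatrix]
  · ring
  · rw [e' (s * ω 0 * x) (s * x * (ω 0 - ω 1)) (s * ω 1 * x) (by ring)]; ring
  · rw [e' (s * ω 0 * x) (s * x * (ω 0 - ω 2)) (s * ω 2 * x) (by ring)]; ring
  · linear_combination (h1 0 2 * h1 1 0 - h1 0 0 * h1 1 2) *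
      e (s * ω 1 * x) (s * (ω 0 - ω 1)) (s * (1 - x) * (ω 0 - ω 1)) (s * ω 0 * x) (by ring)
  · ring
  · rw [e' (s * ω 1 * x) (s * x * (ω 1 - ω 2)) (s * ω 2 * x) (by ring)]; ring
  · linear_combination (h1 0 0 * h1 1 1 - h1 0 1 * h1 1 0) *
      e (s * ω 2 * x) (s * (ω 0 - ω 2)) (s * (1 - x) * (ω 0 - ω 2)) (s * ω 0 * x) (by ring)
  · linear_combination (h0 2 0 * h1 0 1 - h0 2 1 * (h1 0 0 * Complex.exp (s * (ω 0 - ω 1)))) *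
      e (s * ω 2 * x) (s * (ω 1 - ω 2)) (s * (1 - x) * (ω 1 - ω 2)) (s * ω 1 * x) (by ring)
  · ring

/-- The matrices `Ψ s x` describe, up to scaling, solutions with prescribed zero boundary values
and their limits as `s → ∞`. -/
structure IsWeylFamily (μ : ℂ) (ω : Fin 3 → ℂ) (Ψ : ℝ → unitInterval → Matrix (Fin 3) (Fin 3) ℂ) :
    Prop where
  fund_mul : ∀ᶠ s : ℝ in atTop, ∀ x, fund hp (μ * s ^ 3) x * (scaleMatrix s * Ψ s 0)
    = scaleMatrix s * (Ψ s x * expMatrix ω s x)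
  left_eq : ∀ s, Ψ s 0 2 1 = 0 ∧ Ψ s 0 1 2 = 0 ∧ Ψ s 0 2 2 = 0
  right_eq : ∀ s, Ψ s 1 0 0 = 0 ∧ Ψ s 1 1 0 = 0 ∧ Ψ s 1 0 1 = 0
  tendsto : ∀ x : unitInterval, (x : ℝ) ∈ Ioo (0 : ℝ) 1 → Tendsto (fun s => Ψ s x) atTop
    (𝓝 (powMatrix ω * Matrix.diagonal ![ω 2 - ω 1, -ω 0 ^ 2, ω 0 * ω 1 * (ω 1 - ω 0)]))
  tendsto_left_one_zero : Tendsto (fun s => Ψ s 0 1 0) atTop (𝓝 (ω 0 * (ω 2 - ω 1)))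
  tendsto_left_two_zero : Tendsto (fun s => Ψ s 0 2 0) atTop (𝓝 (ω 0 ^ 2 * (ω 2 - ω 1)))
  tendsto_left_one_one : Tendsto (fun s => Ψ s 0 1 1) atTop (𝓝 (ω 0 * ω 1 * (ω 1 - ω 0)))
  tendsto_left_zero_two : Tendsto (fun s => Ψ s 0 0 2) atTop (𝓝 (powMatrix ω).det)
  tendsto_right : Tendsto (fun s => Ψ s 1 2 0) atTop (𝓝 (powMatrix ω).det)

theorem tendsto_exp_mul_zero {z : ℂ} (hz : z.re < 0) {y : ℝ} (hy : 0 < y) :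
    Tendsto (fun s : ℝ => Complex.exp (s * y * z)) atTop (𝓝 0) := by
  rw [tendsto_zero_iff_norm_tendsto_zero]
  have h1 : ∀ s : ℝ, ‖Complex.exp (s * y * z)‖ = Real.exp (s * (y * z.re)) := fun s => by
    rw [Complex.norm_exp, ← Complex.ofReal_mul, Complex.re_ofReal_mul, mul_assoc]
  simp only [h1]
  exact Real.tendsto_exp_atBot.comp
    (tendsto_id.atTop_mul_const_of_neg (mul_neg_of_pos_of_neg hy hz))

theorem tendsto_exp_zero {z : ℂ} (hz : z.re < 0) :
    Tendsto (fun s : ℝ => Complex.exp (s * z)) atTop (𝓝 0) := by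
  simpa using tendsto_exp_mul_zero hz one_pos

/-- The boundary zeros are orthogonality of a cross product to its factors. At interior x every
off-diagonal exponential decays and only the diagonal of `weylMatrix` survives; at an end point some
of these exponentials equal 1, which gives the other limits. -/
theorem exists_isWeylFamily {μ : ℂ} {ω : Fin 3 → ℂ} (h : IsCubeRoots μ ω) :
    ∃ Ψ, IsWeylFamily hp μ ω Ψ := by
  obtain ⟨H, hH, hlim⟩ := exists_tendsto_powMatrix hp h
  have hent : ∀ x i j, Tendsto (fun s => H s x i j) atTop (𝓝 (ω j ^ (i : ℕ))) := fun x i j =>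
    tendsto_pi_nhds.1 (tendsto_pi_nhds.1 (hlim x) i) j
  have r01 : (ω 0 - ω 1).re < 0 := by
    rw [Complex.sub_re, sub_neg]; exact h.re_strictMono (by decide)
  have r12 : (ω 1 - ω 2).re < 0 := by
    rw [Complex.sub_re, sub_neg]; exact h.re_strictMono (by decide)
  have r02 : (ω 0 - ω 2).re < 0 := by
    rw [Complex.sub_re, sub_neg]; exact h.re_strictMono (by decide)
  have e01 := tendsto_exp_zero r01
  have e12 := tendsto_exp_zero r12
  have e02 := tendsto_exp_zero r02
  have hdet : (powMatrix ω).det = (ω 1 * ω 2 ^ 2 - ω 2 * ω 1 ^ 2) - (ω 0 * ω 2 ^ 2 - ω 2 * ω 0 ^ 2)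
      + (ω 0 * ω 1 ^ 2 - ω 1 * ω 0 ^ 2) := by
    rw [Matrix.det_fin_three]
    simp [powMatrix]
    ring
  have v0 := ((hent 1 0 1).mul (hent 1 1 2)).sub ((hent 1 0 2).mul (hent 1 1 1))
  have v1 := ((hent 1 0 2).mul (hent 1 1 0)).sub ((hent 1 0 0).mul (hent 1 1 2))
  have v2 := ((hent 1 0 0).mul (hent 1 1 1)).sub ((hent 1 0 1).mul (hent 1 1 0))
  have c0 := ((hent 0 2 1).mul (hent 1 0 2)).sub (((hent 0 2 2).mul e12).mul (hent 1 0 1))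
  have c1 := (((hent 0 2 2).mul e12).mul ((hent 1 0 0).mul e01)).sub
    ((hent 0 2 0).mul (hent 1 0 2))
  have c2 := ((hent 0 2 0).mul (hent 1 0 1)).sub ((hent 0 2 1).mul ((hent 1 0 0).mul e01))
  have w0 := ((hent 0 1 1).mul (hent 0 2 2)).sub ((hent 0 1 2).mul (hent 0 2 1))
  have w1 := ((hent 0 1 2).mul (hent 0 2 0)).sub ((hent 0 1 0).mul (hent 0 2 2))
  have w2 := ((hent 0 1 0).mul (hent 0 2 1)).sub ((hent 0 1 1).mul (hent 0 2 0))
  refine ⟨fun s x => H s x * weylMatrix ω (H s 0) (H s 1) s x, ?_, fun s => ?_, fun s => ?_,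
    fun x hx => ?_, ?_, ?_, ?_, ?_, ?_⟩
  · filter_upwards [hH] with s hs x
    rw [Matrix.mul_assoc (H s x), ← expMatrix_mul_weylMatrix, ← Matrix.mul_assoc (H s x),
      ← Matrix.mul_assoc (scaleMatrix s) (H s x * expMatrix ω s x), ← hs x,
      show ((0 : unitInterval) : ℝ) = 0 from rfl]
    simp only [Matrix.mul_assoc]
  · simp [Matrix.mul_apply, Fin.sum_univ_three, weylMatrix]
    refine ⟨?_, ?_, ?_⟩ <;> ring
  · simp [Matrix.mul_apply, Fin.sum_univ_three, weylMatrix]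
    refine ⟨?_, ?_, ?_⟩ <;> ring
  · refine (hlim x).mul (tendsto_pi_nhds.2 fun i => tendsto_pi_nhds.2 fun j => ?_)
    have hx0 := hx.1
    have hx1 : 0 < 1 - (x : ℝ) := by linarith [hx.2]
    have f := fun {z : ℂ} (hz : z.re < 0) => tendsto_exp_mul_zero hz hx0
    have g : ∀ {z : ℂ}, z.re < 0 →
        Tendsto (fun s : ℝ => Complex.exp (s * (1 - (x : ℝ)) * z)) atTop (𝓝 0) := fun hz => by
      simpa using tendsto_exp_mul_zero hz hx1
    fin_cases i <;> fin_cases j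
    · simpa [weylMatrix] using v0
    · simpa [weylMatrix] using c0.mul (f r01)
    · simpa [weylMatrix] using w0.mul (f r02)
    · simpa [weylMatrix] using v1.mul (g r01)
    · simpa [weylMatrix] using c1
    · simpa [weylMatrix] using w1.mul (f r12)
    · simpa [weylMatrix] using v2.mul (g r02)
    · simpa [weylMatrix] using c2.mul (g r12)
    · have e : ω 0 * ω 1 * (ω 1 - ω 0) = ω 0 * ω 1 ^ 2 - ω 1 * ω 0 ^ 2 := by ring
      simpa [weylMatrix, e] using w2
  · have := (((hent 0 1 0).mul v0).add ((hent 0 1 1).mul (v1.mul e01))).add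
      ((hent 0 1 2).mul (v2.mul e02))
    simpa [Matrix.mul_apply, Fin.sum_univ_three, weylMatrix] using this
  · have := (((hent 0 2 0).mul v0).add ((hent 0 2 1).mul (v1.mul e01))).add
      ((hent 0 2 2).mul (v2.mul e02))
    simpa [Matrix.mul_apply, Fin.sum_univ_three, weylMatrix] using this
  · have := (((hent 0 1 0).mul c0).add ((hent 0 1 1).mul c1)).add
      ((hent 0 1 2).mul (c2.mul e12))
    have e : ω 0 * ω 1 * (ω 1 - ω 0) = ω 0 * ω 1 ^ 2 + -(ω 1 * ω 0 ^ 2) := by ring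
    rw [e]
    simpa [Matrix.mul_apply, Fin.sum_univ_three, weylMatrix] using this
  · have := (((hent 0 0 0).mul w0).add ((hent 0 0 1).mul w1)).add ((hent 0 0 2).mul w2)
    rw [hdet, show ω 1 * ω 2 ^ 2 - ω 2 * ω 1 ^ 2 - (ω 0 * ω 2 ^ 2 - ω 2 * ω 0 ^ 2)
      = ω 1 * ω 2 ^ 2 - ω 2 * ω 1 ^ 2 + (ω 2 * ω 0 ^ 2 - ω 0 * ω 2 ^ 2) by ring]
    simpa [Matrix.mul_apply, Fin.sum_univ_three, weylMatrix] using this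
  · have := (((hent 1 2 0).mul v0).add ((hent 1 2 1).mul v1)).add ((hent 1 2 2).mul v2)
    rw [hdet, show ω 1 * ω 2 ^ 2 - ω 2 * ω 1 ^ 2 - (ω 0 * ω 2 ^ 2 - ω 2 * ω 0 ^ 2)
      + (ω 0 * ω 1 ^ 2 - ω 1 * ω 0 ^ 2) = ω 0 ^ 2 * (ω 2 - ω 1) + ω 1 ^ 2 * (ω 0 - ω 2)
      + ω 2 ^ 2 * (ω 1 - ω 0) by ring]
    simpa [Matrix.mul_apply, Fin.sum_univ_three, weylMatrix] using this

end Exponential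

end ThirdOrder
end

/-! ### The spectra determine the characteristic functions. -/

noncomputable section

namespace ThirdOrder

open MeasureTheory Set Filter Topology

theorem IsCubeRoots.root_ne_zero {μ : ℂ} {ω : Fin 3 → ℂ} (h : IsCubeRoots μ ω) (k : Fin 3) :
    ω k ≠ 0 := fun h0 => h.ne_zero (by rw [← h.cube k, h0]; simp)

theorem IsCubeRoots.sub_ne_zero {μ : ℂ} {ω : Fin 3 → ℂ} (h : IsCubeRoots μ ω) {j k : Fin 3}
    (hjk : j ≠ k) : ω j - ω k ≠ 0 := _root_.sub_ne_zero.2 (h.injective.ne hjk)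

variable {p q : ℝ → ℂ} (hp : IntervalIntegrable p volume 0 1) (hq : IntervalIntegrable q volume 0 1)
variable {μ : ℂ} {ω : Fin 3 → ℂ} {Ψ Ψ' : ℝ → unitInterval → Matrix (Fin 3) (Fin 3) ℂ}

variable {hp} in
-- Column 0 and the solution behind `endSol` satisfy the same two conditions at 1, so they are
-- proportional; the factor is the value of y^{[2]} at 1.
theorem IsWeylFamily.scale_mul_left (hΨ : IsWeylFamily hp μ ω Ψ) :
    ∀ᶠ s : ℝ in atTop, ∀ i : Fin 3, (s : ℂ) ^ (i : ℕ) * Ψ s 0 i 0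
      = (s : ℂ) ^ 2 * Ψ s 1 2 0 * Complex.exp (s * ω 0) * endSol hp (μ * s ^ 3) i := by
  filter_upwards [hΨ.fund_mul] with s hs i
  set T := fund hp (μ * s ^ 3) 1
  set a := (s : ℂ) ^ 2 * Ψ s 1 2 0 * Complex.exp (s * ω 0)
  have h1 : T.mulVec (fun i => (s : ℂ) ^ (i : ℕ) * Ψ s 0 i 0)
      = T.mulVec (a • endSol hp (μ * s ^ 3)) := by
    rw [Matrix.mulVec_smul, fund_one_mulVec_endSol]
    ext i
    have h2 := congr_fun (congr_fun (hs 1) i) 0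
    rw [Matrix.mul_apply] at h2
    simp only [scaleMatrix, expMatrix, Matrix.diagonal_mul, Matrix.mul_diagonal] at h2
    simp only [Matrix.mulVec, dotProduct]
    refine h2.trans ?_
    obtain ⟨r0, r1, -⟩ := hΨ.right_eq s
    fin_cases i
    · simp [r0]
    · simp [r1]
    · simp [a, mul_assoc]
  have h2 := congr_arg (fundInv hp (μ * s ^ 3) 1).mulVec h1
  rw [Matrix.mulVec_mulVec, Matrix.mulVec_mulVec, fundInv_mul_fund, Matrix.one_mulVec,
    Matrix.one_mulVec] at h2
  exact congr_fun h2 i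

variable {hp} in
theorem IsWeylFamily.fund_zero_zero_mul_add (hΨ : IsWeylFamily hp μ ω Ψ) :
    ∀ᶠ s : ℝ in atTop, fund hp (μ * s ^ 3) 1 0 0 * Ψ s 0 0 1
      + fund hp (μ * s ^ 3) 1 0 1 * (s * Ψ s 0 1 1) = 0 := by
  filter_upwards [hΨ.fund_mul] with s hs
  have h2 := congr_fun (congr_fun (hs 1) 0) 1
  obtain ⟨-, -, r⟩ := hΨ.right_eq s
  obtain ⟨l, -, -⟩ := hΨ.left_eq s
  simpa [Matrix.mul_apply, scaleMatrix, expMatrix, Fin.sum_univ_three, r, l] using h2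

theorem IsWeylFamily.eventually_endSol_ne_zero (hΨ : IsWeylFamily hp μ ω Ψ) {i : Fin 3} {l : ℂ}
    (hl : l ≠ 0) (hi : Tendsto (fun s => Ψ s 0 i 0) atTop (𝓝 l)) :
    ∀ᶠ s : ℝ in atTop, endSol hp (μ * s ^ 3) i ≠ 0 := by
  filter_upwards [hΨ.scale_mul_left, hi.eventually_ne hl, eventually_gt_atTop 0] with s hs h1 h2 h3
  have h4 := hs i
  rw [h3, mul_zero] at h4
  exact mul_ne_zero (pow_ne_zero _ (Complex.ofReal_ne_zero.2 h2.ne')) h1 h4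

/-- If this entry vanished, column 1 would force the next entry to vanish and `endSol` the third,
leaving an invertible matrix with a zero row. -/
theorem IsWeylFamily.eventually_fund_zero_zero_ne_zero (hΨ : IsWeylFamily hp μ ω Ψ)
    (h : IsCubeRoots μ ω) : ∀ᶠ s : ℝ in atTop, fund hp (μ * s ^ 3) 1 0 0 ≠ 0 := by
  have h11 : ω 0 * ω 1 * (ω 1 - ω 0) ≠ 0 := mul_ne_zero (mul_ne_zero (h.root_ne_zero 0)
    (h.root_ne_zero 1)) (h.sub_ne_zero (by decide))
  have h20 : ω 0 ^ 2 * (ω 2 - ω 1) ≠ 0 := mul_ne_zero (pow_ne_zero _ (h.root_ne_zero 0))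
    (h.sub_ne_zero (by decide))
  filter_upwards [hΨ.fund_zero_zero_mul_add, hΨ.tendsto_left_one_one.eventually_ne h11,
    hΨ.eventually_endSol_ne_zero hp h20 hΨ.tendsto_left_two_zero, eventually_gt_atTop 0]
    with s h1 h2 h3 h4 h0
  have hs : (s : ℂ) ≠ 0 := Complex.ofReal_ne_zero.2 h4.ne'
  rw [h0, zero_mul, zero_add] at h1
  have h01 := (mul_eq_zero.1 h1).resolve_right (mul_ne_zero hs h2)
  have h5 := congr_fun (fund_one_mulVec_endSol hp (μ * s ^ 3)) 0
  simp [Matrix.mulVec, dotProduct, Fin.sum_univ_three, h0, h01, h3] at h5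
  have h6 := congr_fun (congr_fun (fund_mul_fundInv hp (μ * s ^ 3) 1) 0) 0
  simp [Matrix.mul_apply, Fin.sum_univ_three, h0, h01, h5] at h6

/-- The powers of s and the exponential in `IsWeylFamily.scale_mul_left` do not depend on the
coefficient and cancel, leaving quantities with common nonzero limits. -/
theorem IsWeylFamily.tendsto_endSol_div (h : IsCubeRoots μ ω)
    (hΨ : IsWeylFamily hp μ ω Ψ) (hΨ' : IsWeylFamily hq μ ω Ψ') {i : Fin 3} {l : ℂ}
    (hl : l ≠ 0) (hi : Tendsto (fun s => Ψ s 0 i 0) atTop (𝓝 l))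
    (hi' : Tendsto (fun s => Ψ' s 0 i 0) atTop (𝓝 l)) :
    Tendsto (fun s : ℝ => endSol hq (μ * s ^ 3) i / endSol hp (μ * s ^ 3) i) atTop (𝓝 1) := by
  have h1 := (hi'.div hi hl).mul (hΨ.tendsto_right.div hΨ'.tendsto_right h.det_ne_zero)
  rw [div_self hl, div_self h.det_ne_zero, mul_one] at h1
  refine h1.congr' ?_
  filter_upwards [hΨ.scale_mul_left, hΨ'.scale_mul_left, hi.eventually_ne hl,
    hΨ.eventually_endSol_ne_zero hp hl hi, hΨ.tendsto_right.eventually_ne h.det_ne_zero,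
    hΨ'.tendsto_right.eventually_ne h.det_ne_zero, eventually_gt_atTop 0] with s e e' h2 h3 h4 h5 h6
  have hs : (s : ℂ) ≠ 0 := Complex.ofReal_ne_zero.2 h6.ne'
  have hsi : (s : ℂ) ^ (i : ℕ) ≠ 0 := pow_ne_zero _ hs
  have hE := Complex.exp_ne_zero (s * ω 0)
  simp only [Pi.div_apply]
  rw [div_mul_div_comm, div_eq_div_iff (mul_ne_zero h2 h5) h3]
  refine mul_left_cancel₀ (mul_ne_zero (mul_ne_zero hsi (pow_ne_zero 2 hs)) hE) ?_
  linear_combination (s : ℂ) ^ 2 * Complex.exp (s * ω 0) * (Ψ s 1 2 0 * endSol hp (μ * s ^ 3) i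
    * e' i - Ψ' s 1 2 0 * endSol hq (μ * s ^ 3) i * e i)

theorem analyticOrderAt_ne_top_of_differentiable {f : ℂ → ℂ} (hf : Differentiable ℂ f) {c : ℂ}
    (hc : f c ≠ 0) (z : ℂ) : analyticOrderAt f z ≠ ⊤ := by
  have h1 : AnalyticOnNhd ℂ f univ := fun w _ => hf.analyticAt w
  refine h1.analyticOrderAt_ne_top_of_isPreconnected isPreconnected_univ (mem_univ c) (mem_univ z) ?_
  rw [(hf.analyticAt c).analyticOrderAt_eq_zero.2 hc]
  exact ENat.zero_ne_top

/-- The spectrum fixes the zeros with multiplicity, and the asymptotics on both halves of the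
imaginary axis fix the remaining zero-free factor. -/
theorem endSol_eq_of_spectrumMult_eq {i : Fin 3} (hi : i = 0 ∨ i = 1)
    (h : ∀ lam, spectrumMult p i lam = spectrumMult q i lam) (lam : ℂ) :
    endSol hp lam i.rev = endSol hq lam i.rev := by
  obtain ⟨Ψ₁, h₁⟩ := exists_isWeylFamily hp isCubeRoots_I
  obtain ⟨Ψ₂, h₂⟩ := exists_isWeylFamily hq isCubeRoots_I
  obtain ⟨Ψ₃, h₃⟩ := exists_isWeylFamily hp isCubeRoots_neg_I
  obtain ⟨Ψ₄, h₄⟩ := exists_isWeylFamily hq isCubeRoots_neg_I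
  have key : ∀ {r : ℝ → ℂ} (hr : IntervalIntegrable r volume 0 1) {μ : ℂ} {ω : Fin 3 → ℂ}
      {Ψ : ℝ → unitInterval → Matrix (Fin 3) (Fin 3) ℂ} (hω : IsCubeRoots μ ω),
      IsWeylFamily hr μ ω Ψ → (ω 0 ^ (i.rev : ℕ) * (ω 2 - ω 1) ≠ 0 ∧
        Tendsto (fun s => Ψ s 0 i.rev 0) atTop (𝓝 (ω 0 ^ (i.rev : ℕ) * (ω 2 - ω 1)))) := by
    intro r hr μ ω Ψ hω hΨ
    refine ⟨mul_ne_zero (pow_ne_zero _ (hω.root_ne_zero 0)) (hω.sub_ne_zero (by decide)), ?_⟩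
    rcases hi with rfl | rfl
    · exact hΨ.tendsto_left_two_zero
    · simpa using hΨ.tendsto_left_one_zero
  obtain ⟨l₁, t₁⟩ := key hp isCubeRoots_I h₁
  obtain ⟨-, t₂⟩ := key hq isCubeRoots_I h₂
  obtain ⟨l₃, t₃⟩ := key hp isCubeRoots_neg_I h₃
  obtain ⟨-, t₄⟩ := key hq isCubeRoots_neg_I h₄
  obtain ⟨s, hs⟩ := (h₁.eventually_endSol_ne_zero hp l₁ t₁).exists
  obtain ⟨s', hs'⟩ := (h₂.eventually_endSol_ne_zero hq l₁ t₂).exists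
  have n1 := analyticOrderAt_ne_top_of_differentiable (differentiable_endSol hp i.rev) hs
  have n2 := analyticOrderAt_ne_top_of_differentiable (differentiable_endSol hq i.rev) hs'
  exact congr_fun (HalfGrowth.eq_of_analyticOrderAt_eq (differentiable_endSol hp i.rev)
    (differentiable_endSol hq i.rev) (halfGrowth_endSol hp i.rev) (halfGrowth_endSol hq i.rev) n1
    (fun z => analyticOrderAt_eq_of_spectrumMult_eq hp hq i z (n1 z) (n2 z) (h z))
    (IsWeylFamily.tendsto_endSol_div hp hq isCubeRoots_I h₁ h₂ l₁ t₁ t₂)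
    (IsWeylFamily.tendsto_endSol_div hp hq isCubeRoots_neg_I h₃ h₄ l₃ t₃ t₄)) lam

/-! ### The transition matrix and its asymptotics. -/

/-- The matrix `1 + d * E`, where `E` has the entry one in the upper right corner. -/
def shearMatrix (d : ℂ) : Matrix (Fin 3) (Fin 3) ℂ := !![1, 0, d; 0, 1, 0; 0, 0, 1]

/-- The matrix that transforms the solutions of the equation with the coefficient `q` into the ones
of the equation with the coefficient `p`. -/
def transitionMatrix (d : ℂ → ℂ) (lam : ℂ) (x : unitInterval) : Matrix (Fin 3) (Fin 3) ℂ :=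
  fund hp lam x * shearMatrix (d lam) * fundInv hq lam x

/-- The transition matrix maps Weyl solutions for q to those for p, and both have the same interior
limit. Undoing the scaling multiplies entry (i, j) by s^(i - j), so only the first row stays under
control. -/
theorem tendsto_transitionMatrix (h : IsCubeRoots μ ω)
    (hb1 : ∀ lam, endSol hp lam 1 = endSol hq lam 1)
    (hb2 : ∀ lam, endSol hp lam 2 = endSol hq lam 2) {d : ℂ → ℂ}
    (hd : ∀ lam, d lam * endSol hp lam 2 = endSol hp lam 0 - endSol hq lam 0) {x : unitInterval}
    (hx : (x : ℝ) ∈ Ioo (0 : ℝ) 1) (j : Fin 3) :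
    Tendsto (fun s : ℝ => transitionMatrix hp hq d (μ * s ^ 3) x 0 j) atTop
      (𝓝 ((1 : Matrix (Fin 3) (Fin 3) ℂ) 0 j)) := by
  obtain ⟨Ψ, hΨ⟩ := exists_isWeylFamily hp h
  obtain ⟨Ψ', hΨ'⟩ := exists_isWeylFamily hq h
  have hdet := h.det_ne_zero
  have h11 : ω 0 * ω 1 * (ω 1 - ω 0) ≠ 0 := mul_ne_zero (mul_ne_zero (h.root_ne_zero 0)
    (h.root_ne_zero 1)) (h.sub_ne_zero (by decide))
  have hT0 : ∀ lam, fund hp lam 1 0 0 = fund hq lam 1 0 0 := fun lam => by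
    simpa [endSol_two] using hb2 (-lam)
  have hT1 : ∀ lam, fund hp lam 1 0 1 = fund hq lam 1 0 1 := fun lam => by
    simpa [endSol_one] using hb1 (-lam)
  -- The two families are normalized differently; D compares y^{[2]}(1) in column 0, y^{[1]}(0) in
  -- column 1 and y(0) in column 2.
  let D : ℝ → Matrix (Fin 3) (Fin 3) ℂ := fun s => Matrix.diagonal
    ![Ψ' s 1 2 0 / Ψ s 1 2 0, Ψ' s 0 1 1 / Ψ s 0 1 1, Ψ' s 0 0 2 / Ψ s 0 0 2]
  have hD : Tendsto D atTop (𝓝 1) := by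
    have a0 := hΨ'.tendsto_right.div hΨ.tendsto_right hdet
    have a1 := hΨ'.tendsto_left_one_one.div hΨ.tendsto_left_one_one h11
    have a2 := hΨ'.tendsto_left_zero_two.div hΨ.tendsto_left_zero_two hdet
    rw [div_self hdet] at a0 a2
    rw [div_self h11] at a1
    refine tendsto_pi_nhds.2 fun i => tendsto_pi_nhds.2 fun j => ?_
    fin_cases i <;> fin_cases j <;> simp [D, Matrix.diagonal] <;> assumption
  -- The shear repairs the first component of column 0. It fixes columns 1 and 2, whose third
  -- components vanish at 0; in column 1 the ratio of the first two is dictated by entries of `fund`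
  -- common to p and q.
  have hconn : ∀ᶠ s : ℝ in atTop, scaleMatrix s * Ψ s 0 * D s
      = shearMatrix (d (μ * s ^ 3)) * (scaleMatrix s * Ψ' s 0) := by
    filter_upwards [hΨ.scale_mul_left, hΨ'.scale_mul_left, hΨ.eventually_fund_zero_zero_ne_zero hp h,
      hΨ.fund_zero_zero_mul_add, hΨ'.fund_zero_zero_mul_add,
      hΨ.tendsto_right.eventually_ne hdet, hΨ.tendsto_left_one_one.eventually_ne h11,
      hΨ.tendsto_left_zero_two.eventually_ne hdet, eventually_gt_atTop 0]
      with s e e' hT m m' n1 n2 n3 hs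
    have hs0 : (s : ℂ) ≠ 0 := Complex.ofReal_ne_zero.2 hs.ne'
    obtain ⟨z1, z2, z3⟩ := hΨ.left_eq s
    obtain ⟨z1', z2', z3'⟩ := hΨ'.left_eq s
    rw [← hT0, ← hT1] at m'
    have hd' := hd (μ * s ^ 3)
    have e0 := e 0
    have e1 := e 1
    have e2 := e 2
    have e0' := e' 0
    have e1' := e' 1
    have e2' := e' 2
    rw [← hb1] at e1'
    rw [← hb2] at e2'
    simp only [Fin.val_zero, Fin.val_one, Fin.val_two, pow_zero, pow_one, one_mul]
      at e0 e1 e2 e0' e1' e2'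
    ext i j
    fin_cases i <;> fin_cases j <;>
      simp [shearMatrix, scaleMatrix, Matrix.mul_apply, D, Fin.sum_univ_three, Matrix.diagonal_apply,
        z1, z2, z3, z1', z2', z3']
    · rw [e0, e0', e2']
      generalize μ * (s : ℂ) ^ 3 = lam at hd' ⊢
      field_simp
      linear_combination -Ψ' s 1 2 0 * hd'
    · rw [mul_div_assoc', div_eq_iff n2]
      refine mul_left_cancel₀ hT ?_
      linear_combination Ψ' s 0 1 1 * m - Ψ s 0 1 1 * m'
    · field_simp
    · rw [e1, e1']
      field_simp
    · field_simp
    · rw [e2, e2']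
      field_simp
  have hmain : ∀ᶠ s : ℝ in atTop, transitionMatrix hp hq d (μ * s ^ 3) x *
      (scaleMatrix s * Ψ' s x) = scaleMatrix s * (Ψ s x * D s) := by
    filter_upwards [hconn, hΨ.fund_mul, hΨ'.fund_mul] with s h1 h2 h3
    have hcomm : expMatrix ω s x * D s = D s * expMatrix ω s x := by
      simp only [expMatrix, D, Matrix.diagonal_mul_diagonal, mul_comm]
    have hunit : IsUnit (expMatrix ω s x) := by
      rw [Matrix.isUnit_iff_isUnit_det, expMatrix, Matrix.det_diagonal, isUnit_iff_ne_zero]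
      exact Finset.prod_ne_zero_iff.2 fun k _ => Complex.exp_ne_zero _
    refine hunit.mul_right_cancel ?_
    have h4 : transitionMatrix hp hq d (μ * s ^ 3) x * fund hq (μ * s ^ 3) x
        = fund hp (μ * s ^ 3) x * shearMatrix (d (μ * s ^ 3)) := by
      rw [transitionMatrix, Matrix.mul_assoc, fundInv_mul_fund, Matrix.mul_one]
    calc transitionMatrix hp hq d (μ * s ^ 3) x * (scaleMatrix s * Ψ' s x) * expMatrix ω s x
        = transitionMatrix hp hq d (μ * s ^ 3) x * (scaleMatrix s * (Ψ' s x * expMatrix ω s x)) := by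
          simp only [Matrix.mul_assoc]
      _ = fund hp (μ * s ^ 3) x * (shearMatrix (d (μ * s ^ 3)) * (scaleMatrix s * Ψ' s 0)) := by
          rw [← h3 x, ← Matrix.mul_assoc, h4, Matrix.mul_assoc]
      _ = fund hp (μ * s ^ 3) x * (scaleMatrix s * Ψ s 0) * D s := by
          rw [← h1]; simp only [Matrix.mul_assoc]
      _ = scaleMatrix s * (Ψ s x * D s) * expMatrix ω s x := by
          rw [h2 x]; simp only [Matrix.mul_assoc, hcomm]
  set L := powMatrix ω * Matrix.diagonal ![ω 2 - ω 1, -ω 0 ^ 2, ω 0 * ω 1 * (ω 1 - ω 0)] with hL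
  have hLdet : L.det ≠ 0 := by
    rw [hL, Matrix.det_mul, Matrix.det_diagonal, Fin.prod_univ_three]
    refine mul_ne_zero hdet (mul_ne_zero (mul_ne_zero ?_ ?_) ?_)
    · exact h.sub_ne_zero (by decide)
    · exact neg_ne_zero.2 (pow_ne_zero _ (h.root_ne_zero 0))
    · exact h11
  have tΨ := hΨ.tendsto x hx
  have tΨ' := hΨ'.tendsto x hx
  have tdet : Tendsto (fun s => (Ψ' s x).det) atTop (𝓝 L.det) :=
    (Continuous.matrix_det continuous_id).continuousAt.tendsto.comp tΨ'
  have tadj : Tendsto (fun s => (Ψ' s x).adjugate) atTop (𝓝 L.adjugate) :=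
    (Continuous.matrix_adjugate continuous_id).continuousAt.tendsto.comp tΨ'
  -- The inverse of `Ψ' s x` is written as adjugate over determinant, which is continuous at the
  -- invertible limit `L`.
  have t1 : Tendsto (fun s => (Ψ s x * D s * (Ψ' s x).adjugate) 0 j / (Ψ' s x).det) atTop
      (𝓝 ((1 : Matrix (Fin 3) (Fin 3) ℂ) 0 j)) := by
    have := tendsto_pi_nhds.1 (tendsto_pi_nhds.1 ((tΨ.mul hD).mul tadj) 0) j
    have h2 := this.div tdet hLdet
    rwa [Matrix.mul_one, Matrix.mul_adjugate, Matrix.smul_apply, smul_eq_mul,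
      mul_div_cancel_left₀ _ hLdet] at h2
  have t2 : Tendsto (fun s : ℝ => (Ψ s x * D s * (Ψ' s x).adjugate) 0 j / (Ψ' s x).det
      * ((s : ℂ) ^ (j : ℕ))⁻¹) atTop (𝓝 ((1 : Matrix (Fin 3) (Fin 3) ℂ) 0 j)) := by
    by_cases hj : j = 0
    · subst hj; simpa using t1
    · have t3 : Tendsto (fun s : ℝ => ((s : ℂ) ^ (j : ℕ))⁻¹) atTop (𝓝 0) := by
        have := (tendsto_inv₀_cobounded.comp (RCLike.tendsto_ofReal_atTop_cobounded ℂ)).pow (j : ℕ)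
        rw [zero_pow (by rwa [Ne, Fin.val_eq_zero_iff])] at this
        simpa [inv_pow] using this
      have := t1.mul t3
      rw [mul_zero] at this
      rwa [Matrix.one_apply_ne (Ne.symm hj)]
  refine t2.congr' ?_
  filter_upwards [hmain, tdet.eventually_ne hLdet, eventually_gt_atTop 0] with s h1 h2 h3
  have hs : (s : ℂ) ^ (j : ℕ) ≠ 0 := pow_ne_zero _ (Complex.ofReal_ne_zero.2 h3.ne')
  have h4 : (transitionMatrix hp hq d (μ * s ^ 3) x * (scaleMatrix s * Ψ' s x)
      * (Ψ' s x).adjugate) 0 j = (scaleMatrix s * (Ψ s x * D s) * (Ψ' s x).adjugate) 0 j := by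
    rw [h1]
  simp only [Matrix.mul_assoc, Matrix.mul_adjugate] at h4
  rw [← Matrix.mul_assoc, Matrix.mul_smul, Matrix.mul_one] at h4
  simp only [scaleMatrix, Matrix.smul_apply, Matrix.mul_diagonal, Matrix.diagonal_mul] at h4
  rw [← div_eq_mul_inv, div_div, div_eq_iff (mul_ne_zero h2 hs), Matrix.mul_assoc]
  simp only [smul_eq_mul, Fin.val_zero, pow_zero, one_mul] at h4
  rw [← h4]; ring

end ThirdOrder
end

noncomputable section

namespace ThirdOrder

open MeasureTheory Set Filter Topology

/-! ### The transition matrix is the identity in its first row -/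

/-- N₁/D₁ and N₂/D₂ agree where both make sense, and at each point at least one of them does. -/
theorem exists_entire_of_mul_eq_mul {D₁ D₂ N₁ N₂ : ℂ → ℂ} (hD₁ : Differentiable ℂ D₁)
    (hD₂ : Differentiable ℂ D₂) (hN₁ : Differentiable ℂ N₁) (hN₂ : Differentiable ℂ N₂)
    (h : ∀ z, N₁ z * D₂ z = N₂ z * D₁ z) (h0 : ∀ z, D₂ z = 0 → D₁ z ≠ 0) :
    ∃ d : ℂ → ℂ, Differentiable ℂ d ∧ ∀ z, d z * D₁ z = N₁ z := by
  classical
  have hd : ∀ z, D₂ z ≠ 0 → (if D₁ z ≠ 0 then N₁ z / D₁ z else N₂ z / D₂ z) = N₂ z / D₂ z := by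
    intro z hz
    split_ifs with h1
    · rw [div_eq_div_iff h1 hz, h]
    · rfl
  refine ⟨fun z => if D₁ z ≠ 0 then N₁ z / D₁ z else N₂ z / D₂ z, fun z => ?_, fun z => ?_⟩
  · by_cases h1 : D₁ z = 0
    · have h2 : D₂ z ≠ 0 := fun h2 => h0 z h2 h1
      refine ((hN₂ z).div (hD₂ z) h2).congr_of_eventuallyEq ?_
      filter_upwards [hD₂.continuous.continuousAt.eventually_ne h2] with w hw
      exact hd w hw
    · refine ((hN₁ z).div (hD₁ z) h1).congr_of_eventuallyEq ?_
      filter_upwards [hD₁.continuous.continuousAt.eventually_ne h1] with w hw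
      simp [hw]
  · by_cases h1 : D₁ z = 0
    · have h2 : D₂ z ≠ 0 := fun h2 => h0 z h2 h1
      have h3 := h z
      rw [h1, mul_zero] at h3
      rw [h1, mul_zero, (mul_eq_zero.1 h3).resolve_right h2]
    · simp only [ne_eq, h1, not_false_eq_true, if_true]
      field_simp

/-- The entries are entire functions of growth order at most one half. -/
def EntireHalfGrowth (A : ℂ → Matrix (Fin 3) (Fin 3) ℂ) : Prop :=
  ∀ i j, (Differentiable ℂ fun z => A z i j) ∧ HalfGrowth fun z => A z i j

theorem EntireHalfGrowth.mul {A B : ℂ → Matrix (Fin 3) (Fin 3) ℂ} (hA : EntireHalfGrowth A)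
    (hB : EntireHalfGrowth B) : EntireHalfGrowth fun z => A z * B z := by
  intro i j
  simp only [Matrix.mul_apply, Fin.sum_univ_three]
  exact ⟨(((hA i 0).1.mul (hB 0 j).1).add ((hA i 1).1.mul (hB 1 j).1)).add
    ((hA i 2).1.mul (hB 2 j).1), (((hA i 0).2.mul (hB 0 j).2).add ((hA i 1).2.mul (hB 1 j).2)).add
    ((hA i 2).2.mul (hB 2 j).2)⟩

variable {p q : ℝ → ℂ} (hp : IntervalIntegrable p volume 0 1) (hq : IntervalIntegrable q volume 0 1)

theorem entireHalfGrowth_fund (x : unitInterval) : EntireHalfGrowth fun z => fund hp z x :=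
  fun i j => ⟨differentiable_fund hp x i j, halfGrowth_fund hp x i j⟩

theorem entireHalfGrowth_fundInv (x : unitInterval) : EntireHalfGrowth fun z => fundInv hp z x := by
  have h1 : ∀ i j, (Differentiable ℂ fun z => fund hp (-z) x i j) ∧
      HalfGrowth fun z => fund hp (-z) x i j := fun i j =>
    ⟨(differentiable_fund hp x i j).comp differentiable_neg, (halfGrowth_fund hp x i j).comp_neg⟩
  have h2 : ∀ i j, (Differentiable ℂ fun z => -fund hp (-z) x i j) ∧
      HalfGrowth fun z => -fund hp (-z) x i j := fun i j =>
    ⟨(h1 i j).1.neg, by simpa using (HalfGrowth.const (-1)).mul (h1 i j).2⟩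
  intro i j
  fin_cases i <;> fin_cases j <;> first | exact h1 _ _ | exact h2 _ _

theorem entireHalfGrowth_shearMatrix {d : ℂ → ℂ} (hd : Differentiable ℂ d) (gd : HalfGrowth d) :
    EntireHalfGrowth fun z => shearMatrix (d z) := by
  intro i j
  fin_cases i <;> fin_cases j <;>
    first | exact ⟨hd, gd⟩ | exact ⟨differentiable_const _, HalfGrowth.const _⟩

theorem exists_endSol_two_ne_zero : ∃ lam, endSol hp lam 2 ≠ 0 := by
  obtain ⟨Ψ, hΨ⟩ := exists_isWeylFamily hp isCubeRoots_I
  have h20 := mul_ne_zero (pow_ne_zero 2 (isCubeRoots_I.root_ne_zero 0))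
    (isCubeRoots_I.sub_ne_zero (j := 2) (k := 1) (by decide))
  obtain ⟨s, hs⟩ := (hΨ.eventually_endSol_ne_zero hp h20 hΨ.tendsto_left_two_zero).exists
  exact ⟨_, hs⟩

/-- Separation removes the poles of d, and `HalfGrowth.of_mul_eq` bounds its growth. The first row
of the transition matrix is then entire of order below one with limits on the imaginary axis, hence
constant. -/
theorem exists_transitionMatrix_zero_eq (hW : Separated p)
    (hb1 : ∀ lam, endSol hp lam 1 = endSol hq lam 1)
    (hb2 : ∀ lam, endSol hp lam 2 = endSol hq lam 2) :
    ∃ d : ℂ → ℂ, ∀ lam (x : unitInterval), (x : ℝ) ∈ Ioo (0 : ℝ) 1 → ∀ j,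
      transitionMatrix hp hq d lam x 0 j = (1 : Matrix (Fin 3) (Fin 3) ℂ) 0 j := by
  have hT0 : ∀ lam, fund hp lam 1 0 0 = fund hq lam 1 0 0 := fun lam => by
    simpa [endSol_two] using hb2 (-lam)
  have hT1 : ∀ lam, fund hp lam 1 0 1 = fund hq lam 1 0 1 := fun lam => by
    simpa [endSol_one] using hb1 (-lam)
  have hN := (differentiable_endSol hp 0).sub (differentiable_endSol hq 0)
  -- The second representation of d comes from subtracting the first rows of `fund` 1 · `endSol` =
  -- (0, 0, 1) for p and q: the terms with b 1 cancel, since the entries involved agree.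
  obtain ⟨d, hd, hdb⟩ := exists_entire_of_mul_eq_mul (differentiable_endSol hp 2)
    (differentiable_fund hp 1 0 0) hN
    ((differentiable_fund hq 1 0 2).sub (differentiable_fund hp 1 0 2)) (fun z => by
      have e := congr_fun (fund_one_mulVec_endSol hp z) 0
      have e' := congr_fun (fund_one_mulVec_endSol hq z) 0
      simp [Matrix.mulVec, dotProduct, Fin.sum_univ_three] at e e'
      rw [← hT0, ← hT1, ← hb1, ← hb2] at e'
      simp only [Pi.sub_apply]
      linear_combination e - e') (fun z => hW.endSol_two_ne_zero hp z)
  obtain ⟨c, hc⟩ := exists_endSol_two_ne_zero hp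
  have gd : HalfGrowth d := HalfGrowth.of_mul_eq hd (differentiable_endSol hp 2) hN hdb hc
    (halfGrowth_endSol hp 2) (by
      have := (halfGrowth_endSol hp 0).add ((HalfGrowth.const (-1)).mul (halfGrowth_endSol hq 0))
      simp only [neg_one_mul, ← sub_eq_add_neg] at this
      exact this)
  refine ⟨d, fun lam x hx j => ?_⟩
  have hP : EntireHalfGrowth fun z => transitionMatrix hp hq d z x :=
    ((entireHalfGrowth_fund hp x).mul (entireHalfGrowth_shearMatrix hd gd)).mul
      (entireHalfGrowth_fundInv hq x)
  exact (hP 0 j).2.eq_const (hP 0 j).1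
    (tendsto_transitionMatrix hp hq isCubeRoots_I hb1 hb2 hdb hx j)
    (tendsto_transitionMatrix hp hq isCubeRoots_neg_I hb1 hb2 hdb hx j) lam

/-! ### Recovering the coefficient -/

/-- Equal zeroth components give equal first ones, and then f₂ - g₂ = (p - q) g₀ almost everywhere.
The function (f₂ - g₂) g₀ is absolutely continuous with derivative -(p - q) g₁ g₀ + (f₂ - g₂) g₁ = 0
and vanishes at 0. -/
theorem SolvesSystem.ae_sub_mul_sq_eq_zero {lam : ℂ} {f g : C(unitInterval, Fin 3 → ℂ)}
    (hf : SolvesSystem p lam (ext f)) (hg : SolvesSystem q lam (ext g))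
    (h : ∀ x : unitInterval, (x : ℝ) ∈ Ioo (0 : ℝ) 1 → f x 0 = g x 0) (h2 : f 0 2 = g 0 2) :
    ∀ᵐ x : ℝ, x ∈ Ioo (0 : ℝ) 1 → (p x - q x) * ext g x 0 ^ 2 = 0 := by
  have hext : ∀ {i : Fin 3}, (∀ x : unitInterval, (x : ℝ) ∈ Ioo (0 : ℝ) 1 → f x i = g x i) →
      ∀ x ∈ Ioo (0 : ℝ) 1, ext f x i = ext g x i := fun hi x hx => by
    rw [ext_of_mem f (Ioo_subset_Icc_self hx), ext_of_mem g (Ioo_subset_Icc_self hx)]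
    exact hi _ hx
  have hev : ∀ {i : Fin 3}, (∀ x ∈ Ioo (0 : ℝ) 1, ext f x i = ext g x i) → ∀ x ∈ Ioo (0 : ℝ) 1,
      (fun y => ext f y i) =ᶠ[𝓝 x] fun y => ext g y i := fun hi x hx =>
    eventually_of_mem (Ioo_mem_nhds hx.1 hx.2) hi
  have e0 := hext h
  have hf' : ∀ᵐ x : ℝ, x ∈ Ioo (0 : ℝ) 1 → ∀ i, HasDerivAt (fun y => ext f y i)
      (coef p lam x (ext f x) i) x := by
    filter_upwards [hf.2] with x hx hx1 using hasDerivAt_pi.1 (hx hx1)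
  have hg' : ∀ᵐ x : ℝ, x ∈ Ioo (0 : ℝ) 1 → ∀ i, HasDerivAt (fun y => ext g y i)
      (coef q lam x (ext g x) i) x := by
    filter_upwards [hg.2] with x hx hx1 using hasDerivAt_pi.1 (hx hx1)
  have hcont : ∀ (f : C(unitInterval, Fin 3 → ℂ)) i, Continuous fun x => f x i := fun f i =>
    (continuous_apply i).comp f.continuous
  have e1 : ∀ x ∈ Ioo (0 : ℝ) 1, ext f x 1 = ext g x 1 := by
    have h3 : (fun x : unitInterval => f x 1 - g x 1) = 0 := by
      refine eq_zero_of_ae_Ioo ((hcont f 1).sub (hcont g 1)) ?_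
      filter_upwards [hf', hg'] with x hx hx' hx1
      have h4 := ((hx hx1 0).congr_of_eventuallyEq (hev e0 x hx1).symm).unique (hx' hx1 0)
      rw [coef_apply, coef_apply, ext_of_mem f (Ioo_subset_Icc_self hx1),
        ext_of_mem g (Ioo_subset_Icc_self hx1)] at h4
      exact sub_eq_zero.2 h4
    exact hext fun x _ => sub_eq_zero.1 (congr_fun h3 x)
  have hv : ∀ᵐ x : ℝ, x ∈ Ioo (0 : ℝ) 1 →
      ext f x 2 - ext g x 2 = (p x - q x) * ext g x 0 := by
    filter_upwards [hf', hg'] with x hx hx' hx1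
    have h4 := ((hx hx1 1).congr_of_eventuallyEq (hev e1 x hx1).symm).unique (hx' hx1 1)
    rw [coef_apply, coef_apply] at h4
    simp only [Matrix.cons_val_one, Matrix.cons_val_zero, e0 x hx1] at h4
    linear_combination h4
  have hac : AbsolutelyContinuousOnInterval
      (fun x => (ext f x 2 - ext g x 2) * ext g x 0) 0 1 :=
    ((absolutelyContinuousOnInterval_pi.1 hf.1 2).sub
      (absolutelyContinuousOnInterval_pi.1 hg.1 2)).smul (absolutelyContinuousOnInterval_pi.1 hg.1 0)
  have hz : IntervalIntegrable (fun _ : ℝ => (0 : ℂ)) volume 0 1 := intervalIntegrable_const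
  have hconst := (ac_and_hasDerivAt_iff hz (left_mem_Icc.2 zero_le_one)).1 ⟨hac, by
    filter_upwards [hf', hg', hv] with x hx hx' hvx hx1
    refine (((hx hx1 2).sub (hx' hx1 2)).mul (hx' hx1 0)).congr_deriv ?_
    rw [coef_apply, coef_apply]
    simp only [Matrix.cons_val, Pi.sub_apply, e0 x hx1, e1 x hx1, hvx hx1]
    ring⟩
  filter_upwards [hv] with x hx hx1
  have h5 := hconst x (Ioo_subset_Icc_self hx1)
  rw [ext_of_mem f (left_mem_Icc.2 zero_le_one), ext_of_mem g (left_mem_Icc.2 zero_le_one)] at h5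
  have h6 : f ⟨0, left_mem_Icc.2 zero_le_one⟩ 2 = g ⟨0, left_mem_Icc.2 zero_le_one⟩ 2 := h2
  rw [h6, sub_self, zero_mul, intervalIntegral.integral_zero, add_zero, hx hx1] at h5
  linear_combination h5

theorem ae_eq_of_endSol_eq (hW : Separated p)
    (hb1 : ∀ lam, endSol hp lam 1 = endSol hq lam 1)
    (hb2 : ∀ lam, endSol hp lam 2 = endSol hq lam 2) :
    ∀ᵐ x : ℝ, x ∈ Ioo (0 : ℝ) 1 → p x = q x := by
  obtain ⟨d, hd⟩ := exists_transitionMatrix_zero_eq hp hq hW hb1 hb2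
  -- The single value lam = 0 suffices. The shear leaves the third component of the initial vectors
  -- unchanged, as the comparison of the solutions requires.
  have hrow : ∀ x : unitInterval, (x : ℝ) ∈ Ioo (0 : ℝ) 1 → ∀ j,
      (fund hp 0 x * shearMatrix (d 0)) 0 j = fund hq 0 x 0 j := by
    intro x hx j
    have h1 : transitionMatrix hp hq d 0 x * fund hq 0 x = fund hp 0 x * shearMatrix (d 0) := by
      rw [transitionMatrix, Matrix.mul_assoc, fundInv_mul_fund, Matrix.mul_one]
    rw [← h1, Matrix.mul_apply, Fin.sum_univ_three, hd 0 x hx, hd 0 x hx, hd 0 x hx]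
    simp
  have hk : ∀ k : Fin 3, ∀ᵐ x : ℝ, x ∈ Ioo (0 : ℝ) 1 →
      (p x - q x) * ext (sol hq 0 0 (Pi.single k 1)) x 0 ^ 2 = 0 := by
    intro k
    refine (solvesSystem_sol hp 0 (Or.inl rfl) fun i => shearMatrix (d 0) i k).ae_sub_mul_sq_eq_zero
      (solvesSystem_sol hq 0 (Or.inl rfl) (Pi.single k 1)) (fun x hx => ?_) ?_
    · rw [sol_zero_apply]
      exact hrow x hx k
    · rw [sol_self hp 0 (Or.inl rfl), sol_self hq 0 (Or.inl rfl)]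
      fin_cases k <;> simp [shearMatrix]
  -- Where p ≠ q, all three solutions for q would vanish, which is impossible for a row of an
  -- invertible matrix.
  filter_upwards [ae_all_iff.2 hk] with x hx hx1
  by_contra hne
  have h0 : ∀ k, fund hq 0 ⟨x, Ioo_subset_Icc_self hx1⟩ 0 k = 0 := fun k => by
    have h1 := (mul_eq_zero.1 (hx k hx1)).resolve_left (sub_ne_zero.2 hne)
    rw [ext_of_mem _ (Ioo_subset_Icc_self hx1)] at h1
    exact pow_eq_zero_iff two_ne_zero |>.1 h1
  have h1 := congr_fun (congr_fun (fund_mul_fundInv hq 0 ⟨x, Ioo_subset_Icc_self hx1⟩) 0) 0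
  simp [Matrix.mul_apply, h0] at h1

end ThirdOrder
end

theorem theorem2p3 (p q : ℝ → ℂ)
    (hp : MeasureTheory.IntegrableOn p (Set.Ioo 0 1) MeasureTheory.volume)
    (hq : MeasureTheory.IntegrableOn q (Set.Ioo 0 1) MeasureTheory.volume)
    (hpW : ThirdOrder.Separated p) (hqW : ThirdOrder.Separated q)
    (h1 : ∀ lam : ℂ, ThirdOrder.spectrumMult p 0 lam = ThirdOrder.spectrumMult q 0 lam)
    (h2 : ∀ lam : ℂ, ThirdOrder.spectrumMult p 1 lam = ThirdOrder.spectrumMult q 1 lam) :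
    p =ᵐ[MeasureTheory.volume.restrict (Set.Ioo 0 1)] q := by
  have ip := ThirdOrder.intervalIntegrable_of_integrableOn_Ioo hp
  have iq := ThirdOrder.intervalIntegrable_of_integrableOn_Ioo hq
  exact (MeasureTheory.ae_restrict_iff' measurableSet_Ioo).2
    (ThirdOrder.ae_eq_of_endSol_eq ip iq hpW
      (ThirdOrder.endSol_eq_of_spectrumMult_eq ip iq (Or.inr rfl) h2)
      (ThirdOrder.endSol_eq_of_spectrumMult_eq ip iq (Or.inl rfl) h1))
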